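/- Let $d\ge 2$, and for $k\ge 1$ let $\omega_k$ denote the $(k-1)$-dimensional volume of the unit sphere in $\mathbb{R}^k$ (so $\omega_1=2$). The equation $$2\,\omega_d\int_1^2 (t-1)^{d-1}\,t^{-s}\,dt=\frac{\omega_{d-1}}{d-1}\int_0^2\bigl(1-(t/2)^2\bigr)^{\frac{d-1}{2}}\,t^{-s}\,dt$$ has exactly one solution $s=s(d)$ in $(0,1)$, and there is a constant $C=C(d)\in(0,\infty)$ such that the following holds. Let $\mathcal R$ (red points) and $\mathcal B$ (blue points) be independent Poisson point processes of intensity $1$ in $\mathbb{R}^d$. A partial matching between $\mathcal R$ and $\mathcal B$ is a set of red-blue pairs in which every point occurs at most once; $M(x)$ denotes the partner of $x$, and $|x-M(x)|:=\infty$ if $x$ is unmatched. It is stable if there are no red point $x$ and blue point $y$ with $|x-y|<\min\{|x-M(x)|,|y-M(y)|\}$. Almost surely there is exactly one stable partial matching $M$ between $\mathcal R$ and $\mathcal B$, and it is perfect (every point is matched). Let $X$ be the distance from a typical red point to its partner in the two-color stable matching $M$, that is, $$\mathbb P^*(X\in A)=\mathbb E\,\#\bigl\{x\in\mathcal R\cap[0,1)^d:\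 |x-M(x)|\in A\bigr\}.$$ Then $$\mathbb P^*(X>r)\le C\,r^{-s}\qquad\text{for all } r>0 .$$ -/

import Mathlib

open MeasureTheory ProbabilityTheory
open scoped ENNReal NNReal

noncomputable section

namespace StableMatching

/-- Euclidean space `ℝᵈ`. -/
abbrev Space (d : ℕ) : Type := EuclideanSpace ℝ (Fin d)

/-- A simple, locally finite point configuration in `ℝᵈ`, identified with its support. -/
@[ext]
structure Configuration (d : ℕ) where
  /-- The set of points of the configuration. -/
  points : Set (Space d)
  /-- Every bounded region contains only finitely many points. -/
  locallyFinite : ∀ A : Set (Space d), Bornology.IsBounded A → (points ∩ A).Finite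

/-- The number of points of a configuration in a region. -/
def Configuration.count {d : ℕ} (c : Configuration d) (A : Set (Space d)) : ℕ∞ :=
  (c.points ∩ A).encard

/-- The σ-algebra on configurations generated by the counts in Borel regions. -/
instance (d : ℕ) : MeasurableSpace (Configuration d) :=
  ⨆ (A : Set (Space d)) (_ : MeasurableSet A),
    MeasurableSpace.comap (fun c : Configuration d => c.count A) inferInstance

/-- `R` is a homogeneous Poisson point process of intensity `lam` on `ℝᵈ`: the number of points in
a Borel set of finite volume is Poisson with mean `lam` times the volume, and the numbers
of points in finitely many pairwise disjoint Borel sets are independent. -/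
structure IsPoissonProcess {Ω : Type*} [MeasurableSpace Ω] {d : ℕ}
    (R : Ω → Configuration d) (lam : ℝ≥0) (P : Measure Ω) : Prop where
  measurable : Measurable R
  law_count : ∀ A : Set (Space d), MeasurableSet A → volume A < ∞ →
    P.map (fun ω => (R ω).count A) =
      (poissonMeasure (lam * (volume A).toNNReal)).map (fun n : ℕ => (n : ℕ∞))
  indep_count : ∀ (n : ℕ) (A : Fin n → Set (Space d)), (∀ i, MeasurableSet (A i)) →
    Pairwise (fun i j => Disjoint (A i) (A j)) →
    iIndepFun (fun i ω => (R ω).count (A i)) P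

/-- `m` is a two-color partial matching between the red set `U` and the blue set `V`.
An edge between the red point `x` and the blue point `y` is recorded as the pair `(x, y)`. -/
structure IsPartialMatching {d : ℕ} (U V : Set (Space d)) (m : Set (Space d × Space d)) :
    Prop where
  mem : ∀ x y, (x, y) ∈ m → x ∈ U ∧ y ∈ V
  blue_unique : ∀ x y y', (x, y) ∈ m → (x, y') ∈ m → y = y'
  red_unique : ∀ x x' y, (x, y) ∈ m → (x', y) ∈ m → x = x'

/-- The distance `|x - m(x)|` from a red point to its partner; it is `∞` if `x` is unmatched. -/
def redDist {d : ℕ} (m : Set (Space d × Space d)) (x : Space d) : ℝ≥0∞ :=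
  ⨅ (y : Space d) (_ : (x, y) ∈ m), edist x y

/-- The distance `|y - m(y)|` from a blue point to its partner; it is `∞` if `y` is unmatched. -/
def blueDist {d : ℕ} (m : Set (Space d × Space d)) (y : Space d) : ℝ≥0∞ :=
  ⨅ (x : Space d) (_ : (x, y) ∈ m), edist x y

/-- A stable partial matching between `U` and `V`: no red point and blue point
are strictly closer to each other than each of them is to its own partner. -/
structure IsStablePartialMatching {d : ℕ} (U V : Set (Space d)) (m : Set (Space d × Space d)) :
    Prop extends IsPartialMatching U V m where
  stable : ¬ ∃ x ∈ U, ∃ y ∈ V, edist x y < min (redDist m x) (blueDist m y)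

/-- Every red point and every blue point is matched. -/
def IsPerfect {d : ℕ} (U V : Set (Space d)) (m : Set (Space d × Space d)) : Prop :=
  (∀ x ∈ U, ∃ y, (x, y) ∈ m) ∧ (∀ y ∈ V, ∃ x, (x, y) ∈ m)

/-- The half-open unit cube `[0,1)ᵈ`. -/
def unitCube (d : ℕ) : Set (Space d) := {x | ∀ i, 0 ≤ x i ∧ x i < 1}

/-- The Palm probability `P*(X ∈ A)`, where `X` is the distance from a typical red point to its
partner: the expected number of red points `x` in the unit cube with `|x - M(x)| ∈ A`
(for a red process `R` of intensity one). -/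
def palmProb {Ω : Type*} [MeasurableSpace Ω] {d : ℕ} (P : Measure Ω) (R : Ω → Configuration d)
    (M : Ω → Set (Space d × Space d)) (A : Set ℝ≥0∞) : ℝ≥0∞ :=
  ∫⁻ ω, (({x ∈ (R ω).points ∩ unitCube d | redDist (M ω) x ∈ A}.encard : ℕ∞) : ℝ≥0∞) ∂P

/-- `ω_d`: the `(d-1)`-dimensional volume of the unit sphere in `ℝᵈ`. -/
def sphereVolume (d : ℕ) : ℝ :=
  ((volume : Measure (Space d)).toSphere Set.univ).toReal

/-- The equation that determines the exponent `s(d)`. -/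
def ExponentEquation (d : ℕ) (s : ℝ) : Prop :=
  2 * sphereVolume d * ∫ t in (1 : ℝ)..2, (t - 1) ^ (d - 1) * t ^ (-s) =
    sphereVolume (d - 1) / ((d : ℝ) - 1) *
      ∫ t in (0 : ℝ)..2, (1 - (t / 2) ^ 2) ^ (((d : ℝ) - 1) / 2) * t ^ (-s)

end StableMatching

end

/-! Let F(t) be the probability that a typical point is at distance at least t from its partner,
being unmatched counting as distance ∞. Let D be the ball of radius r about 0. A red x and a blue y
in D whose partners are at distance at least r + |x| and r + |y| would both prefer each other, since
|x - y| < r + |x| and |x - y| < r + |y|. So one colour, say blue, has all its points in D matched at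
distance below r + |y|, while every red point of D with partner in D is matched at distance below r
+ |x|. Counting gives `IsSolution.ball_inequality`. In expectation the counts cost only Poisson
fluctuations of order r^(d/2). Pairs inside D are counted through the volume of the lens D ∩ (D - z)
(`volume_lens`). The volumes of D cancel, and `IsDisplacement.tail_inequality` says that ∫₀² K(t)
F(rt) dt ≤ c/r for r ≥ 1, with K = `exponentKernel`.

K is strictly increasing on [0, 2] and changes sign once, at some t₀ in (1, 2). The exponent
equation is ∫₀² K(t) t^(-s) dt = 0; the single sign change gives uniqueness, and comparing s = 0
with s near 1 gives existence. Integrating the tail inequality against r^(s-1) over [1, ρ] yields a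
bound on ∫ K(t) t^(-s) Φ(ρt) dt with Φ(x) = ∫₀ˣ u^(s-1) F(u) du. By the exponent equation Φ(ρt₀) may
be subtracted from Φ(ρt) for free. The integrand is then nonnegative, and its part near t = 2
already dominates a multiple of ρ^s F(2ρ) (`exists_decay`).

Stable matchings are handled through the fixed point equations `IsSolution` for the partner
distances. Monotone iteration (Gale–Shapley) produces extremal solutions that are measurable and
translation covariant. The solution best for red is worst for blue, but by mass transport both
colours have the same distance law, so the extremal solutions agree almost surely
(`IsDisplacement.ae_eq`) and the matching is unique. It is perfect because F tends to 0. -/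

noncomputable section

/-! ### Configurations as counting measures, and measurability. -/

namespace StableMatching

variable {d : ℕ}

lemma Configuration.countable (c : Configuration d) : c.points.Countable := by
  have h : c.points = ⋃ n : ℕ, c.points ∩ Metric.closedBall 0 n := by
    rw [← Set.inter_iUnion, Metric.iUnion_closedBall_nat, Set.inter_univ]
  rw [h]
  exact Set.countable_iUnion fun n => (c.locallyFinite _ Metric.isBounded_closedBall).countable

lemma Configuration.measurableSet (c : Configuration d) : MeasurableSet c.points :=
  c.countable.measurableSet

lemma measurable_count {A : Set (Space d)} (hA : MeasurableSet A) :
    Measurable (fun c : Configuration d => c.count A) := by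
  refine measurable_iff_comap_le.mpr ?_
  exact le_iSup₂_of_le (f := fun (A : Set (Space d)) (_ : MeasurableSet A) =>
    MeasurableSpace.comap (fun c : Configuration d => c.count A) inferInstance) A hA le_rfl

/-- The counting measure on the points of a configuration. -/
def Configuration.toMeasure (c : Configuration d) : Measure (Space d) :=
  Measure.count.restrict c.points

lemma Configuration.toMeasure_apply (c : Configuration d) {A : Set (Space d)}
    (hA : MeasurableSet A) : c.toMeasure A = ((c.count A : ℕ∞) : ℝ≥0∞) := by
  rw [Configuration.toMeasure, Measure.restrict_apply hA,
    Measure.count_apply (hA.inter c.measurableSet), Set.inter_comm]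
  rfl

lemma Configuration.count_ne_top (c : Configuration d) {A : Set (Space d)}
    (hA : Bornology.IsBounded A) : c.count A ≠ ⊤ := by
  rw [Configuration.count, Set.encard_ne_top_iff]
  exact c.locallyFinite A hA

lemma Configuration.lintegral_toMeasure (c : Configuration d) (f : Space d → ℝ≥0∞) :
    ∫⁻ x, f x ∂c.toMeasure = ∑' x : c.points, f x := by
  rw [Configuration.toMeasure]
  have := c.countable.to_subtype
  rw [lintegral_countable _ c.countable]
  simp

lemma Configuration.ae_toMeasure (c : Configuration d) (p : Space d → Prop) :
    (∀ᵐ x ∂c.toMeasure, p x) ↔ ∀ x ∈ c.points, p x := by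
  rw [Configuration.toMeasure, ae_restrict_iff' c.measurableSet]
  simp [ae_iff, Measure.count_eq_zero_iff, Set.eq_empty_iff_forall_notMem]

/-- The counting measures of configurations as a kernel. -/
def pointKernel (d : ℕ) : Kernel (Configuration d) (Space d) where
  toFun := Configuration.toMeasure
  measurable' := by
    refine Measure.measurable_of_measurable_coe _ fun A hA => ?_
    simp_rw [Configuration.toMeasure_apply _ hA]
    exact Measurable.of_discrete.comp (measurable_count hA)

lemma pointKernel_apply (c : Configuration d) : pointKernel d c = c.toMeasure := rfl

/-- The counts have no uniform bound, so the kernel is cut both by bounded shells of space and by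
the value of the count in each shell; a piece has mass at most that value. -/
instance : IsSFiniteKernel (pointKernel d) := by
  classical
  let A : ℕ → Set (Space d) := disjointed fun n => Metric.closedBall 0 n
  have hA : ∀ n, MeasurableSet (A n) :=
    fun n => MeasurableSet.disjointed (fun n => measurableSet_closedBall) n
  have hb : ∀ n, Bornology.IsBounded (A n) :=
    fun n => Metric.isBounded_closedBall.subset (disjointed_subset _ n)
  have hU : ⋃ n, A n = Set.univ := by
    rw [iUnion_disjointed, Metric.iUnion_closedBall_nat]
  have hd : Pairwise (Function.onFun Disjoint A) := disjoint_disjointed _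
  have hm : ∀ n (k : ℕ), MeasurableSet {c : Configuration d | c.count (A n) = k} :=
    fun n k => measurable_count (hA n) (measurableSet_singleton _)
  let η : ℕ × ℕ → Kernel (Configuration d) (Space d) := fun p =>
    Kernel.piecewise (hm p.1 p.2) ((pointKernel d).restrict (hA p.1)) 0
  have hη : ∀ p, IsFiniteKernel (η p) := by
    intro p
    refine ⟨p.2, by simp, fun c => ?_⟩
    rw [Kernel.piecewise_apply]
    split_ifs with h
    · rw [Kernel.restrict_apply, Measure.restrict_apply_univ, pointKernel_apply,
        c.toMeasure_apply (hA _)]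
      simp only [Set.mem_ofPred_eq] at h
      rw [h]; simp
    · simp
  have : pointKernel d = Kernel.sum η := by
    ext c s hs
    rw [Kernel.sum_apply' _ _ hs, ENNReal.tsum_prod']
    have : ∀ n, ∑' k, η (n, k) c s = pointKernel d c (s ∩ A n) := by
      intro n
      obtain ⟨k, hk⟩ := ENat.ne_top_iff_exists.mp (c.count_ne_top (hb n))
      rw [tsum_eq_single k]
      · have hmem : c ∈ {c : Configuration d | c.count (A n) = k} := hk.symm
        rw [Kernel.piecewise_apply, if_pos hmem, Kernel.restrict_apply,
          Measure.restrict_apply hs]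
      · intro k' hk'
        rw [Kernel.piecewise_apply, if_neg]
        · simp
        · intro h
          simp only [Set.mem_ofPred_eq] at h
          rw [← hk] at h
          exact hk' (by exact_mod_cast h.symm)
    simp_rw [this]
    rw [← measure_iUnion (fun i j hij => (hd hij).mono Set.inter_subset_right
      Set.inter_subset_right) (fun n => hs.inter (hA n)), ← Set.inter_iUnion, hU, Set.inter_univ]
  rw [this]
  infer_instance

/-- The infimum of a jointly measurable function over the points of a configuration
is measurable. -/
lemma measurable_iInf_points {α : Type*} [MeasurableSpace α] {c : α → Configuration d}
    (hc : Measurable c) {g : α → Space d → ℝ≥0∞} (hg : Measurable (Function.uncurry g)) :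
    Measurable (fun w => ⨅ y ∈ (c w).points, g w y) := by
  refine measurable_of_Iio fun t => ?_
  -- The infimum is below `t` exactly when the number of points with `g < t` is nonzero, and that
  -- number is a kernel integral. No measurable enumeration of the points is needed.
  have : (fun w => ⨅ y ∈ (c w).points, g w y) ⁻¹' Set.Iio t =
      {w | ∫⁻ y, Set.indicator {p : α × Space d | g p.1 p.2 < t} 1 (w, y)
        ∂((pointKernel d).comap c hc w) ≠ 0} := by
    ext w
    simp only [Set.mem_preimage, Set.mem_Iio, Set.mem_ofPred_eq, Kernel.comap_apply,
      pointKernel_apply, Configuration.lintegral_toMeasure, ne_eq, ENNReal.tsum_eq_zero]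
    simp [iInf_lt_iff, Set.indicator_apply]
  rw [this]
  have hm : MeasurableSet {p : α × Space d | g p.1 p.2 < t} := hg measurableSet_Iio
  refine (measurableSet_singleton (0 : ℝ≥0∞)).compl.preimage ?_
  exact Measurable.lintegral_kernel_prod_right'
    (κ := (pointKernel d).comap c hc) ((measurable_one).indicator hm)

/-- The translate of a configuration. -/
def Configuration.shift (v : Space d) (c : Configuration d) : Configuration d where
  points := (fun x => x - v) ⁻¹' c.points
  locallyFinite A hA := by
    have hb : Bornology.IsBounded ((fun x => x - v) '' A) := by
      have := (LipschitzWith.id (α := Space d)).sub (LipschitzWith.const v)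
      exact this.isBounded_image hA
    refine Set.Finite.of_finite_image (f := fun x => x - v) ?_ (sub_left_injective.injOn)
    refine (c.locallyFinite _ hb).subset ?_
    rintro _ ⟨x, ⟨hx, hA⟩, rfl⟩
    exact ⟨hx, x, hA, rfl⟩

lemma Configuration.mem_shift {v : Space d} {c : Configuration d} {x : Space d} :
    x ∈ (c.shift v).points ↔ x - v ∈ c.points := Iff.rfl

lemma Configuration.shift_count (v : Space d) (c : Configuration d) (A : Set (Space d)) :
    (c.shift v).count A = c.count ((fun x => x + v) ⁻¹' A) := by
  rw [Configuration.count, Configuration.count,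
    ← (sub_left_injective (b := v)).encard_image ((c.shift v).points ∩ A)]
  congr 1
  ext x
  constructor
  · rintro ⟨y, ⟨hy, hA⟩, rfl⟩
    exact ⟨hy, by simpa using hA⟩
  · rintro ⟨hx, hA⟩
    exact ⟨x + v, ⟨by simpa [Configuration.mem_shift] using hx, hA⟩, by simp⟩

/-- Bounded regions suffice because every count is the increasing limit of the counts inside large
balls. -/
lemma measurable_configuration {α : Type*} [MeasurableSpace α] {f : α → Configuration d}
    (h : ∀ A : Set (Space d), MeasurableSet A → Bornology.IsBounded A →
      Measurable fun w => (f w).count A) : Measurable f := by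
  have key : ∀ A : Set (Space d), MeasurableSet A → Measurable fun w => (f w).count A := by
    intro A hA
    have : (fun w => (f w).count A) = fun w => ⨆ n : ℕ, (f w).count (A ∩ Metric.closedBall 0 n) := by
      funext w
      have h1 : A = ⋃ n : ℕ, A ∩ Metric.closedBall 0 n := by
        rw [← Set.inter_iUnion, Metric.iUnion_closedBall_nat, Set.inter_univ]
      have hmono : Monotone fun n : ℕ => A ∩ Metric.closedBall (0 : Space d) n := fun i j hij =>
        Set.inter_subset_inter_right _ (Metric.closedBall_subset_closedBall (by exact_mod_cast hij))
      have h2 := (hmono.measure_iUnion (μ := (f w).toMeasure))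
      rw [← h1, (f w).toMeasure_apply hA] at h2
      have h3 : ∀ n : ℕ, (f w).toMeasure (A ∩ Metric.closedBall 0 n) =
          (((f w).count (A ∩ Metric.closedBall 0 n) : ℕ∞) : ℝ≥0∞) :=
        fun n => (f w).toMeasure_apply (hA.inter measurableSet_closedBall)
      simp_rw [h3] at h2
      rw [← ENat.toENNReal_iSup] at h2
      exact_mod_cast h2
    rw [this]
    have hm : Measurable fun w => ⨆ n : ℕ,
        (((f w).count (A ∩ Metric.closedBall 0 n) : ℕ∞) : ℝ≥0∞) :=
      Measurable.iSup fun n => Measurable.of_discrete.comp (h _ (hA.inter measurableSet_closedBall)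
        (Metric.isBounded_closedBall.subset Set.inter_subset_right))
    simp_rw [← ENat.toENNReal_iSup] at hm
    refine measurable_to_countable' fun k => ?_
    convert hm (measurableSet_singleton (k : ℝ≥0∞)) using 1
    ext w
    simp only [Set.mem_preimage, Set.mem_singleton_iff, ENat.toENNReal_inj]
  refine measurable_iff_comap_le.mpr ?_
  change MeasurableSpace.comap f (⨆ (A : Set (Space d)) (_ : MeasurableSet A),
    MeasurableSpace.comap (fun c : Configuration d => c.count A) inferInstance) ≤ _
  rw [MeasurableSpace.comap_iSup]
  refine iSup_le fun A => ?_
  rw [MeasurableSpace.comap_iSup]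
  refine iSup_le fun hA => ?_
  rw [MeasurableSpace.comap_comp]
  exact (key A hA).comap_le

lemma measurable_shift (v : Space d) : Measurable (Configuration.shift v) := by
  refine measurable_configuration fun A hA _ => ?_
  simp_rw [Configuration.shift_count]
  exact measurable_count (measurable_id.add_const v hA)

lemma Configuration.lintegral_shift (v : Space d) (c : Configuration d) (f : Space d → ℝ≥0∞) :
    ∫⁻ x, f x ∂(c.shift v).toMeasure = ∫⁻ x, f (x + v) ∂c.toMeasure := by
  rw [Configuration.lintegral_toMeasure, Configuration.lintegral_toMeasure]
  let e : c.points ≃ (c.shift v).points :=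
    { toFun := fun x => ⟨x + v, by simp [Configuration.mem_shift]⟩
      invFun := fun x => ⟨x - v, x.2⟩
      left_inv := fun x => by simp
      right_inv := fun x => by simp }
  exact (e.tsum_eq (fun x : (c.shift v).points => f x)).symm

end StableMatching

/-! ### The law of a Poisson process: uniqueness and stationarity. -/

namespace StableMatching

variable {d : ℕ}

section Law

variable {Ω Ω' : Type*} [MeasurableSpace Ω] [MeasurableSpace Ω'] {P : Measure Ω} {P' : Measure Ω'}
  {R : Ω → Configuration d} {R' : Ω' → Configuration d} {lam : ℝ≥0}

/-- The cells of the partition of `⋃ i, A i` generated by the sets `A i`. -/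
def partitionCell {ι : Type*} (A : ι → Set (Space d)) (S : Finset ι) : Set (Space d) :=
  {x | (∃ i, x ∈ A i) ∧ ∀ i, x ∈ A i ↔ i ∈ S}

lemma measurableSet_partitionCell {ι : Type*} [Countable ι] {A : ι → Set (Space d)}
    (hA : ∀ i, MeasurableSet (A i)) (S : Finset ι) : MeasurableSet (partitionCell A S) := by
  have : partitionCell A S = (⋃ i, A i) ∩ ⋂ i, {x | x ∈ A i ↔ i ∈ S} := by
    ext x; simp [partitionCell]
  rw [this]
  refine (MeasurableSet.iUnion hA).inter (MeasurableSet.iInter fun i => ?_)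
  by_cases h : i ∈ S
  · simpa [h] using hA i
  · simp only [h, iff_false]
    exact (hA i).compl

lemma disjoint_partitionCell {ι : Type*} (A : ι → Set (Space d)) :
    Pairwise (Function.onFun Disjoint (partitionCell A)) := by
  intro S T hST
  refine Set.disjoint_left.mpr fun x hS hT => hST ?_
  ext i
  rw [← hS.2 i, ← hT.2 i]

/-- The clause `∃ i, x ∈ A i` in `partitionCell` matters here: it makes the cell of `∅` empty
instead of the unbounded complement. -/
lemma isBounded_partitionCell {ι : Type*} [Finite ι] {A : ι → Set (Space d)}
    (hA : ∀ i, Bornology.IsBounded (A i)) (S : Finset ι) :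
    Bornology.IsBounded (partitionCell A S) := by
  refine (Bornology.isBounded_iUnion.mpr hA).subset fun x hx => ?_
  simpa using hx.1

lemma Configuration.count_eq_sum_partitionCell {ι : Type*} [Fintype ι] [DecidableEq ι]
    {A : ι → Set (Space d)}
    (hA : ∀ i, MeasurableSet (A i)) (c : Configuration d) (i : ι) :
    c.count (A i) = ∑ S ∈ Finset.univ.filter (i ∈ ·), c.count (partitionCell A S) := by
  have h : A i = ⋃ S ∈ Finset.univ.filter (i ∈ ·), partitionCell A S := by
    classical
    ext x
    simp only [Finset.mem_filter_univ, Set.mem_iUnion, exists_prop]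
    constructor
    · intro hx
      exact ⟨Finset.univ.filter (x ∈ A ·), by simpa using hx, ⟨i, hx⟩, fun j => by simp⟩
    · rintro ⟨S, hi, hS⟩
      exact (hS.2 i).mpr hi
  have h1 := c.toMeasure_apply (hA i)
  have h2 : c.toMeasure (A i) = _ := congrArg c.toMeasure h
  rw [measure_biUnion_finset (fun S _ T _ hST => disjoint_partitionCell A hST)
    (fun S _ => measurableSet_partitionCell hA S), h1] at h2
  simp_rw [c.toMeasure_apply (measurableSet_partitionCell hA _)] at h2
  have h3 : ∀ s : Finset (Finset ι), ((∑ S ∈ s, c.count (partitionCell A S) : ℕ∞) : ℝ≥0∞) =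
      ∑ S ∈ s, ((c.count (partitionCell A S) : ℕ∞) : ℝ≥0∞) := fun s =>
    map_sum ENat.toENNRealRingHom _ _
  rw [← h3] at h2
  exact_mod_cast h2

/-- Independence is postulated only for disjoint sets. Overlapping sets are cut into their disjoint
cells, whose counts have a product law fixed by the intensity, and the original counts are sums over
cells. -/
lemma IsPoissonProcess.map_counts_eq [IsProbabilityMeasure P] [IsProbabilityMeasure P']
    (hR : IsPoissonProcess R lam P) (hR' : IsPoissonProcess R' lam P')
    {ι : Type*} [Fintype ι] {A : ι → Set (Space d)} (hA : ∀ i, MeasurableSet (A i))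
    (hb : ∀ i, Bornology.IsBounded (A i)) :
    P.map (fun ω i => (R ω).count (A i)) = P'.map (fun ω i => (R' ω).count (A i)) := by
  classical
  let e := Fintype.equivFin (Finset ι)
  let B : Fin (Fintype.card (Finset ι)) → Set (Space d) := fun k => partitionCell A (e.symm k)
  have hB : ∀ k, MeasurableSet (B k) := fun k => measurableSet_partitionCell hA _
  have hBd : Pairwise (fun i j => Disjoint (B i) (B j)) := fun i j hij =>
    disjoint_partitionCell A (e.symm.injective.ne hij)
  have hBf : ∀ k, volume (B k) < ∞ := fun k => (isBounded_partitionCell hb _).measure_lt_top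
  have h1 : P.map (fun ω k => (R ω).count (B k)) = P'.map (fun ω k => (R' ω).count (B k)) := by
    refine ((iIndepFun_iff_map_fun_eq_pi_map
        (fun k => ((measurable_count (hB k)).comp hR.measurable).aemeasurable)).mp
        (hR.indep_count _ B hB hBd)).trans (Eq.trans ?_ ((iIndepFun_iff_map_fun_eq_pi_map
        (fun k => ((measurable_count (hB k)).comp hR'.measurable).aemeasurable)).mp
        (hR'.indep_count _ B hB hBd)).symm)
    congr 1
    funext k
    exact (hR.law_count _ (hB k) (hBf k)).trans (hR'.law_count _ (hB k) (hBf k)).symm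
  let g : (Fin (Fintype.card (Finset ι)) → ℕ∞) → ι → ℕ∞ := fun n i =>
    ∑ S ∈ Finset.univ.filter (i ∈ ·), n (e S)
  have hg : Measurable g := Measurable.of_discrete
  have hRg : ∀ c : Configuration d, (fun i => c.count (A i)) = g fun k => c.count (B k) := by
    intro c
    funext i
    simp [g, B, c.count_eq_sum_partitionCell hA i]
  have h2 : (fun ω i => (R ω).count (A i)) = g ∘ fun ω k => (R ω).count (B k) :=
    funext fun ω => hRg _
  have h3 : (fun ω i => (R' ω).count (A i)) = g ∘ fun ω k => (R' ω).count (B k) :=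
    funext fun ω => hRg _
  rw [h2, h3]
  have hm : Measurable fun ω k => (R ω).count (B k) :=
    measurable_pi_lambda _ fun k => (measurable_count (hB k)).comp hR.measurable
  have hm' : Measurable fun ω k => (R' ω).count (B k) :=
    measurable_pi_lambda _ fun k => (measurable_count (hB k)).comp hR'.measurable
  have := congrArg (Measure.map g) h1
  rwa [Measure.map_map hg hm, Measure.map_map hg hm'] at this

/-- The law of a Poisson process is determined by its intensity. -/
theorem IsPoissonProcess.map_eq [IsProbabilityMeasure P] [IsProbabilityMeasure P']
    (hR : IsPoissonProcess R lam P) (hR' : IsPoissonProcess R' lam P') :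
    P.map R = P'.map R' := by
  let ι := {A : Set (Space d) // MeasurableSet A ∧ Bornology.IsBounded A}
  let φ : Configuration d → ι → ℕ∞ := fun c A => c.count A.1
  have hφ : Measurable φ := measurable_pi_lambda _ fun A => measurable_count A.2.1
  have hprob : IsProbabilityMeasure (P'.map (φ ∘ R')) :=
    Measure.isProbabilityMeasure_map (hφ.comp hR'.measurable).aemeasurable
  -- Both laws have the same finite-dimensional marginals, and a finite measure on a product space
  -- is the unique projective limit of its marginals.
  have hlim : P.map (φ ∘ R) = P'.map (φ ∘ R') := by
    refine IsProjectiveLimit.unique (α := fun _ : ι => ℕ∞)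
      (P := fun J => (P'.map (φ ∘ R')).map J.restrict) ?_ fun J => rfl
    intro J
    have hr : Measurable (J.restrict (π := fun _ : ι => ℕ∞)) := Finset.measurable_restrict J
    change (P.map (φ ∘ R)).map J.restrict = (P'.map (φ ∘ R')).map J.restrict
    rw [Measure.map_map hr (hφ.comp hR.measurable), Measure.map_map hr (hφ.comp hR'.measurable)]
    exact hR.map_counts_eq hR' (A := fun j : J => j.1.1) (fun j => j.1.2.1) fun j => j.1.2.2
  ext s hs
  have hcomap : (inferInstance : MeasurableSpace (Configuration d)) ≤
      MeasurableSpace.comap φ inferInstance := by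
    have : @Measurable _ _ (MeasurableSpace.comap φ inferInstance) _
        (id : Configuration d → Configuration d) := by
      refine @measurable_configuration d _ (MeasurableSpace.comap φ inferInstance) _ ?_
      intro A hA hb
      have h1 : @Measurable _ _ (MeasurableSpace.comap φ inferInstance) _ φ :=
        comap_measurable φ
      exact (measurable_pi_apply (⟨A, hA, hb⟩ : ι)).comp h1
    exact this.comap_le.trans' (by rw [MeasurableSpace.comap_id])
  obtain ⟨t, ht, rfl⟩ := hcomap s hs
  rw [Measure.map_apply hR.measurable hs, Measure.map_apply hR'.measurable hs,
    ← Set.preimage_comp, ← Set.preimage_comp, ← Measure.map_apply (hφ.comp hR.measurable) ht,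
    ← Measure.map_apply (hφ.comp hR'.measurable) ht, hlim]

lemma IsPoissonProcess.shift (hR : IsPoissonProcess R lam P) (v : Space d) :
    IsPoissonProcess (fun ω => (R ω).shift v) lam P where
  measurable := (measurable_shift v).comp hR.measurable
  law_count A hA hf := by
    simp_rw [Configuration.shift_count]
    have hv : volume ((fun x => x + v) ⁻¹' A) = volume A := measure_preimage_add_right _ _ _
    refine (hR.law_count _ (measurable_id.add_const v hA) (hv.trans_lt hf)).trans ?_
    simp only [id, hv]
  indep_count n A hA hd := by
    simp_rw [Configuration.shift_count]
    exact hR.indep_count n _ (fun i => measurable_id.add_const v (hA i))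
      fun i j hij => (hd hij).preimage _

lemma IsPoissonProcess.map_shift [IsProbabilityMeasure P]
    (hR : IsPoissonProcess R lam P) (v : Space d) :
    (P.map R).map (Configuration.shift v) = P.map R := by
  rw [Measure.map_map (measurable_shift v) hR.measurable]
  exact (hR.shift v).map_eq hR

end Law

/-! ### Moments of the Poisson distribution. -/

section Moments

lemma poissonMeasure_lintegral (r : ℝ≥0) (f : ℕ → ℝ≥0∞) :
    ∫⁻ n, f n ∂poissonMeasure r =
      ∑' n : ℕ, ENNReal.ofReal (Real.exp (-r) * r ^ n / n.factorial) * f n := by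
  rw [poissonMeasure, lintegral_sum_measure]
  simp

/-- The size-biasing identity, from n / n! = 1 / (n - 1)!. Applied to `1` and to `n` it gives the
first two moments. -/
lemma poissonMeasure_lintegral_mul (r : ℝ≥0) (f : ℕ → ℝ≥0∞) :
    ∫⁻ n, n * f n ∂poissonMeasure r = r * ∫⁻ n, f (n + 1) ∂poissonMeasure r := by
  rw [poissonMeasure_lintegral, poissonMeasure_lintegral, tsum_eq_zero_add' ENNReal.summable,
    ← ENNReal.tsum_mul_left]
  simp only [Nat.cast_zero, zero_mul, mul_zero, zero_add]
  congr 1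
  funext n
  rw [← mul_assoc, ← mul_assoc]
  congr 1
  rw [← ENNReal.ofReal_natCast, ← ENNReal.ofReal_coe_nnreal, ← ENNReal.ofReal_mul (by positivity),
    ← ENNReal.ofReal_mul (by positivity)]
  congr 1
  rw [Nat.factorial_succ]
  push_cast
  field_simp
  ring

lemma poissonMeasure_mean (r : ℝ≥0) : ∫⁻ n, (n : ℝ≥0∞) ∂poissonMeasure r = r := by
  simpa using poissonMeasure_lintegral_mul r fun _ => 1

lemma poissonMeasure_secondMoment (r : ℝ≥0) :
    ∫⁻ n, (n : ℝ≥0∞) * n ∂poissonMeasure r = r * (r + 1) := by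
  rw [poissonMeasure_lintegral_mul r fun n => n]
  simp_rw [Nat.cast_add, Nat.cast_one]
  rw [lintegral_add_right _ measurable_const, poissonMeasure_mean]
  simp

lemma poissonMeasure_variance (r : ℝ≥0) :
    ∫⁻ n : ℕ, ENNReal.ofReal ((n - r : ℝ) ^ 2) ∂poissonMeasure r = r := by
  -- The square is expanded with its negative term moved to the left, since subtraction in `ℝ≥0∞` is
  -- truncated.
  have h : ∫⁻ n : ℕ, ENNReal.ofReal ((n - r : ℝ) ^ 2) ∂poissonMeasure r +
      ∫⁻ n : ℕ, 2 * r * (n : ℝ≥0∞) ∂poissonMeasure r =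
      ∫⁻ n, (n : ℝ≥0∞) * n ∂poissonMeasure r + ∫⁻ n, (r : ℝ≥0∞) * r ∂poissonMeasure r := by
    rw [← lintegral_add_left Measurable.of_discrete, ← lintegral_add_left Measurable.of_discrete]
    congr 1
    funext n
    have e1 : (r : ℝ≥0∞) = ENNReal.ofReal r := by simp
    have e2 : (n : ℝ≥0∞) = ENNReal.ofReal n := by simp
    have e3 : (2 : ℝ≥0∞) = ENNReal.ofReal 2 := by simp
    rw [e1, e2, e3, ← ENNReal.ofReal_mul (by positivity), ← ENNReal.ofReal_mul (by positivity),
      ← ENNReal.ofReal_mul (by positivity), ← ENNReal.ofReal_mul (by positivity),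
      ← ENNReal.ofReal_add (by positivity) (by positivity),
      ← ENNReal.ofReal_add (by positivity) (by positivity)]
    congr 1
    ring
  rw [poissonMeasure_secondMoment, lintegral_const_mul _ Measurable.of_discrete,
    poissonMeasure_mean] at h
  simp only [lintegral_const, measure_univ, mul_one] at h
  have hfin : (2 * r * r : ℝ≥0∞) ≠ ∞ := by finiteness
  have : (r * (r + 1) + r * r : ℝ≥0∞) = r + 2 * r * r := by ring
  rw [this] at h
  exact (ENNReal.add_left_inj hfin).mp h

/-- The mean absolute deviation (in one direction) of a Poisson variable is at most its standard
deviation. -/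
lemma poissonMeasure_excess (r : ℝ≥0) :
    ∫⁻ n : ℕ, ((n : ℝ≥0∞) - r) ∂poissonMeasure r ≤ (NNReal.sqrt r : ℝ≥0∞) := by
  have h1 : ∀ n : ℕ, ((n : ℝ≥0∞) - r) ≤ ENNReal.ofReal |(n - r : ℝ)| := by
    intro n
    have e1 : (r : ℝ≥0∞) = ENNReal.ofReal r := by simp
    have e2 : (n : ℝ≥0∞) = ENNReal.ofReal n := by simp
    rw [e1, e2, ← ENNReal.ofReal_sub _ (by positivity)]
    exact ENNReal.ofReal_le_ofReal (le_abs_self _)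
  refine (lintegral_mono h1).trans ?_
  have h2 := ENNReal.lintegral_mul_le_Lp_mul_Lq (poissonMeasure r) (p := 2) (q := 2)
    Real.HolderConjugate.two_two (f := fun n : ℕ => ENNReal.ofReal |(n - r : ℝ)|) (g := fun _ => 1)
    Measurable.of_discrete.aemeasurable Measurable.of_discrete.aemeasurable
  have h3 : ∀ n : ℕ, ENNReal.ofReal |(n - r : ℝ)| ^ (2 : ℝ) = ENNReal.ofReal ((n - r : ℝ) ^ 2) := by
    intro n
    rw [ENNReal.ofReal_rpow_of_nonneg (abs_nonneg _) (by norm_num)]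
    simp
  simp only [Pi.mul_apply, mul_one, h3, poissonMeasure_variance] at h2
  refine h2.trans ?_
  simp only [ENNReal.one_rpow, lintegral_const, measure_univ, mul_one]
  rw [← ENNReal.coe_rpow_of_nonneg _ (by norm_num), NNReal.sqrt_eq_rpow]

end Moments

/-! ### Campbell's formula and the fluctuation of counts. -/

section Campbell

variable {Ω : Type*} [MeasurableSpace Ω] {P : Measure Ω} {R : Ω → Configuration d}

lemma IsPoissonProcess.lintegral_count (hR : IsPoissonProcess R 1 P) {A : Set (Space d)}
    (hA : MeasurableSet A) (hf : volume A < ∞) (g : ℕ∞ → ℝ≥0∞) :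
    ∫⁻ c, g (c.count A) ∂P.map R = ∫⁻ n : ℕ, g n ∂poissonMeasure (volume A).toNNReal := by
  rw [lintegral_map (f := fun c : Configuration d => g (c.count A))
    (Measurable.of_discrete.comp (measurable_count hA)) hR.measurable]
  have := hR.law_count A hA hf
  rw [one_mul] at this
  rw [← lintegral_map (f := g) (g := fun n : ℕ => (n : ℕ∞)) Measurable.of_discrete
    Measurable.of_discrete, ← this]
  exact (lintegral_map (f := g) Measurable.of_discrete
    ((measurable_count hA).comp hR.measurable)).symm

lemma IsPoissonProcess.bind_pointKernel (hR : IsPoissonProcess R 1 P) :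
    (P.map R).bind (pointKernel d) = volume := by
  have key : ∀ A : Set (Space d), MeasurableSet A → volume A < ∞ →
      (P.map R).bind (pointKernel d) A = volume A := by
    intro A hA hf
    rw [Measure.bind_apply hA (pointKernel d).measurable.aemeasurable]
    simp_rw [pointKernel_apply, Configuration.toMeasure_apply _ hA]
    rw [hR.lintegral_count hA hf fun n => (n : ℝ≥0∞)]
    simp only [ENat.toENNReal_coe]
    rw [poissonMeasure_mean, ENNReal.coe_toNNReal hf.ne]
  refine Measure.ext_of_generateFrom_of_iUnion {A | MeasurableSet A ∧ volume A < ∞}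
    (fun n => Metric.closedBall 0 n) ?_ ?_ ?_ ?_ ?_ ?_
  · refine le_antisymm ?_ (MeasurableSpace.generateFrom_le fun A hA => hA.1)
    intro A hA
    have h1 : A = ⋃ n : ℕ, A ∩ Metric.closedBall 0 n := by
      rw [← Set.inter_iUnion, Metric.iUnion_closedBall_nat, Set.inter_univ]
    rw [h1]
    refine @MeasurableSet.iUnion _ _ _ _ _ fun n => MeasurableSpace.measurableSet_generateFrom ?_
    exact ⟨hA.inter measurableSet_closedBall,
      (Metric.isBounded_closedBall.subset Set.inter_subset_right).measure_lt_top⟩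
  · exact fun A hA B hB _ => ⟨hA.1.inter hB.1, (measure_mono Set.inter_subset_left).trans_lt hA.2⟩
  · exact Metric.iUnion_closedBall_nat 0
  · exact fun n => ⟨measurableSet_closedBall, measure_closedBall_lt_top⟩
  · intro n
    rw [key _ measurableSet_closedBall measure_closedBall_lt_top]
    exact measure_closedBall_lt_top.ne
  · exact fun A hA => key A hA.1 hA.2

/-- Campbell's formula. -/
lemma IsPoissonProcess.campbell (hR : IsPoissonProcess R 1 P) {f : Space d → ℝ≥0∞}
    (hf : Measurable f) : ∫⁻ c, ∫⁻ x, f x ∂c.toMeasure ∂P.map R = ∫⁻ x, f x := by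
  rw [← hR.bind_pointKernel,
    Measure.lintegral_bind (pointKernel d).measurable.aemeasurable hf.aemeasurable]
  rfl

/-- This one-sided deviation controls the expected maximum of the red and the blue count in a ball.
-/
lemma IsPoissonProcess.excess (hR : IsPoissonProcess R 1 P) {A : Set (Space d)}
    (hA : MeasurableSet A) (hf : volume A < ∞) :
    ∫⁻ c, (c.toMeasure A - volume A) ∂P.map R ≤ (NNReal.sqrt (volume A).toNNReal : ℝ≥0∞) := by
  simp_rw [Configuration.toMeasure_apply _ hA]
  rw [hR.lintegral_count hA hf fun n => (n : ℝ≥0∞) - volume A]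
  refine le_trans (le_of_eq ?_) (poissonMeasure_excess _)
  simp [ENNReal.coe_toNNReal hf.ne]

end Campbell

end StableMatching

/-! ### Deterministic theory: stable matchings as solutions of fixed point equations. -/

namespace StableMatching

variable {d : ℕ}

/-- The distance from `x` to the nearest point `y` of `V` which accepts partners at distance
up to `b y` and is not farther than that from `x`. -/
def acceptDist (V : Set (Space d)) (b : Space d → ℝ≥0∞) (x : Space d) : ℝ≥0∞ :=
  ⨅ y ∈ V, if edist x y ≤ b y then edist x y else ∞

lemma acceptDist_le {V : Set (Space d)} {b : Space d → ℝ≥0∞} {x y : Space d} (hy : y ∈ V)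
    (h : edist x y ≤ b y) : acceptDist V b x ≤ edist x y :=
  (iInf₂_le y hy).trans (by rw [if_pos h])

lemma acceptDist_lt_iff {V : Set (Space d)} {b : Space d → ℝ≥0∞} {x : Space d} {t : ℝ≥0∞} :
    acceptDist V b x < t ↔ ∃ y ∈ V, edist x y ≤ b y ∧ edist x y < t := by
  simp only [acceptDist, iInf_lt_iff, exists_prop]
  refine exists_congr fun y => and_congr_right fun _ => ?_
  split_ifs with h <;> simp [h]

lemma le_acceptDist_iff {V : Set (Space d)} {b : Space d → ℝ≥0∞} {x : Space d} {t : ℝ≥0∞} :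
    t ≤ acceptDist V b x ↔ ∀ y ∈ V, edist x y ≤ b y → t ≤ edist x y := by
  rw [← not_lt, acceptDist_lt_iff]
  push Not
  rfl

/-- More willing points can only bring the nearest willing one closer. Two such order-reversing maps
compose to a monotone one, which makes the iteration `blueIter` converge. -/
lemma acceptDist_anti {V : Set (Space d)} {b b' : Space d → ℝ≥0∞} (h : ∀ y ∈ V, b y ≤ b' y)
    (x : Space d) : acceptDist V b' x ≤ acceptDist V b x :=
  le_acceptDist_iff.mpr fun y hy hxy => acceptDist_le hy (hxy.trans (h y hy))

lemma Configuration.finite_edist_lt (V : Configuration d) (x : Space d) {t : ℝ≥0∞} (ht : t ≠ ∞) :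
    {y ∈ V.points | edist x y < t}.Finite := by
  lift t to ℝ≥0 using ht
  refine (V.locallyFinite (Metric.ball x t) Metric.isBounded_ball).subset fun y hy => ⟨hy.1, ?_⟩
  have h := hy.2
  rw [edist_comm, ← ENNReal.ofReal_coe_nnreal, edist_lt_ofReal] at h
  exact h

/-- Continuity along decreasing sequences. The witnesses for the various `n` lie among finitely many
points of `V` near `x`, so by pigeonhole one of them serves infinitely many `n`, hence all. -/
lemma acceptDist_iInf_lt (V : Configuration d) {b : ℕ → Space d → ℝ≥0∞} (hb : Antitone b)
    {x : Space d} {t : ℝ≥0∞} (ht : t ≠ ∞) (h : ∀ n, acceptDist V.points (b n) x < t) :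
    acceptDist V.points (fun y => ⨅ n, b n y) x < t := by
  simp_rw [acceptDist_lt_iff] at h ⊢
  choose y hyV hyb hyt using h
  have hfin := V.finite_edist_lt x ht
  have := hfin.to_subtype
  obtain ⟨⟨z, hz⟩, hinf⟩ := Finite.exists_infinite_fiber
    fun n => (⟨y n, hyV n, hyt n⟩ : {y ∈ V.points | edist x y < t})
  refine ⟨z, hz.1, le_iInf fun n => ?_, hz.2⟩
  obtain ⟨k, hk, hnk⟩ := (Set.infinite_coe_iff.mp hinf).exists_gt n
  obtain rfl : y k = z := congrArg Subtype.val hk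
  exact (hyb k).trans (hb hnk.le _)

lemma exists_eq_acceptDist (V : Configuration d) {b : Space d → ℝ≥0∞} {x : Space d}
    (h : acceptDist V.points b x < ∞) :
    ∃ y ∈ V.points, edist x y ≤ b y ∧ edist x y = acceptDist V.points b x := by
  obtain ⟨t, ht1, ht2⟩ := exists_between h
  have hfin : {y ∈ V.points | edist x y ≤ b y ∧ edist x y < t}.Finite :=
    (V.finite_edist_lt x ht2.ne).subset fun y hy => ⟨hy.1, hy.2.2⟩
  obtain ⟨y₀, hy₀, hb₀, hlt₀⟩ := acceptDist_lt_iff.mp ht1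
  obtain ⟨y, ⟨hyV, hyb, hyt⟩, hmin⟩ := Set.exists_min_image _ (fun y => edist x y) hfin
    ⟨y₀, hy₀, hb₀, hlt₀⟩
  refine ⟨y, hyV, hyb, le_antisymm (le_acceptDist_iff.mpr fun z hz hzb => ?_)
    (acceptDist_le hyV hyb)⟩
  by_cases hzt : edist x z < t
  · exact hmin z ⟨hz, hzb, hzt⟩
  · exact hyt.le.trans (not_lt.mp hzt)

/-- The fixed point equations satisfied by the distances to the partners in a stable matching. -/
def IsSolution (U V : Set (Space d)) (a b : Space d → ℝ≥0∞) : Prop :=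
  (∀ x ∈ U, a x = acceptDist V b x) ∧ ∀ y ∈ V, b y = acceptDist U a y

lemma IsSolution.symm {U V : Set (Space d)} {a b : Space d → ℝ≥0∞} (h : IsSolution U V a b) :
    IsSolution V U b a := ⟨h.2, h.1⟩

/-- The iterated distances of the second colour when the first colour proposes. -/
def blueIter (U V : Set (Space d)) : ℕ → Space d → ℝ≥0∞
  | 0 => fun _ => ∞
  | n + 1 => acceptDist U (acceptDist V (blueIter U V n))

/-- The limit distances of the second colour when the first colour proposes. -/
def blueOpt (U V : Set (Space d)) (y : Space d) : ℝ≥0∞ := ⨅ n, blueIter U V n y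

/-- The limit distances of the first colour when the first colour proposes. -/
def redOpt (U V : Set (Space d)) (x : Space d) : ℝ≥0∞ := acceptDist V (blueOpt U V) x

lemma blueIter_antitone (U V : Set (Space d)) : Antitone (blueIter U V) := by
  refine antitone_nat_of_succ_le fun n => ?_
  induction n with
  | zero => exact fun y => le_top
  | succ n ih => exact fun y => acceptDist_anti (fun x _ => acceptDist_anti (fun y _ => ih y) x) y

/-- The limit of the deferred acceptance iteration is a fixed point because `acceptDist` commutes
with the decreasing limit, by local finiteness. Ties are harmless here, so this holds for every pair
of configurations. -/
lemma isSolution_opt (U V : Configuration d) :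
    IsSolution U.points V.points (redOpt U.points V.points) (blueOpt U.points V.points) := by
  refine ⟨fun x _ => rfl, fun y hy => le_antisymm ?_ ?_⟩
  · refine le_acceptDist_iff.mpr fun x hx hxy => ?_
    suffices h : ∃ n, edist y x ≤ acceptDist V.points (blueIter U.points V.points n) x by
      obtain ⟨n, hn⟩ := h
      exact (iInf_le _ (n + 1)).trans (acceptDist_le hx hn)
    by_contra! hcon
    exact (acceptDist_iInf_lt V (blueIter_antitone _ _) (edist_ne_top y x) hcon).not_ge hxy
  · refine le_iInf fun n => ?_
    cases n with
    | zero => exact le_top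
    | succ n =>
      exact acceptDist_anti (fun x _ => acceptDist_anti (fun y _ => iInf_le _ n) x) y

/-- The iteration starts at `∞`, above every solution, and its monotone step preserves this. Thus
`blueOpt` is the worst solution for blue, and `redOpt` accordingly the best for red. -/
lemma IsSolution.le_blueOpt {U V : Set (Space d)} {a b : Space d → ℝ≥0∞}
    (h : IsSolution U V a b) {y : Space d} (hy : y ∈ V) : b y ≤ blueOpt U V y := by
  refine le_iInf fun n => ?_
  induction n generalizing y with
  | zero => exact le_top
  | succ n ih =>
    rw [h.2 y hy]
    refine acceptDist_anti (fun x hx => ?_) y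
    rw [h.1 x hx]
    exact acceptDist_anti (fun y hy => ih hy) x

lemma IsSolution.redOpt_le {U V : Set (Space d)} {a b : Space d → ℝ≥0∞}
    (h : IsSolution U V a b) {x : Space d} (hx : x ∈ U) : redOpt U V x ≤ a x := by
  rw [h.1 x hx]
  exact acceptDist_anti (fun y hy => h.le_blueOpt hy) x

/-- No point of `U` is at the same distance from two points of `V`. -/
def NoTies (U V : Set (Space d)) : Prop :=
  ∀ x ∈ U, ∀ y ∈ V, ∀ y' ∈ V, edist x y = edist x y' → y = y'

/-- The matching that pairs points whose distance is the prescribed distance of both. -/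
def distMatching (U V : Set (Space d)) (a b : Space d → ℝ≥0∞) : Set (Space d × Space d) :=
  {p | p.1 ∈ U ∧ p.2 ∈ V ∧ edist p.1 p.2 = a p.1 ∧ edist p.1 p.2 = b p.2}

section Matching

variable {U V : Set (Space d)} {m : Set (Space d × Space d)}

lemma IsPartialMatching.redDist_eq (h : IsPartialMatching U V m) {x y : Space d}
    (hxy : (x, y) ∈ m) : redDist m x = edist x y := by
  refine le_antisymm (iInf₂_le y hxy) (le_iInf₂ fun y' hy' => ?_)
  rw [h.blue_unique x y y' hxy hy']

lemma IsPartialMatching.blueDist_eq (h : IsPartialMatching U V m) {x y : Space d}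
    (hxy : (x, y) ∈ m) : blueDist m y = edist x y := by
  refine le_antisymm (iInf₂_le x hxy) (le_iInf₂ fun x' hx' => ?_)
  rw [h.red_unique x x' y hxy hx']

lemma exists_mem_of_redDist_lt_top {x : Space d} (h : redDist m x < ∞) : ∃ y, (x, y) ∈ m := by
  simp only [redDist, iInf_lt_iff] at h
  obtain ⟨y, hy, -⟩ := h
  exact ⟨y, hy⟩

lemma exists_mem_of_blueDist_lt_top {y : Space d} (h : blueDist m y < ∞) : ∃ x, (x, y) ∈ m := by
  simp only [blueDist, iInf_lt_iff] at h
  obtain ⟨x, hx, -⟩ := h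
  exact ⟨x, hx⟩

/-- If `y` accepts `x` although `x` has a partner strictly farther away than `y` or none, stability
forces the partner of `y` to be exactly as far as `x`. Without ties that partner is `x` itself, a
contradiction. -/
lemma IsStablePartialMatching.isSolution (h : IsStablePartialMatching U V m) (hUV : NoTies U V)
    (hVU : NoTies V U) : IsSolution U V (redDist m) (blueDist m) := by
  have hm := h.toIsPartialMatching
  refine ⟨fun x hx => le_antisymm (le_acceptDist_iff.mpr fun y hy hxy => ?_) ?_,
    fun y hy => le_antisymm (le_acceptDist_iff.mpr fun x hx hxy => ?_) ?_⟩
  · by_contra! hlt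
    have hge : blueDist m y ≤ edist x y := by
      by_contra! hlt'
      exact h.stable ⟨x, hx, y, hy, lt_min hlt hlt'⟩
    obtain ⟨x', hx'⟩ := exists_mem_of_blueDist_lt_top (hge.trans_lt (edist_lt_top x y))
    have he := hm.blueDist_eq hx'
    obtain rfl := hVU y hy x hx x' (hm.mem _ _ hx').1
      (by rw [edist_comm y x, edist_comm y x', ← he]; exact le_antisymm hxy hge)
    exact hlt.ne (hm.redDist_eq hx').symm
  · refine le_iInf₂ fun y hxy => acceptDist_le (hm.mem _ _ hxy).2 (hm.blueDist_eq hxy).ge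
  · by_contra! hlt
    rw [edist_comm] at hxy hlt
    have hge : redDist m x ≤ edist x y := by
      by_contra! hlt'
      exact h.stable ⟨x, hx, y, hy, lt_min hlt' hlt⟩
    obtain ⟨y', hy'⟩ := exists_mem_of_redDist_lt_top (hge.trans_lt (edist_lt_top x y))
    have he := hm.redDist_eq hy'
    obtain rfl := hUV x hx y hy y' (hm.mem _ _ hy').2 (by rw [← he]; exact le_antisymm hxy hge)
    exact hlt.ne (hm.blueDist_eq hy').symm
  · refine le_iInf₂ fun x hxy => ?_
    rw [edist_comm]
    exact acceptDist_le (hm.mem _ _ hxy).1 (by rw [edist_comm]; exact (hm.redDist_eq hxy).ge)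

/-- In the absence of ties a stable matching can be recovered from its distances, so uniqueness of
the matching reduces to uniqueness of the distances. -/
lemma IsStablePartialMatching.eq_distMatching (h : IsStablePartialMatching U V m)
    (hUV : NoTies U V) {a b : Space d → ℝ≥0∞} (ha : ∀ x ∈ U, redDist m x = a x)
    (hb : ∀ y ∈ V, blueDist m y = b y) : m = distMatching U V a b := by
  have hm := h.toIsPartialMatching
  ext ⟨x, y⟩
  constructor
  · intro hxy
    have hU := hm.mem _ _ hxy
    exact ⟨hU.1, hU.2, by simpa [← ha x hU.1] using (hm.redDist_eq hxy).symm,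
      by simpa [← hb y hU.2] using (hm.blueDist_eq hxy).symm⟩
  · rintro ⟨hx, hy, hax, hby⟩
    simp only at hx hy hax hby
    rw [← ha x hx] at hax
    obtain ⟨y', hy'⟩ := exists_mem_of_redDist_lt_top (hax ▸ edist_lt_top x y)
    obtain rfl := hUV x hx y hy y' (hm.mem _ _ hy').2 (hax.trans (hm.redDist_eq hy'))
    exact hy'

lemma IsSolution.isPartialMatching {a b : Space d → ℝ≥0∞} (hUV : NoTies U V)
    (hVU : NoTies V U) : IsPartialMatching U V (distMatching U V a b) where
  mem x y h := ⟨h.1, h.2.1⟩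
  blue_unique x y y' h h' := hUV x h.1 y h.2.1 y' h'.2.1 (h.2.2.1.trans h'.2.2.1.symm)
  red_unique x x' y h h' := hVU y h.2.1 x h.1 x' h'.1
    (by rw [edist_comm y x, edist_comm y x']; exact h.2.2.2.trans h'.2.2.2.symm)

end Matching

section Solution

variable {U V : Configuration d} {a b : Space d → ℝ≥0∞}

/-- Local finiteness provides a `y` attaining the infimum. Since `x` is then willing at that
distance, the equation for `y` gives `b y ≤ edist x y`, the inequality that is missing. -/
lemma IsSolution.exists_red (h : IsSolution U.points V.points a b) {x : Space d}
    (hx : x ∈ U.points) (hax : a x < ∞) : ∃ y, (x, y) ∈ distMatching U.points V.points a b := by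
  have hax' := h.1 x hx
  obtain ⟨y, hy, hyb, hye⟩ := exists_eq_acceptDist V (hax' ▸ hax)
  refine ⟨y, hx, hy, hye.trans hax'.symm, le_antisymm hyb ?_⟩
  change b y ≤ edist x y
  rw [h.2 y hy, edist_comm]
  exact acceptDist_le hx (by rw [edist_comm, hye, hax'])

lemma IsSolution.exists_blue (h : IsSolution U.points V.points a b) {y : Space d}
    (hy : y ∈ V.points) (hby : b y < ∞) : ∃ x, (x, y) ∈ distMatching U.points V.points a b := by
  obtain ⟨x, hx⟩ := h.symm.exists_red hy hby
  exact ⟨x, hx.2.1, hx.1, by rw [edist_comm]; exact hx.2.2.2, by rw [edist_comm]; exact hx.2.2.1⟩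

lemma IsSolution.redDist_distMatching (h : IsSolution U.points V.points a b) {x : Space d}
    (hx : x ∈ U.points) : redDist (distMatching U.points V.points a b) x = a x := by
  refine le_antisymm ?_ (le_iInf₂ fun y hy => hy.2.2.1.ge)
  rcases eq_or_ne (a x) ∞ with hax | hax
  · rw [hax]; exact le_top
  · obtain ⟨y, hy⟩ := h.exists_red hx (lt_top_iff_ne_top.mpr hax)
    exact (iInf₂_le y hy).trans hy.2.2.1.le

lemma IsSolution.blueDist_distMatching (h : IsSolution U.points V.points a b) {y : Space d}
    (hy : y ∈ V.points) : blueDist (distMatching U.points V.points a b) y = b y := by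
  refine le_antisymm ?_ (le_iInf₂ fun x hx => hx.2.2.2.ge)
  rcases eq_or_ne (b y) ∞ with hby | hby
  · rw [hby]; exact le_top
  · obtain ⟨x, hx⟩ := h.exists_blue hy (lt_top_iff_ne_top.mpr hby)
    exact (iInf₂_le x hx).trans hx.2.2.2.le

lemma IsSolution.le_or_le (h : IsSolution U.points V.points a b) {x y : Space d}
    (hx : x ∈ U.points) (hy : y ∈ V.points) : a x ≤ edist x y ∨ b y ≤ edist x y := by
  by_contra! hcon
  have := acceptDist_le hy hcon.2.le
  rw [← h.1 x hx] at this
  exact this.not_gt hcon.1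

lemma IsSolution.isStablePartialMatching (h : IsSolution U.points V.points a b)
    (hUV : NoTies U.points V.points) (hVU : NoTies V.points U.points) :
    IsStablePartialMatching U.points V.points (distMatching U.points V.points a b) where
  toIsPartialMatching := IsSolution.isPartialMatching hUV hVU
  stable := by
    rintro ⟨x, hx, y, hy, hlt⟩
    rw [h.redDist_distMatching hx, h.blueDist_distMatching hy, lt_min_iff] at hlt
    rcases h.le_or_le hx hy with h' | h'
    exacts [h'.not_gt hlt.1, h'.not_gt hlt.2]

end Solution

/-! ### Measurability and translation covariance of the extremal solutions. -/

section Measurability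

lemma measurable_acceptDist {α : Type*} [MeasurableSpace α] {c : α → Configuration d}
    (hc : Measurable c) {b : α → Space d → ℝ≥0∞} (hb : Measurable (Function.uncurry b)) :
    Measurable (Function.uncurry fun w x => acceptDist (c w).points (b w) x) := by
  have := measurable_iInf_points (α := α × Space d) (c := fun p => c p.1)
    (hc.comp measurable_fst)
    (g := fun p y => if edist p.2 y ≤ b p.1 y then edist p.2 y else ∞) ?_
  · exact this
  · have h1 : Measurable fun q : (α × Space d) × Space d => edist q.1.2 q.2 := by fun_prop
    have h2 : Measurable fun q : (α × Space d) × Space d => b q.1.1 q.2 :=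
      hb.comp (f := fun q : (α × Space d) × Space d => (q.1.1, q.2)) (by fun_prop)
    exact Measurable.ite (measurableSet_le h1 h2) h1 measurable_const

lemma measurable_blueOpt {α : Type*} [MeasurableSpace α] {u v : α → Configuration d}
    (hu : Measurable u) (hv : Measurable v) :
    Measurable (Function.uncurry fun w x => blueOpt (u w).points (v w).points x) := by
  have h : ∀ n, Measurable
      (Function.uncurry fun w x => blueIter (u w).points (v w).points n x) := by
    intro n
    induction n with
    | zero =>
      simp only [blueIter]
      exact measurable_const (a := (∞ : ℝ≥0∞))
    | succ n ih =>
      simp only [blueIter]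
      exact measurable_acceptDist hu (b := fun w => acceptDist (v w).points _)
        (measurable_acceptDist hv (b := fun w => blueIter (u w).points (v w).points n) ih)
  exact Measurable.iInf h

lemma measurable_redOpt {α : Type*} [MeasurableSpace α] {u v : α → Configuration d}
    (hu : Measurable u) (hv : Measurable v) :
    Measurable (Function.uncurry fun w x => redOpt (u w).points (v w).points x) :=
  measurable_acceptDist hv (measurable_blueOpt hu hv)

lemma acceptDist_shift (v : Space d) (c : Configuration d) {b b' : Space d → ℝ≥0∞}
    (h : ∀ y, b' (y + v) = b y) (x : Space d) :
    acceptDist (c.shift v).points b' (x + v) = acceptDist c.points b x := by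
  refine eq_of_forall_le_iff fun t => ?_
  rw [le_acceptDist_iff, le_acceptDist_iff]
  constructor
  · intro H y hy hxy
    have := H (y + v) (by simpa [Configuration.mem_shift] using hy)
      (by rwa [edist_add_right, h])
    rwa [edist_add_right] at this
  · intro H y hy hxy
    have hy' : y = (y - v) + v := by simp
    rw [hy', edist_add_right] at hxy ⊢
    rw [h] at hxy
    exact H (y - v) hy hxy

lemma blueOpt_shift (v : Space d) (U V : Configuration d) (y : Space d) :
    blueOpt (U.shift v).points (V.shift v).points (y + v) = blueOpt U.points V.points y := by
  refine iInf_congr fun n => ?_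
  induction n generalizing y with
  | zero => rfl
  | succ n ih => exact acceptDist_shift v U (acceptDist_shift v V ih) y

lemma redOpt_shift (v : Space d) (U V : Configuration d) (x : Space d) :
    redOpt (U.shift v).points (V.shift v).points (x + v) = redOpt U.points V.points x :=
  acceptDist_shift v V (blueOpt_shift v U V) x

end Measurability

end StableMatching

/-! ### Almost sure absence of ties, and translation invariant measures on products. -/

namespace StableMatching

variable {d : ℕ}

/-- The properties of the law of a unit intensity Poisson process that are used below. -/
structure IsPoissonLaw (ρ : Measure (Configuration d)) : Prop where
  prob : IsProbabilityMeasure ρ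
  map_shift : ∀ v, ρ.map (Configuration.shift v) = ρ
  campbell : ∀ f : Space d → ℝ≥0∞, Measurable f →
    ∫⁻ c, ∫⁻ x, f x ∂c.toMeasure ∂ρ = ∫⁻ x, f x
  excess : ∀ A : Set (Space d), MeasurableSet A → volume A < ∞ →
    ∫⁻ c, (c.toMeasure A - volume A) ∂ρ ≤ (NNReal.sqrt (volume A).toNNReal : ℝ≥0∞)

lemma IsPoissonProcess.isPoissonLaw {Ω : Type*} [MeasurableSpace Ω] {P : Measure Ω}
    [IsProbabilityMeasure P] {R : Ω → Configuration d} (hR : IsPoissonProcess R 1 P) :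
    IsPoissonLaw (P.map R) where
  prob := Measure.isProbabilityMeasure_map hR.measurable.aemeasurable
  map_shift := hR.map_shift
  campbell _ hf := hR.campbell hf
  excess _ hA hf := hR.excess hA hf

instance (c : Configuration d) : SFinite c.toMeasure :=
  inferInstanceAs (SFinite (pointKernel d c))

lemma measurable_lintegral_points {α : Type*} [MeasurableSpace α] {c : α → Configuration d}
    (hc : Measurable c) {g : α × Space d → ℝ≥0∞} (hg : Measurable g) :
    Measurable fun w => ∫⁻ x, g (w, x) ∂(c w).toMeasure :=
  Measurable.lintegral_kernel_prod_right' (κ := (pointKernel d).comap c hc) hg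

lemma volume_equidistant {y y' : Space d} (h : y ≠ y') :
    volume {x : Space d | edist x y = edist x y'} = 0 := by
  have : {x : Space d | edist x y = edist x y'} = (AffineSubspace.perpBisector y y' : Set _) := by
    ext x
    simp only [Set.mem_ofPred_eq, SetLike.mem_coe, AffineSubspace.mem_perpBisector_iff_dist_eq]
    rw [edist_dist, edist_dist, ENNReal.ofReal_eq_ofReal_iff dist_nonneg dist_nonneg]
  rw [this]
  exact Measure.addHaar_affineSubspace _ _ (by simpa using h)

/-- For a fixed blue configuration, Campbell's formula turns the expected number of red points
equidistant from two blue ones into a countable sum of volumes of perpendicular bisectors, which are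
null. -/
lemma ae_noTies {ρ β : Measure (Configuration d)} (hρ : IsPoissonLaw ρ) (hβ : IsPoissonLaw β) :
    ∀ᵐ w ∂ρ.prod β, NoTies w.1.points w.2.points := by
  have := hρ.prob
  have := hβ.prob
  let S : Set ((Space d × Space d) × Space d) :=
    {p | p.1.2 ≠ p.2 ∧ edist p.1.1 p.1.2 = edist p.1.1 p.2}
  have hS : MeasurableSet S := by
    refine MeasurableSet.inter ?_ ?_
    · exact (measurableSet_eq_fun (by fun_prop) (by fun_prop)).compl
    · exact measurableSet_eq_fun (by fun_prop) (by fun_prop)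
  have hm : Measurable (S.indicator (1 : (Space d × Space d) × Space d → ℝ≥0∞)) := measurable_one.indicator hS
  let g : Configuration d × Space d → ℝ≥0∞ := fun p =>
    ∫⁻ y, ∫⁻ y', S.indicator 1 ((p.2, y), y') ∂p.1.toMeasure ∂p.1.toMeasure
  have hg : Measurable g := by
    refine measurable_lintegral_points measurable_fst
      (g := fun q : (Configuration d × Space d) × Space d =>
        ∫⁻ y', S.indicator 1 ((q.1.2, q.2), y') ∂q.1.1.toMeasure) ?_
    exact measurable_lintegral_points (c := fun q : (Configuration d × Space d) × Space d => q.1.1)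
      (by fun_prop) (g := fun q => S.indicator 1 ((q.1.1.2, q.1.2), q.2))
      (hm.comp (by fun_prop))
  have hg0 : ∀ V : Configuration d, ∫⁻ x, g (V, x) = 0 := by
    intro V
    have h1 : ∀ y y', ∫⁻ x, S.indicator 1 ((x, y), y') = 0 := by
      intro y y'
      have hS' : MeasurableSet ((fun x => ((x, y), y')) ⁻¹' S) := hS.preimage (by fun_prop)
      have := lintegral_indicator_one (μ := (volume : Measure (Space d))) hS'
      refine this.trans ?_
      by_cases h : y = y'
      · simp [S, h]
      · exact measure_mono_null (fun x hx => hx.2) (volume_equidistant h)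
    simp only [g]
    rw [lintegral_lintegral_swap]
    · have h2 : ∀ y, ∫⁻ x, ∫⁻ y', S.indicator 1 ((x, y), y') ∂V.toMeasure = 0 := by
        intro y
        rw [lintegral_lintegral_swap]
        · simp [h1]
        · exact (hm.comp (f := fun q : Space d × Space d => ((q.1, y), q.2))
            (by fun_prop)).aemeasurable
      simp [h2]
    · exact (measurable_lintegral_points (c := fun _ : Space d × Space d => V) measurable_const
        (g := fun q => S.indicator 1 ((q.1.1, q.1.2), q.2)) (hm.comp (by fun_prop))).aemeasurable
  have hN : Measurable fun w : Configuration d × Configuration d =>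
      ∫⁻ x, g (w.2, x) ∂w.1.toMeasure :=
    measurable_lintegral_points measurable_fst (g := fun q => g (q.1.2, q.2))
      (hg.comp (by fun_prop))
  have hzero : ∫⁻ w, ∫⁻ x, g (w.2, x) ∂w.1.toMeasure ∂ρ.prod β = 0 := by
    rw [lintegral_prod_symm _ hN.aemeasurable]
    have : ∀ V, ∫⁻ U, ∫⁻ x, g (V, x) ∂U.toMeasure ∂ρ = 0 := by
      intro V
      rw [hρ.campbell (fun x => g (V, x)) (hg.comp (by fun_prop)), hg0]
    simp [this]
  rw [lintegral_eq_zero_iff hN] at hzero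
  filter_upwards [hzero] with w hw x hx y hy y' hy' he
  by_contra hne
  simp only [Pi.zero_apply, g, Configuration.lintegral_toMeasure, ENNReal.tsum_eq_zero] at hw
  have := hw ⟨x, hx⟩ ⟨y, hy⟩ ⟨y', hy'⟩
  simp [S, hne, he] at this

lemma ae_noTies' {ρ β : Measure (Configuration d)} (hρ : IsPoissonLaw ρ) (hβ : IsPoissonLaw β) :
    ∀ᵐ w ∂ρ.prod β, NoTies w.2.points w.1.points := by
  have := hρ.prob
  have := hβ.prob
  exact (Measure.measurePreserving_swap (μ := ρ) (ν := β)).quasiMeasurePreserving.ae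
    (ae_noTies hβ hρ)

/-- A measure on a product that is invariant under translations of the first factor is a product
of Lebesgue measure and a finite measure. -/
lemma exists_eq_volume_prod {T : Type*} [MeasurableSpace T] (Λ : Measure (Space d × T))
    (hinv : ∀ v, Λ.map (fun p => (v + p.1, p.2)) = Λ)
    (hfin : ∀ A : Set (Space d), MeasurableSet A → Λ (A ×ˢ Set.univ) ≤ volume A) :
    ∃ μ : Measure T, IsFiniteMeasure μ ∧ Λ = (volume : Measure (Space d)).prod μ := by
  let C : Set (Space d) := Metric.ball 0 1
  have hC : MeasurableSet C := measurableSet_ball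
  have hC0 : volume C ≠ 0 := (Metric.measure_ball_pos _ _ one_pos).ne'
  have hCt : volume C ≠ ∞ := measure_ball_lt_top.ne
  let μ₀ : Measure T := (Λ.restrict (C ×ˢ Set.univ)).map Prod.snd
  have hμ₀ : ∀ S, MeasurableSet S → μ₀ S = Λ (C ×ˢ S) := by
    intro S hS
    rw [Measure.map_apply measurable_snd hS, Measure.restrict_apply (measurable_snd hS)]
    congr 1
    ext p
    simp [and_comm]
  have hprod : ∀ A S, MeasurableSet A → MeasurableSet S →
      Λ (A ×ˢ S) * volume C = volume A * Λ (C ×ˢ S) := by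
    intro A S hA hS
    let Λs : Measure (Space d) := (Λ.restrict (Set.univ ×ˢ S)).map Prod.fst
    have hΛs : ∀ A, MeasurableSet A → Λs A = Λ (A ×ˢ S) := by
      intro A hA
      rw [Measure.map_apply measurable_fst hA, Measure.restrict_apply (measurable_fst hA)]
      congr 1
      ext p
      simp
    have hle : ∀ A, MeasurableSet A → Λs A ≤ volume A := fun A hA => by
      rw [hΛs A hA]
      exact (measure_mono (Set.prod_mono_right (Set.subset_univ _))).trans (hfin A hA)
    have : IsFiniteMeasureOnCompacts Λs :=
      ⟨fun K hK => (hle K hK.measurableSet).trans_lt hK.measure_lt_top⟩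
    have : Λs.IsAddLeftInvariant := by
      refine ⟨fun v => ?_⟩
      ext A hA
      rw [Measure.map_apply (measurable_const_add v) hA, hΛs _ (measurable_const_add v hA), hΛs _ hA]
      conv_rhs => rw [← hinv v]
      rw [Measure.map_apply (by fun_prop) (hA.prod hS)]
      rfl
    have h := Measure.isAddLeftInvariant_eq_smul Λs (volume : Measure (Space d))
    rw [← hΛs A hA, ← hΛs C hC, h]
    simp only [Measure.smul_apply, ENNReal.smul_def, smul_eq_mul]
    ring
  have hμf : IsFiniteMeasure μ₀ := ⟨by
    rw [hμ₀ _ MeasurableSet.univ]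
    exact (hfin C hC).trans_lt hCt.lt_top⟩
  refine ⟨(volume C)⁻¹ • μ₀, ?_, ?_⟩
  · exact Measure.smul_finite _ (ENNReal.inv_ne_top.mpr hC0)
  · have := Measure.smul_finite μ₀ (ENNReal.inv_ne_top.mpr hC0)
    refine (Measure.prod_eq fun A S hA hS => ?_).symm
    rw [Measure.smul_apply, hμ₀ S hS, smul_eq_mul, mul_left_comm, ← hprod A S hA hS,
      mul_comm (Λ _), ← mul_assoc, ENNReal.inv_mul_cancel hC0 hCt, one_mul]

/-- Distances to the partners given by a translation covariant stable matching. -/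
structure IsStationarySolution (a b : Configuration d × Configuration d → Space d → ℝ≥0∞) :
    Prop where
  measurable_red : Measurable (Function.uncurry a)
  measurable_blue : Measurable (Function.uncurry b)
  shift_red : ∀ v (w : Configuration d × Configuration d) x,
    a (w.1.shift v, w.2.shift v) (x + v) = a w x
  shift_blue : ∀ v (w : Configuration d × Configuration d) x,
    b (w.1.shift v, w.2.shift v) (x + v) = b w x
  isSolution : ∀ w : Configuration d × Configuration d,
    IsSolution w.1.points w.2.points (a w) (b w)

lemma isStationarySolution_redOpt : IsStationarySolution (d := d)
    (fun w => redOpt w.1.points w.2.points) (fun w => blueOpt w.1.points w.2.points) where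
  measurable_red := measurable_redOpt measurable_fst measurable_snd
  measurable_blue := measurable_blueOpt measurable_fst measurable_snd
  shift_red v _ x := redOpt_shift v _ _ x
  shift_blue v _ x := blueOpt_shift v _ _ x
  isSolution _ := isSolution_opt _ _

lemma isStationarySolution_blueOpt : IsStationarySolution (d := d)
    (fun w => blueOpt w.2.points w.1.points) (fun w => redOpt w.2.points w.1.points) where
  measurable_red := measurable_blueOpt measurable_snd measurable_fst
  measurable_blue := measurable_redOpt measurable_snd measurable_fst
  shift_red v _ x := blueOpt_shift v _ _ x
  shift_blue v _ x := redOpt_shift v _ _ x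
  isSolution _ := (isSolution_opt _ _).symm

/-- The indicator of the pairs of points matched to each other. -/
def matchInd (a b : Space d → ℝ≥0∞) (x y : Space d) : ℝ≥0∞ :=
  open Classical in if edist x y = a x ∧ edist x y = b y then 1 else 0

lemma matchInd_swap (a b : Space d → ℝ≥0∞) (x y : Space d) :
    matchInd b a y x = matchInd a b x y := by
  simp only [matchInd, edist_comm y x, and_comm]

lemma IsSolution.lintegral_matchInd {U V : Configuration d} {a b : Space d → ℝ≥0∞}
    (h : IsSolution U.points V.points a b) (hUV : NoTies U.points V.points) {x : Space d}
    (hx : x ∈ U.points) (f : ℝ≥0∞ → ℝ≥0∞) :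
    ∫⁻ y, matchInd a b x y * f (edist x y) ∂V.toMeasure = if a x = ∞ then 0 else f (a x) := by
  rw [Configuration.lintegral_toMeasure]
  split_ifs with hax
  · refine ENNReal.tsum_eq_zero.mpr fun y => ?_
    rw [matchInd, if_neg, zero_mul]
    exact fun hh => edist_ne_top x y (hh.1.trans hax)
  · obtain ⟨y₀, -, hy₀, h1, h2⟩ := h.exists_red hx (lt_top_iff_ne_top.mpr hax)
    simp only at hy₀ h1 h2
    rw [tsum_eq_single (⟨y₀, hy₀⟩ : V.points)]
    · rw [matchInd, if_pos ⟨h1, h2⟩, one_mul, h1]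
    · intro y hy
      rw [matchInd, if_neg, zero_mul]
      rintro ⟨h3, -⟩
      exact hy (Subtype.ext (hUV x hx y y.2 y₀ hy₀ (h3.trans h1.symm)))

lemma IsSolution.lintegral_matchInd_le {U V : Configuration d} {a b : Space d → ℝ≥0∞}
    (h : IsSolution U.points V.points a b) (hUV : NoTies U.points V.points) {x : Space d}
    (hx : x ∈ U.points) : ∫⁻ y, matchInd a b x y ∂V.toMeasure ≤ 1 := by
  have := h.lintegral_matchInd hUV hx fun _ => 1
  simp only [mul_one] at this
  rw [this]
  split_ifs <;> simp

/-! ### The intensity measure of matched pairs. -/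

section PairMeasure

variable {a b : Configuration d × Configuration d → Space d → ℝ≥0∞}

lemma IsStationarySolution.measurable_matchInd (h : IsStationarySolution a b) :
    Measurable fun p : (Configuration d × Configuration d) × Space d × Space d =>
      matchInd (a p.1) (b p.1) p.2.1 p.2.2 := by
  have h1 : Measurable fun p : (Configuration d × Configuration d) × Space d × Space d =>
    edist p.2.1 p.2.2 := by fun_prop
  have ha : Measurable fun p : (Configuration d × Configuration d) × Space d × Space d =>
    a p.1 p.2.1 := h.measurable_red.comp
      (f := fun p : (Configuration d × Configuration d) × Space d × Space d => (p.1, p.2.1))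
      (by fun_prop)
  have hb : Measurable fun p : (Configuration d × Configuration d) × Space d × Space d =>
    b p.1 p.2.2 := h.measurable_blue.comp
      (f := fun p : (Configuration d × Configuration d) × Space d × Space d => (p.1, p.2.2))
      (by fun_prop)
  exact Measurable.ite ((measurableSet_eq_fun h1 ha).inter (measurableSet_eq_fun h1 hb))
    measurable_const measurable_const

lemma IsStationarySolution.matchInd_shift (h : IsStationarySolution a b) (v : Space d)
    (w : Configuration d × Configuration d) (x y : Space d) :
    matchInd (a (w.1.shift v, w.2.shift v)) (b (w.1.shift v, w.2.shift v)) (x + v) (y + v) =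
      matchInd (a w) (b w) x y := by
  simp only [matchInd, h.shift_red, h.shift_blue, edist_add_right]

/-- The kernel of all pairs of a red and a blue point. -/
def pairKernel (d : ℕ) : Kernel (Configuration d × Configuration d) (Space d × Space d) :=
  (pointKernel d).comap Prod.fst measurable_fst ×ₖ (pointKernel d).comap Prod.snd measurable_snd

instance : IsSFiniteKernel (pairKernel d) := by
  unfold pairKernel; infer_instance

/-- The intensity of the matched pairs, with a pair `(x, y)` recorded as `(x, y - x)`. -/
def pairMeasure (Q : Measure (Configuration d × Configuration d))
    (a b : Configuration d × Configuration d → Space d → ℝ≥0∞) : Measure (Space d × Space d) :=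
  ((Q ⊗ₘ pairKernel d).withDensity fun p => matchInd (a p.1) (b p.1) p.2.1 p.2.2).map
    fun p => (p.2.1, p.2.2 - p.2.1)

lemma IsStationarySolution.lintegral_pairMeasure (h : IsStationarySolution a b)
    (Q : Measure (Configuration d × Configuration d)) [SFinite Q]
    {g : Space d × Space d → ℝ≥0∞} (hg : Measurable g) :
    ∫⁻ p, g p ∂pairMeasure Q a b = ∫⁻ w, ∫⁻ x, ∫⁻ y,
      matchInd (a w) (b w) x y * g (x, y - x) ∂w.2.toMeasure ∂w.1.toMeasure ∂Q := by
  have hm := h.measurable_matchInd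
  have hg' : Measurable fun p : (Configuration d × Configuration d) × Space d × Space d =>
    g (p.2.1, p.2.2 - p.2.1) := hg.comp (by fun_prop)
  rw [pairMeasure, lintegral_map hg (by fun_prop), lintegral_withDensity_eq_lintegral_mul _ hm hg',
    Measure.lintegral_compProd (hm.mul hg')]
  refine lintegral_congr fun w => ?_
  exact Kernel.lintegral_prod _ _ _ ((hm.mul hg').comp measurable_prodMk_left)

/-- Translating both processes preserves their joint law and carries matched pairs along. In the
coordinates `(x, y - x)` only the first component moves. -/
lemma IsStationarySolution.map_pairMeasure (h : IsStationarySolution a b)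
    {ρ β : Measure (Configuration d)} (hρ : IsPoissonLaw ρ) (hβ : IsPoissonLaw β) (v : Space d) :
    (pairMeasure (ρ.prod β) a b).map (fun p => (v + p.1, p.2)) = pairMeasure (ρ.prod β) a b := by
  have := hρ.prob
  have := hβ.prob
  have hQ : (ρ.prod β).map (Prod.map (Configuration.shift v) (Configuration.shift v)) =
      ρ.prod β := by
    rw [← Measure.map_prod_map _ _ (measurable_shift v) (measurable_shift v), hρ.map_shift,
      hβ.map_shift]
  refine Measure.ext_of_lintegral _ fun g hg => ?_
  rw [lintegral_map hg (by fun_prop), h.lintegral_pairMeasure _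
    (g := fun p => g (v + p.1, p.2)) (hg.comp (by fun_prop)), h.lintegral_pairMeasure _ hg]
  conv_rhs => rw [← hQ]
  rw [lintegral_map]
  · refine lintegral_congr fun w => ?_
    simp only [Prod.map_fst, Prod.map_snd, Configuration.lintegral_shift]
    refine lintegral_congr fun x => lintegral_congr fun y => ?_
    have := h.matchInd_shift v w x y
    simp only [Prod.map]
    rw [this, add_sub_add_right_eq_sub, add_comm v x]
  · refine measurable_lintegral_points measurable_fst
      (g := fun q : (Configuration d × Configuration d) × Space d => ∫⁻ y,
        matchInd (a q.1) (b q.1) q.2 y * g (q.2, y - q.2) ∂q.1.2.toMeasure) ?_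
    refine measurable_lintegral_points
      (c := fun q : (Configuration d × Configuration d) × Space d => q.1.2) (by fun_prop)
      (g := fun r => matchInd (a r.1.1) (b r.1.1) r.1.2 r.2 * g (r.1.2, r.2 - r.1.2)) ?_
    exact (h.measurable_matchInd.comp (f := fun r :
      ((Configuration d × Configuration d) × Space d) × Space d => (r.1.1, r.1.2, r.2))
      (by fun_prop)).mul (hg.comp (by fun_prop))
  · exact (measurable_shift v).prodMap (measurable_shift v)

lemma lintegral_fst_points {ρ β : Measure (Configuration d)} (hρ : IsPoissonLaw ρ)
    (hβ : IsPoissonLaw β) {f : Space d → ℝ≥0∞} (hf : Measurable f) :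
    ∫⁻ w, ∫⁻ x, f x ∂w.1.toMeasure ∂ρ.prod β = ∫⁻ x, f x := by
  have := hρ.prob
  have := hβ.prob
  rw [lintegral_prod _ (measurable_lintegral_points measurable_fst
    (g := fun q : (Configuration d × Configuration d) × Space d => f q.2)
    (hf.comp measurable_snd)).aemeasurable]
  simp only [lintegral_const, measure_univ, mul_one]
  exact hρ.campbell f hf

lemma lintegral_snd_points {ρ β : Measure (Configuration d)} (hρ : IsPoissonLaw ρ)
    (hβ : IsPoissonLaw β) {f : Space d → ℝ≥0∞} (hf : Measurable f) :
    ∫⁻ w, ∫⁻ x, f x ∂w.2.toMeasure ∂ρ.prod β = ∫⁻ x, f x := by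
  have := hρ.prob
  have := hβ.prob
  rw [lintegral_prod _ (measurable_lintegral_points measurable_snd
    (g := fun q : (Configuration d × Configuration d) × Space d => f q.2)
    (hf.comp measurable_snd)).aemeasurable]
  simp only [lintegral_const, measure_univ, mul_one]
  exact hβ.campbell f hf

/-- A red point has at most one partner, so the pairs with `x ∈ A` have intensity at most that of
the red points in `A`; this is the bound required by `exists_eq_volume_prod`. -/
lemma IsStationarySolution.exists_displacement (h : IsStationarySolution a b)
    {ρ β : Measure (Configuration d)} (hρ : IsPoissonLaw ρ) (hβ : IsPoissonLaw β) :
    ∃ μ : Measure (Space d), IsFiniteMeasure μ ∧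
      pairMeasure (ρ.prod β) a b = (volume : Measure (Space d)).prod μ := by
  have := hρ.prob
  have := hβ.prob
  refine exists_eq_volume_prod _ (h.map_pairMeasure hρ hβ) fun A hA => ?_
  have hA' : MeasurableSet (A ×ˢ (Set.univ : Set (Space d))) := hA.prod MeasurableSet.univ
  rw [← lintegral_indicator_one hA', h.lintegral_pairMeasure _ (measurable_one.indicator hA'),
    ← lintegral_indicator_one hA, ← lintegral_fst_points hρ hβ (measurable_one.indicator hA)]
  refine lintegral_mono_ae ?_
  filter_upwards [ae_noTies hρ hβ] with w hw
  refine lintegral_mono_ae ((w.1.ae_toMeasure _).mpr fun x hx => ?_)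
  by_cases hxA : x ∈ A
  · simpa [hxA] using (h.isSolution w).lintegral_matchInd_le hw hx
  · simp [hxA]

end PairMeasure

end StableMatching

/-! ### Mass transport, comparison of solutions, and the counting inequality in a ball. -/

namespace StableMatching

variable {d : ℕ}

section Displacement

variable {a b : Configuration d × Configuration d → Space d → ℝ≥0∞}
  {ρ β : Measure (Configuration d)} {μ : Measure (Space d)}

/-- The measure `μ` describes the displacement between matched points: the intensity of
the matched pairs `(x, y)`, recorded as `(x, y - x)`, is the product of Lebesgue measure and `μ`. -/
structure IsDisplacement (ρ β : Measure (Configuration d))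
    (a b : Configuration d × Configuration d → Space d → ℝ≥0∞) (μ : Measure (Space d)) : Prop where
  finite : IsFiniteMeasure μ
  red : IsPoissonLaw ρ
  blue : IsPoissonLaw β
  stationary : IsStationarySolution a b
  eq_prod : pairMeasure (ρ.prod β) a b = (volume : Measure (Space d)).prod μ

lemma IsDisplacement.lintegral_pair (h : IsDisplacement ρ β a b μ)
    {g : Space d × Space d → ℝ≥0∞} (hg : Measurable g) :
    ∫⁻ w, ∫⁻ x, ∫⁻ y, matchInd (a w) (b w) x y * g (x, y - x) ∂w.2.toMeasure ∂w.1.toMeasure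
      ∂ρ.prod β = ∫⁻ p, g p ∂(volume : Measure (Space d)).prod μ := by
  have := h.red.prob
  have := h.blue.prob
  rw [← h.eq_prod, h.stationary.lintegral_pairMeasure _ hg]

lemma IsDisplacement.lintegral_red (h : IsDisplacement ρ β a b μ)
    {f : Space d → ℝ≥0∞ → ℝ≥0∞} (hf : Measurable (Function.uncurry f)) :
    ∫⁻ w, ∫⁻ x, (if a w x = ∞ then 0 else f x (a w x)) ∂w.1.toMeasure ∂ρ.prod β =
      ∫⁻ x, ∫⁻ z, f x ‖z‖ₑ ∂μ := by
  have := h.red.prob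
  have := h.blue.prob
  have := h.finite
  have hg : Measurable fun p : Space d × Space d => f p.1 ‖p.2‖ₑ :=
    hf.comp (f := fun p : Space d × Space d => (p.1, ‖p.2‖ₑ)) (by fun_prop)
  rw [← lintegral_prod (fun p : Space d × Space d => f p.1 ‖p.2‖ₑ) hg.aemeasurable,
    ← h.lintegral_pair hg]
  refine lintegral_congr_ae ?_
  filter_upwards [ae_noTies h.red h.blue] with w hw
  refine lintegral_congr_ae ((w.1.ae_toMeasure _).mpr fun x hx => ?_)
  simp only [← edist_eq_enorm_sub]
  rw [← (h.stationary.isSolution w).lintegral_matchInd hw hx]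
  simp only [edist_comm x]

lemma lintegral_points_swap (U V : Configuration d) (f : Space d → Space d → ℝ≥0∞) :
    ∫⁻ x, ∫⁻ y, f x y ∂V.toMeasure ∂U.toMeasure = ∫⁻ y, ∫⁻ x, f x y ∂U.toMeasure ∂V.toMeasure := by
  simp_rw [Configuration.lintegral_toMeasure]
  exact ENNReal.tsum_comm

/-- Mass transport: the distance to the partner has the same law for red and for blue points. -/
lemma IsDisplacement.lintegral_blue (h : IsDisplacement ρ β a b μ)
    {f : Space d → ℝ≥0∞ → ℝ≥0∞} (hf : Measurable (Function.uncurry f)) :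
    ∫⁻ w, ∫⁻ y, (if b w y = ∞ then 0 else f y (b w y)) ∂w.2.toMeasure ∂ρ.prod β =
      ∫⁻ x, ∫⁻ z, f x ‖z‖ₑ ∂μ := by
  have := h.red.prob
  have := h.blue.prob
  have := h.finite
  have hg : Measurable fun p : Space d × Space d => f (p.1 + p.2) ‖p.2‖ₑ :=
    hf.comp (f := fun p : Space d × Space d => (p.1 + p.2, ‖p.2‖ₑ)) (by fun_prop)
  have hg' : Measurable fun p : Space d × Space d => f p.1 ‖p.2‖ₑ :=
    hf.comp (f := fun p : Space d × Space d => (p.1, ‖p.2‖ₑ)) (by fun_prop)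
  -- The blue end of a pair sits at `x + z`; for each fixed `z` the translation of Lebesgue measure
  -- by `z` removes this shift.
  have e : ∫⁻ x, ∫⁻ z, f x ‖z‖ₑ ∂μ =
      ∫⁻ p, f (p.1 + p.2) ‖p.2‖ₑ ∂(volume : Measure (Space d)).prod μ := by
    rw [lintegral_prod_symm _ hg.aemeasurable, lintegral_lintegral_swap hg'.aemeasurable]
    refine lintegral_congr fun z => ?_
    exact (lintegral_add_right_eq_self (fun x => f x ‖z‖ₑ) z).symm
  rw [e, ← h.lintegral_pair hg]
  refine lintegral_congr_ae ?_
  filter_upwards [ae_noTies' h.red h.blue] with w hw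
  rw [lintegral_points_swap]
  refine lintegral_congr_ae ((w.2.ae_toMeasure _).mpr fun y hy => ?_)
  simp only [← edist_eq_enorm_sub, add_sub_cancel]
  rw [← (h.stationary.isSolution w).symm.lintegral_matchInd hw hy]
  simp only [matchInd_swap]

lemma IsDisplacement.lintegral_red_lt (h : IsDisplacement ρ β a b μ) {f t : Space d → ℝ≥0∞}
    (hf : Measurable f) (ht : Measurable t) :
    ∫⁻ w, ∫⁻ x, (if a w x < t x then f x else 0) ∂w.1.toMeasure ∂ρ.prod β =
      ∫⁻ x, f x * μ {z | ‖z‖ₑ < t x} := by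
  have := h.lintegral_red (f := fun x s => if s < t x then f x else 0)
    (Measurable.ite (measurableSet_lt measurable_snd (ht.comp measurable_fst))
      (hf.comp measurable_fst) measurable_const)
  convert this using 1
  · refine lintegral_congr fun w => lintegral_congr fun x => ?_
    split_ifs with h1 h2 h2 <;> simp_all
  · refine lintegral_congr fun x => ?_
    have hm : MeasurableSet {z : Space d | ‖z‖ₑ < t x} :=
      measurableSet_lt (by fun_prop) measurable_const
    rw [← lintegral_indicator_const hm]
    exact lintegral_congr fun z => by simp [Set.indicator_apply]

lemma IsDisplacement.lintegral_blue_lt (h : IsDisplacement ρ β a b μ) {f t : Space d → ℝ≥0∞}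
    (hf : Measurable f) (ht : Measurable t) :
    ∫⁻ w, ∫⁻ y, (if b w y < t y then f y else 0) ∂w.2.toMeasure ∂ρ.prod β =
      ∫⁻ x, f x * μ {z | ‖z‖ₑ < t x} := by
  have := h.lintegral_blue (f := fun x s => if s < t x then f x else 0)
    (Measurable.ite (measurableSet_lt measurable_snd (ht.comp measurable_fst))
      (hf.comp measurable_fst) measurable_const)
  convert this using 1
  · refine lintegral_congr fun w => lintegral_congr fun x => ?_
    split_ifs with h1 h2 h2 <;> simp_all
  · refine lintegral_congr fun x => ?_
    have hm : MeasurableSet {z : Space d | ‖z‖ₑ < t x} :=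
      measurableSet_lt (by fun_prop) measurable_const
    rw [← lintegral_indicator_const hm]
    exact lintegral_congr fun z => by simp [Set.indicator_apply]

/-- Two ordered stationary solutions agree almost surely. -/
lemma IsDisplacement.ae_eq {a' b' : Configuration d × Configuration d → Space d → ℝ≥0∞}
    {μ' : Measure (Space d)} (h : IsDisplacement ρ β a b μ) (h' : IsDisplacement ρ β a' b' μ')
    (ha : ∀ w, ∀ x ∈ w.1.points, a w x ≤ a' w x) (hb : ∀ w, ∀ y ∈ w.2.points, b' w y ≤ b w y) :
    ∀ᵐ w ∂ρ.prod β, ∀ x ∈ w.1.points, a w x = a' w x := by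
  have := h.red.prob
  have := h.blue.prob
  let κ : Kernel (Configuration d × Configuration d) (Space d) :=
    (pointKernel d).comap Prod.fst measurable_fst
  -- With a fixed threshold and a bounded window all integrals are finite, so two ordered functions
  -- with equal integrals agree almost everywhere. Countably many thresholds and windows then
  -- suffice.
  have key : ∀ (q : ℚ≥0) (n : ℕ), ∀ᵐ w ∂ρ.prod β, ∀ x ∈ w.1.points,
      ‖x‖ₑ < n → (a w x < ((q : ℝ≥0) : ℝ≥0∞) ↔ a' w x < ((q : ℝ≥0) : ℝ≥0∞)) := by
    intro q n
    let t : ℝ≥0∞ := ((q : ℝ≥0) : ℝ≥0∞)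
    let f : Space d → ℝ≥0∞ := Set.indicator {x | ‖x‖ₑ < n} 1
    have hfs : MeasurableSet {x : Space d | ‖x‖ₑ < n} :=
      measurableSet_lt (by fun_prop) measurable_const
    have hf : Measurable f := measurable_one.indicator hfs
    have hm : ∀ a'' : Configuration d × Configuration d → Space d → ℝ≥0∞,
        Measurable (Function.uncurry a'') → Measurable
        fun p : (Configuration d × Configuration d) × Space d =>
          if a'' p.1 p.2 < t then f p.2 else 0 := fun a'' ha'' =>
      Measurable.ite (measurableSet_lt ha'' measurable_const) (hf.comp measurable_snd)
        measurable_const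
    have e : ∀ a'' : Configuration d × Configuration d → Space d → ℝ≥0∞,
        Measurable (Function.uncurry a'') →
        ∫⁻ p, (if a'' p.1 p.2 < t then f p.2 else 0) ∂(ρ.prod β) ⊗ₘ κ =
        ∫⁻ w, ∫⁻ x, (if a'' w x < t then f x else 0) ∂w.1.toMeasure ∂ρ.prod β := fun a'' ha'' =>
      Measure.lintegral_compProd (hm a'' ha'')
    have h1 := h.lintegral_red_lt hf (measurable_const (a := t))
    have h2 := h.lintegral_blue_lt hf (measurable_const (a := t))
    have h3 := h'.lintegral_red_lt hf (measurable_const (a := t))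
    have h4 := h'.lintegral_blue_lt hf (measurable_const (a := t))
    -- The ordering of the red distances gives the opposite inequality. This one is read off the
    -- blue distances, which have the same law within each solution but are ordered the other way
    -- round.
    have hle : ∫⁻ w, ∫⁻ x, (if a w x < t then f x else 0) ∂w.1.toMeasure ∂ρ.prod β ≤
        ∫⁻ w, ∫⁻ x, (if a' w x < t then f x else 0) ∂w.1.toMeasure ∂ρ.prod β := by
      rw [h1, ← h2, h3, ← h4]
      refine lintegral_mono fun w => lintegral_mono_ae ((w.2.ae_toMeasure _).mpr fun y hy => ?_)
      by_cases hlt : b w y < t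
      · rw [if_pos hlt, if_pos ((hb w y hy).trans_lt hlt)]
      · rw [if_neg hlt]; exact zero_le
    have hfin : ∫⁻ w, ∫⁻ x, (if a' w x < t then f x else 0) ∂w.1.toMeasure ∂ρ.prod β ≠ ∞ := by
      refine ne_top_of_le_ne_top (b := ∫⁻ x, f x) ?_ ?_
      · rw [lintegral_indicator_one hfs]
        have : {x : Space d | ‖x‖ₑ < n} = Metric.ball 0 n := by
          ext x
          simp [← edist_zero_right, ← ENNReal.ofReal_natCast, edist_lt_ofReal]
        rw [this]
        exact measure_ball_lt_top.ne
      · rw [← lintegral_fst_points h.red h.blue hf]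
        refine lintegral_mono fun w => lintegral_mono fun x => ?_
        split_ifs <;> simp
    have hae : ∀ᵐ p ∂(ρ.prod β) ⊗ₘ κ,
        (if a' p.1 p.2 < t then f p.2 else 0) ≤ (if a p.1 p.2 < t then f p.2 else 0) := by
      refine (Measure.ae_compProd_iff (measurableSet_le (hm a' h'.stationary.measurable_red)
        (hm a h.stationary.measurable_red))).mpr (Filter.Eventually.of_forall fun w => ?_)
      refine (w.1.ae_toMeasure _).mpr fun x hx => ?_
      by_cases hlt : a' w x < t
      · simp only
        rw [if_pos hlt, if_pos ((ha w x hx).trans_lt hlt)]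
      · simp only
        rw [if_neg hlt]; exact zero_le
    have heq := ae_eq_of_ae_le_of_lintegral_le hae (by rw [e _ h'.stationary.measurable_red]; exact hfin)
      (hm a h.stationary.measurable_red).aemeasurable
      (by rw [e _ h'.stationary.measurable_red, e _ h.stationary.measurable_red]; exact hle)
    filter_upwards [Measure.ae_ae_of_ae_compProd heq] with w hw x hx hxn
    have hx' := (w.1.ae_toMeasure _).mp hw x hx
    have hf1 : f x = 1 := Set.indicator_of_mem (s := {x : Space d | ‖x‖ₑ < n}) hxn 1
    simp only [hf1] at hx'
    change a w x < t ↔ a' w x < t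
    split_ifs at hx' with h5 h6 h6
    · exact iff_of_true h6 h5
    · exact absurd hx' one_ne_zero
    · exact absurd hx' zero_ne_one
    · exact iff_of_false h6 h5
  have hall := ae_all_iff.mpr fun q : ℚ≥0 => ae_all_iff.mpr fun n : ℕ => key q n
  filter_upwards [hall] with w hw x hx
  obtain ⟨n, hn⟩ := exists_nat_gt ‖x‖
  have hn' : ‖x‖ₑ < n := by
    rw [← ofReal_norm, ← ENNReal.ofReal_natCast]
    exact (ENNReal.ofReal_lt_ofReal_iff_of_nonneg (norm_nonneg _)).mpr hn
  refine le_antisymm (ha w x hx) ?_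
  by_contra! hlt
  obtain ⟨q, hq1, hq2⟩ := ENNReal.lt_iff_exists_nnreal_btwn.mp hlt
  obtain ⟨r, hr1, hr2⟩ := ENNReal.lt_iff_exists_nnreal_btwn.mp hq2
  obtain ⟨k, hk1, hk2⟩ := exists_rat_btwn (x := (q : ℝ)) (y := r)
    (by exact_mod_cast hr1)
  have hk0 : 0 ≤ k := by exact_mod_cast (q.coe_nonneg.trans hk1.le)
  lift k to ℚ≥0 using hk0
  have h1 : a w x < ((k : ℝ≥0) : ℝ≥0∞) := hq1.trans (by
    rw [ENNReal.coe_lt_coe, ← NNReal.coe_lt_coe]; exact_mod_cast hk1)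
  have h2 : ((k : ℝ≥0) : ℝ≥0∞) < a' w x := lt_trans (by
    rw [ENNReal.coe_lt_coe, ← NNReal.coe_lt_coe]; exact_mod_cast hk2) hr2
  exact h2.not_gt ((hw k n x hx hn').mp h1)

/-- In a ball `D` around the origin, there cannot be both a red and a blue point that are matched
outside of a larger ball. -/
lemma IsSolution.ball_inequality {U V : Configuration d} {a b : Space d → ℝ≥0∞}
    (h : IsSolution U.points V.points a b) (hUV : NoTies U.points V.points)
    (hVU : NoTies V.points U.points) (r : ℝ≥0) :
    U.toMeasure (Metric.eball 0 r) + V.toMeasure (Metric.eball 0 r) +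
      ∫⁻ x, ∫⁻ y, matchInd a b x y * ((Metric.eball 0 (r : ℝ≥0∞)).indicator 1 x *
        (Metric.eball 0 (r : ℝ≥0∞)).indicator 1 y) ∂V.toMeasure ∂U.toMeasure ≤
    max (U.toMeasure (Metric.eball 0 r)) (V.toMeasure (Metric.eball 0 r)) +
      (∫⁻ x, (if a x < r + ‖x‖ₑ then (Metric.eball 0 (r : ℝ≥0∞)).indicator 1 x else 0)
        ∂U.toMeasure +
      ∫⁻ y, (if b y < r + ‖y‖ₑ then (Metric.eball 0 (r : ℝ≥0∞)).indicator 1 y else 0)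
        ∂V.toMeasure) := by
  set D : Set (Space d) := Metric.eball 0 (r : ℝ≥0∞) with hD
  have hDm : MeasurableSet D := Metric.isOpen_eball.measurableSet
  have mem_D : ∀ x : Space d, x ∈ D ↔ ‖x‖ₑ < r := fun x => by
    rw [hD, Metric.mem_eball, edist_zero_right]
  have hlt : ∀ x y : Space d, y ∈ D → edist x y < r + ‖x‖ₑ := by
    intro x y hy
    calc edist x y ≤ ‖x‖ₑ + ‖y‖ₑ := by
          rw [edist_eq_enorm_sub]; exact enorm_sub_le
      _ < r + ‖x‖ₑ := by
          rw [add_comm (r : ℝ≥0∞)]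
          exact ENNReal.add_lt_add_left enorm_ne_top ((mem_D y).mp hy)
  -- A matched pair inside `D` is charged to its endpoint in `U`. That endpoint has at most one
  -- partner, and by `hlt` a partner in `D` is at distance below `r + ‖x‖ₑ`.
  have aux : ∀ (U V : Configuration d) (a b : Space d → ℝ≥0∞),
      IsSolution U.points V.points a b → NoTies U.points V.points →
      ∫⁻ x, ∫⁻ y, matchInd a b x y * (D.indicator 1 x * D.indicator 1 y)
        ∂V.toMeasure ∂U.toMeasure ≤
      ∫⁻ x, (if a x < r + ‖x‖ₑ then D.indicator 1 x else 0) ∂U.toMeasure := by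
    intro U V a b h hUV
    refine lintegral_mono_ae ((U.ae_toMeasure _).mpr fun x hx => ?_)
    split_ifs with hlt'
    · refine le_trans (lintegral_mono fun y => ?_) ((lintegral_mul_const' (D.indicator 1 x) _
        (by by_cases hxD : x ∈ D <;> simp [hxD])).le.trans
        ((mul_le_mul_left (h.lintegral_matchInd_le hUV hx) _).trans (one_mul _).le))
      by_cases hyD : y ∈ D <;> simp [hyD]
    · refine (lintegral_eq_zero_of_ae_eq_zero ((V.ae_toMeasure _).mpr fun y hy => ?_)).le
      by_cases hyD : y ∈ D
      · have hm : matchInd a b x y = 0 := by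
          rw [matchInd, if_neg]
          exact fun hh => hlt' (hh.1 ▸ hlt x y hyD)
        simp [hm]
      · simp [hyD]
  have full : ∀ (U : Configuration d) (a : Space d → ℝ≥0∞),
      (∀ x ∈ U.points, x ∈ D → a x < r + ‖x‖ₑ) →
      U.toMeasure D ≤ ∫⁻ x, (if a x < r + ‖x‖ₑ then D.indicator 1 x else 0) ∂U.toMeasure := by
    intro U a hU
    rw [← lintegral_indicator_one hDm]
    refine lintegral_mono_ae ((U.ae_toMeasure _).mpr fun x hx => ?_)
    by_cases hxD : x ∈ D
    · rw [if_pos (hU x hx hxD)]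
    · simp [hxD]
  -- If every blue point of `D` is matched this closely, the blue term pays for all of them and the
  -- red term pays for the pairs. Otherwise one blue exception forces every red point of `D` to be
  -- matched closely, and the colours exchange roles.
  by_cases hblue : ∀ y ∈ V.points, y ∈ D → b y < r + ‖y‖ₑ
  · calc _ = U.toMeasure D + (∫⁻ x, ∫⁻ y, matchInd a b x y * (D.indicator 1 x * D.indicator 1 y)
          ∂V.toMeasure ∂U.toMeasure + V.toMeasure D) := by ring
      _ ≤ _ := add_le_add (le_max_left _ _) (add_le_add (aux U V a b h hUV) (full V b hblue))
  · have hred : ∀ x ∈ U.points, x ∈ D → a x < r + ‖x‖ₑ := by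
      push Not at hblue
      obtain ⟨y, hyV, hyD, hby⟩ := hblue
      intro x hx hxD
      rcases h.le_or_le hx hyV with h1 | h1
      · exact h1.trans_lt (hlt x y hyD)
      · exact absurd (hby.trans h1) (by rw [edist_comm]; exact (hlt y x hxD).not_ge)
    have haux := aux V U b a h.symm hVU
    rw [lintegral_points_swap] at haux
    simp only [matchInd_swap a b] at haux
    calc _ = V.toMeasure D + (U.toMeasure D + ∫⁻ x, ∫⁻ y, matchInd a b x y *
          (D.indicator 1 x * D.indicator 1 y) ∂V.toMeasure ∂U.toMeasure) := by ring
      _ ≤ _ := by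
        refine add_le_add (le_max_right _ _) (add_le_add (full U a hred) ?_)
        refine le_of_eq_of_le ?_ haux
        exact lintegral_congr fun x => lintegral_congr fun y => by
          rw [mul_comm (D.indicator 1 x)]

end Displacement

end StableMatching

/-! ### The counting inequality in expectation. -/

namespace StableMatching

variable {d : ℕ}

section Expectation

variable {a b : Configuration d × Configuration d → Space d → ℝ≥0∞}
  {ρ β : Measure (Configuration d)} {μ : Measure (Space d)}

lemma IsDisplacement.measure_univ_le_one (h : IsDisplacement ρ β a b μ) : μ Set.univ ≤ 1 := by
  have := h.red.prob
  have := h.blue.prob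
  have := h.finite
  have hD : MeasurableSet (Metric.ball (0 : Space d) 1) := measurableSet_ball
  have h1 := h.lintegral_red_lt (f := (Metric.ball (0 : Space d) 1).indicator 1)
    (t := fun _ => ∞) (measurable_one.indicator hD) measurable_const
  have h2 : ∫⁻ w, ∫⁻ x, (if a w x < ∞ then (Metric.ball (0 : Space d) 1).indicator 1 x else 0)
      ∂w.1.toMeasure ∂ρ.prod β ≤ volume (Metric.ball (0 : Space d) 1) := by
    rw [← lintegral_indicator_one hD,
      ← lintegral_fst_points h.red h.blue (measurable_one.indicator hD)]
    refine lintegral_mono fun w => lintegral_mono fun x => ?_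
    split_ifs <;> simp
  rw [h1] at h2
  simp only [enorm_lt_top, Set.ofPred_true] at h2
  rw [lintegral_mul_const _ (measurable_one.indicator hD), lintegral_indicator_one hD] at h2
  have hpos : volume (Metric.ball (0 : Space d) 1) ≠ 0 :=
    (Metric.measure_ball_pos _ _ one_pos).ne'
  rw [← ENNReal.mul_le_mul_iff_right hpos measure_ball_lt_top.ne]
  simpa using h2

/-- The maximum of the two counts is at most the volume plus both excesses, so its mean exceeds the
volume by at most two standard deviations. The common volume term is then cancelled. -/
lemma IsDisplacement.ball_inequality (h : IsDisplacement ρ β a b μ) (r : ℝ≥0) :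
    volume (Metric.eball (0 : Space d) r) +
      ∫⁻ p, (Metric.eball (0 : Space d) (r : ℝ≥0∞)).indicator 1 p.1 *
        (Metric.eball (0 : Space d) (r : ℝ≥0∞)).indicator 1 (p.1 + p.2)
          ∂(volume : Measure (Space d)).prod μ ≤
    2 * (NNReal.sqrt (volume (Metric.eball (0 : Space d) r)).toNNReal : ℝ≥0∞) +
      2 * ∫⁻ x, (Metric.eball (0 : Space d) (r : ℝ≥0∞)).indicator 1 x *
        μ {z | ‖z‖ₑ < r + ‖x‖ₑ} := by
  have := h.red.prob
  have := h.blue.prob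
  have hmono := ((ae_noTies h.red h.blue).and (ae_noTies' h.red h.blue)).mono fun w hw =>
    (h.stationary.isSolution w).ball_inequality hw.1 hw.2 r
  set D : Set (Space d) := Metric.eball 0 (r : ℝ≥0∞) with hD
  have hDm : MeasurableSet D := Metric.isOpen_eball.measurableSet
  have hDf : volume D < ∞ := by
    rw [hD, Metric.eball_coe]; exact measure_ball_lt_top
  have hind : Measurable (D.indicator (1 : Space d → ℝ≥0∞)) := measurable_one.indicator hDm
  have hU : Measurable fun w : Configuration d × Configuration d => w.1.toMeasure D :=
    (Measure.measurable_coe hDm).comp ((pointKernel d).measurable.comp measurable_fst)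
  have hV : Measurable fun w : Configuration d × Configuration d => w.2.toMeasure D :=
    (Measure.measurable_coe hDm).comp ((pointKernel d).measurable.comp measurable_snd)
  have eU : ∫⁻ w, w.1.toMeasure D ∂ρ.prod β = volume D := by
    have := lintegral_fst_points h.red h.blue hind
    simpa only [lintegral_indicator_one hDm] using this
  have eV : ∫⁻ w, w.2.toMeasure D ∂ρ.prod β = volume D := by
    have := lintegral_snd_points h.red h.blue hind
    simpa only [lintegral_indicator_one hDm] using this
  have exU : ∫⁻ w, (w.1.toMeasure D - volume D) ∂ρ.prod β ≤
      (NNReal.sqrt (volume D).toNNReal : ℝ≥0∞) := by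
    rw [lintegral_prod _ (hU.sub_const _).aemeasurable]
    simpa using h.red.excess D hDm hDf
  have exV : ∫⁻ w, (w.2.toMeasure D - volume D) ∂ρ.prod β ≤
      (NNReal.sqrt (volume D).toNNReal : ℝ≥0∞) := by
    rw [lintegral_prod _ (hV.sub_const _).aemeasurable]
    simpa using h.blue.excess D hDm hDf
  have hmax : ∫⁻ w, max (w.1.toMeasure D) (w.2.toMeasure D) ∂ρ.prod β ≤
      volume D + 2 * (NNReal.sqrt (volume D).toNNReal : ℝ≥0∞) := by
    calc ∫⁻ w, max (w.1.toMeasure D) (w.2.toMeasure D) ∂ρ.prod β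
        ≤ ∫⁻ w, (volume D + ((w.1.toMeasure D - volume D) + (w.2.toMeasure D - volume D)))
            ∂ρ.prod β := by
          refine lintegral_mono fun w => max_le ?_ ?_
          · exact le_add_tsub.trans (add_le_add le_rfl le_self_add)
          · exact le_add_tsub.trans (add_le_add le_rfl le_add_self)
      _ ≤ _ := by
          rw [lintegral_add_left measurable_const, lintegral_add_left (hU.sub_const _), two_mul]
          simp only [lintegral_const, measure_univ, mul_one]
          exact add_le_add le_rfl (add_le_add exU exV)
  have ht : Measurable fun x : Space d => (r : ℝ≥0∞) + ‖x‖ₑ := by fun_prop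
  have hredeq := h.lintegral_red_lt hind ht
  have hblueeq := h.lintegral_blue_lt hind ht
  have hpair := h.lintegral_pair (g := fun p => D.indicator 1 p.1 * D.indicator 1 (p.1 + p.2))
    ((hind.comp measurable_fst).mul (hind.comp (measurable_fst.add measurable_snd)))
  simp only [add_sub_cancel] at hpair
  have hred_meas : Measurable fun w : Configuration d × Configuration d =>
      ∫⁻ x, (if a w x < r + ‖x‖ₑ then D.indicator 1 x else 0) ∂w.1.toMeasure :=
    measurable_lintegral_points measurable_fst
      (g := fun q : (Configuration d × Configuration d) × Space d =>
        if a q.1 q.2 < r + ‖q.2‖ₑ then D.indicator 1 q.2 else 0)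
      (Measurable.ite (measurableSet_lt h.stationary.measurable_red (ht.comp measurable_snd))
        (hind.comp measurable_snd) measurable_const)
  have hint := lintegral_mono_ae hmono
  have hsum : Measurable fun w : Configuration d × Configuration d =>
    w.1.toMeasure D + w.2.toMeasure D := hU.add hV
  have hmaxm : Measurable fun w : Configuration d × Configuration d =>
    max (w.1.toMeasure D) (w.2.toMeasure D) := hU.max hV
  rw [lintegral_add_left hsum, lintegral_add_left hU, eU, eV, hpair,
    lintegral_add_left hmaxm, lintegral_add_left hred_meas, hredeq, hblueeq] at hint
  have hint' := hint.trans (add_le_add hmax le_rfl)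
  rw [add_assoc, add_assoc, ENNReal.add_le_add_iff_left hDf.ne, ← two_mul] at hint'
  exact hint'

end Expectation

/-! ### The volume of the intersection of two balls. -/

section Lens

/-- Splitting off the first coordinate. -/
def splitFirst (n : ℕ) : Space (n + 1) ≃ᵐ ℝ × Space n :=
  ((MeasurableEquiv.toLp 2 (Fin (n + 1) → ℝ)).symm.trans
    (MeasurableEquiv.piFinSuccAbove (fun _ => ℝ) 0)).trans
    (MeasurableEquiv.prodCongr (MeasurableEquiv.refl ℝ) (MeasurableEquiv.toLp 2 (Fin n → ℝ)))

lemma measurePreserving_splitFirst (n : ℕ) : MeasurePreserving (splitFirst n) := by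
  have h1 := EuclideanSpace.volume_preserving_symm_measurableEquiv_toLp (Fin (n + 1))
  have h2 := volume_preserving_piFinSuccAbove (fun _ : Fin (n + 1) => ℝ) 0
  have h3 : MeasurePreserving (MeasurableEquiv.prodCongr (MeasurableEquiv.refl ℝ)
      (MeasurableEquiv.toLp 2 (Fin n → ℝ))) :=
    (MeasurePreserving.id volume).prod
      (EuclideanSpace.volume_preserving_symm_measurableEquiv_toLp (Fin n)).symm
  exact h3.comp (h2.comp h1)

lemma splitFirst_fst {n : ℕ} (x : Space (n + 1)) : (splitFirst n x).1 = x 0 := rfl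

lemma splitFirst_snd {n : ℕ} (x : Space (n + 1)) (i : Fin n) :
    (splitFirst n x).2 i = x i.succ := rfl

lemma norm_sq_eq_splitFirst {n : ℕ} (x : Space (n + 1)) :
    ‖x‖ ^ 2 = (splitFirst n x).1 ^ 2 + ‖(splitFirst n x).2‖ ^ 2 := by
  rw [EuclideanSpace.norm_sq_eq, EuclideanSpace.norm_sq_eq, Fin.sum_univ_succ, splitFirst_fst]
  simp only [splitFirst_snd, Real.norm_eq_abs, sq_abs]

lemma exists_isometry_map_eq {E : Type*} [NormedAddCommGroup E] [InnerProductSpace ℝ E]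
    [FiniteDimensional ℝ E] {v w : E} (h : ‖v‖ = ‖w‖) : ∃ φ : E ≃ₗᵢ[ℝ] E, φ v = w :=
  ⟨Submodule.reflection (ℝ ∙ (v - w))ᗮ, Submodule.reflection_sub h⟩

/-- The substitution t = 2|k| + u. With k the offset from the midpoint of two centres at distance u,
t / 2 is the distance of the slice from the farther centre. -/
lemma lintegral_comp_abs_two (g : ℝ → ℝ≥0∞) (hg : Measurable g) (u : ℝ) :
    ∫⁻ k : ℝ, g (2 * |k| + u) = ∫⁻ t in Set.Ioi u, g t := by
  have h1 : ∫⁻ k : ℝ, g (|k| + u) = 2 * ∫⁻ k : ℝ, g (2 * |k| + u) := by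
    have hm : Measurable fun k : ℝ => g (|k| + u) := hg.comp (by fun_prop)
    conv_lhs => rw [← Real.smul_map_volume_mul_left (two_ne_zero (α := ℝ))]
    rw [lintegral_smul_measure, lintegral_map hm (measurable_const_mul 2)]
    simp [abs_mul]
  have h2 : ∫⁻ k : ℝ, g (|k| + u) = 2 * ∫⁻ t in Set.Ioi u, g t := by
    rw [← lintegral_add_compl _ (measurableSet_Ioi (a := (0 : ℝ))), two_mul]
    have h3 : ∫⁻ k in Set.Ioi (0 : ℝ), g (|k| + u) = ∫⁻ t in Set.Ioi u, g t := by
      rw [← lintegral_indicator measurableSet_Ioi, ← lintegral_indicator measurableSet_Ioi]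
      conv_rhs => rw [← lintegral_add_right_eq_self _ u]
      refine lintegral_congr fun k => ?_
      by_cases hk : 0 < k
      · simp [Set.indicator, hk, abs_of_pos hk]
      · simp [Set.indicator, hk]
    have h4 : ∫⁻ k in (Set.Ioi (0 : ℝ))ᶜ, g (|k| + u) =
        ∫⁻ k in Set.Ioi (0 : ℝ), g (|k| + u) := by
      rw [Set.compl_Ioi, ← setLIntegral_congr (Iio_ae_eq_Iic (a := (0 : ℝ))),
        ← lintegral_indicator measurableSet_Ioi, ← lintegral_indicator measurableSet_Iio,
        ← lintegral_neg_eq_self]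
      refine lintegral_congr fun k => ?_
      by_cases hk : 0 < k <;> simp [Set.indicator, hk]
    rw [h4, h3]
  have h5 := h1.symm.trans h2
  exact (ENNReal.mul_right_inj two_ne_zero ENNReal.ofNat_ne_top).mp h5

/-- The volume of the slice at distance `t / 2` from the center of a ball of radius `r`. -/
def sliceVolume (n : ℕ) (r t : ℝ) : ℝ≥0∞ :=
  volume (Metric.ball (0 : Space n) (√(r ^ 2 - (t / 2) ^ 2)))

lemma sliceVolume_eq {n : ℕ} (hn : n ≠ 0) (r t : ℝ) : sliceVolume n r t =
    ENNReal.ofReal (√(r ^ 2 - (t / 2) ^ 2) ^ n) * volume (Metric.ball (0 : Space n) 1) := by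
  have : Nonempty (Fin n) := ⟨⟨0, Nat.pos_of_ne_zero hn⟩⟩
  rw [sliceVolume, Measure.addHaar_ball _ _ (Real.sqrt_nonneg _)]
  simp

lemma measurable_sliceVolume {n : ℕ} (hn : n ≠ 0) (r : ℝ) : Measurable (sliceVolume n r) := by
  have : sliceVolume n r = fun t => ENNReal.ofReal (√(r ^ 2 - (t / 2) ^ 2) ^ n) *
      volume (Metric.ball (0 : Space n) 1) := funext fun t => sliceVolume_eq hn r t
  rw [this]
  fun_prop

/-- The volume of the intersection of two balls of the same radius. -/
lemma volume_lens {n : ℕ} (hn : n ≠ 0) {r : ℝ} (hr : 0 < r) (z : Space (n + 1)) :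
    volume (Metric.ball (0 : Space (n + 1)) r ∩ (fun x => x + z) ⁻¹' Metric.ball 0 r) =
      ∫⁻ t in Set.Ioi ‖z‖, sliceVolume n r t := by
  set u := ‖z‖ with hu
  -- An isometry moves `z` onto the first coordinate axis, after which the lens can be sliced along
  -- that axis.
  let e : Space (n + 1) := EuclideanSpace.single 0 u
  have he : ‖z‖ = ‖e‖ := by simp [e, u]
  obtain ⟨φ, hφ⟩ := exists_isometry_map_eq he
  let T : Set (ℝ × Space n) := {p | p.1 ^ 2 + ‖p.2‖ ^ 2 < r ^ 2 ∧
    (p.1 + u) ^ 2 + ‖p.2‖ ^ 2 < r ^ 2}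
  have hT : MeasurableSet T := by
    refine MeasurableSet.inter ?_ ?_
    · have : Measurable fun p : ℝ × Space n => p.1 ^ 2 + ‖p.2‖ ^ 2 := by fun_prop
      exact measurableSet_lt this measurable_const
    · have : Measurable fun p : ℝ × Space n => (p.1 + u) ^ 2 + ‖p.2‖ ^ 2 := by fun_prop
      exact measurableSet_lt this measurable_const
  have hset : Metric.ball (0 : Space (n + 1)) r ∩ (fun x => x + z) ⁻¹' Metric.ball 0 r =
      φ ⁻¹' (splitFirst n ⁻¹' T) := by
    ext x
    have h1 : ‖x‖ ^ 2 = (splitFirst n (φ x)).1 ^ 2 + ‖(splitFirst n (φ x)).2‖ ^ 2 := by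
      rw [← norm_sq_eq_splitFirst, φ.norm_map]
    have h2 : ‖x + z‖ ^ 2 = ((splitFirst n (φ x)).1 + u) ^ 2 + ‖(splitFirst n (φ x)).2‖ ^ 2 := by
      have hs1 : (splitFirst n (φ x + e)).1 = (splitFirst n (φ x)).1 + u := by
        simp [splitFirst_fst, e]
      have hs2 : (splitFirst n (φ x + e)).2 = (splitFirst n (φ x)).2 := by
        ext i
        simp [splitFirst_snd, e]
      rw [← φ.norm_map, map_add, hφ, norm_sq_eq_splitFirst, hs1, hs2]
    simp only [Set.mem_inter_iff, Set.mem_preimage, Metric.mem_ball, dist_zero_right, T,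
      Set.mem_ofPred_eq, ← h1, ← h2]
    rw [sq_lt_sq₀ (norm_nonneg _) hr.le, sq_lt_sq₀ (norm_nonneg _) hr.le]
  -- The shift by `-(u / 2)` moves the midpoint between the two centres to the origin. The slice at
  -- offset k is then cut out by the ball whose centre is farther away, at distance |k| + u / 2.
  rw [hset, φ.measurePreserving.measure_preimage
      ((splitFirst n).measurable hT).nullMeasurableSet,
    (measurePreserving_splitFirst n).measure_preimage hT.nullMeasurableSet,
    Measure.volume_eq_prod, Measure.prod_apply hT,
    ← lintegral_comp_abs_two _ (measurable_sliceVolume hn r),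
    ← lintegral_add_right_eq_self _ (-(u / 2))]
  refine lintegral_congr fun k => ?_
  rw [sliceVolume]
  congr 1
  ext w
  simp only [T, Set.mem_preimage, Set.mem_ofPred_eq, Metric.mem_ball, dist_zero_right]
  rw [Real.lt_sqrt (norm_nonneg _)]
  have hu0 : 0 ≤ u := norm_nonneg _
  rcases le_total 0 k with hk | hk
  · rw [abs_of_nonneg hk]
    constructor
    · rintro ⟨h1, h2⟩; nlinarith
    · intro h; constructor <;> nlinarith
  · rw [abs_of_nonpos hk]
    constructor
    · rintro ⟨h1, h2⟩; nlinarith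
    · intro h; constructor <;> nlinarith

end Lens

end StableMatching

/-! ### The integral inequality for the tail. -/

namespace StableMatching

section RealInequality

/-- The volume of the unit ball. -/
def ballVolume (n : ℕ) : ℝ := volume.real (Metric.ball (0 : Space n) 1)

lemma ballVolume_pos (n : ℕ) : 0 < ballVolume n :=
  ENNReal.toReal_pos (Metric.measure_ball_pos _ _ one_pos).ne' measure_ball_lt_top.ne

lemma ofReal_ballVolume (n : ℕ) :
    ENNReal.ofReal (ballVolume n) = volume (Metric.ball (0 : Space n) 1) :=
  ENNReal.ofReal_toReal measure_ball_lt_top.ne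

lemma sphereVolume_eq (n : ℕ) : sphereVolume n = n * ballVolume n := by
  rw [sphereVolume, ← measureReal_def, Measure.toSphere_real_apply_univ]
  simp [ballVolume]

lemma volume_ball_eq (n : ℕ) {r : ℝ} (hr : 0 < r) :
    volume (Metric.ball (0 : Space n) r) = ENNReal.ofReal (ballVolume n * r ^ n) := by
  rw [Measure.addHaar_ball_of_pos _ _ hr, mul_comm (ballVolume n), ENNReal.ofReal_mul (by positivity),
    ofReal_ballVolume]
  simp

lemma intervalIntegrable_mul_of_monotone {f H : ℝ → ℝ} (hf : Continuous f) (hH : Monotone H)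
    (a b : ℝ) : IntervalIntegrable (fun t => f t * H t) volume a b :=
  (hH.intervalIntegrable).continuousOn_mul hf.continuousOn

lemma lintegral_sliceVolume {n : ℕ} (hn : n ≠ 0) {r : ℝ} (hr : 0 < r) {H : ℝ → ℝ}
    (hH : Monotone H) (hH0 : ∀ t, 0 ≤ H t) :
    ∫⁻ t in Set.Ioi 0, sliceVolume n r t * ENNReal.ofReal (H t) =
      ENNReal.ofReal (ballVolume n * ∫ t in (0 : ℝ)..2 * r, √(r ^ 2 - (t / 2) ^ 2) ^ n * H t) := by
  have hint := intervalIntegrable_mul_of_monotone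
    (f := fun t => √(r ^ 2 - (t / 2) ^ 2) ^ n) (by fun_prop) hH 0 (2 * r)
  have h0 : ∀ t ∈ Set.Ioi (2 * r), sliceVolume n r t * ENNReal.ofReal (H t) = 0 := by
    intro t ht
    have ht' : 2 * r < t := ht
    have : √(r ^ 2 - (t / 2) ^ 2) = 0 := Real.sqrt_eq_zero_of_nonpos (by nlinarith)
    rw [sliceVolume_eq hn, this]
    simp [hn]
  have h2r : 0 ≤ 2 * r := by positivity
  rw [← Set.Ioc_union_Ioi_eq_Ioi h2r, lintegral_union measurableSet_Ioi
      Set.Ioc_disjoint_Ioi_same, setLIntegral_eq_zero measurableSet_Ioi h0, add_zero,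
    intervalIntegral.integral_of_le h2r, ENNReal.ofReal_mul (ballVolume_pos n).le,
    ofReal_integral_eq_lintegral_ofReal hint.1 (Filter.Eventually.of_forall fun t =>
      mul_nonneg (by positivity) (hH0 t)), ← lintegral_const_mul']
  · refine lintegral_congr fun t => ?_
    rw [sliceVolume_eq hn, ← ofReal_ballVolume, ENNReal.ofReal_mul (by positivity)]
    ring
  · exact ENNReal.ofReal_ne_top

/-- Polar coordinates, applied later to `H = 1 - tailReal μ`. This is the source of the factor ω_d =
d κ_d, with κ_d the volume of the unit ball. -/
lemma lintegral_ball_norm {d : ℕ} (hd : d ≠ 0) {r : ℝ} (hr : 0 < r) {H : ℝ → ℝ}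
    (hH : Monotone H) (hH0 : ∀ t, 0 ≤ H t) :
    ∫⁻ x, (Metric.ball (0 : Space d) r).indicator 1 x * ENNReal.ofReal (H (r + ‖x‖)) =
      ENNReal.ofReal (d * ballVolume d * ∫ y in (0 : ℝ)..r, y ^ (d - 1) * H (r + y)) := by
  have : Nonempty (Fin d) := ⟨⟨0, Nat.pos_of_ne_zero hd⟩⟩
  let g : ℝ → ℝ := Set.indicator (Set.Iio r) fun y => H (r + y)
  have hgm : Measurable g :=
    (hH.measurable.comp (measurable_const_add r)).indicator measurableSet_Iio
  have hg0 : ∀ y, 0 ≤ g y := fun y => Set.indicator_nonneg (fun y _ => hH0 _) y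
  have h1 : ∀ x : Space d, (Metric.ball (0 : Space d) r).indicator 1 x *
      ENNReal.ofReal (H (r + ‖x‖)) = ENNReal.ofReal (g ‖x‖) := by
    intro x
    by_cases hx : ‖x‖ < r <;> simp [g, Set.indicator, hx]
  have hint : Integrable fun x : Space d => g ‖x‖ := by
    have hb : Integrable ((Metric.ball (0 : Space d) r).indicator fun _ => H (r + r)) :=
      (integrable_indicator_iff measurableSet_ball).mpr
        (integrableOn_const measure_ball_lt_top.ne)
    refine hb.mono' (hgm.comp measurable_norm).aestronglyMeasurable
      (Filter.Eventually.of_forall fun x => ?_)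
    rw [Real.norm_of_nonneg (hg0 _)]
    by_cases hx : ‖x‖ < r
    · simp only [g, Set.indicator, Set.mem_Iio, hx, if_true, Metric.mem_ball, dist_zero_right]
      exact hH (by linarith)
    · simp [g, Set.indicator, hx]
  simp_rw [h1]
  rw [← ofReal_integral_eq_lintegral_ofReal hint (Filter.Eventually.of_forall fun x => hg0 _),
    integral_fun_norm_addHaar]
  congr 1
  have e1 : ∫ y in Set.Ioi (0 : ℝ), y ^ (d - 1) • g y =
      ∫ y in (0 : ℝ)..r, y ^ (d - 1) * H (r + y) := by
    rw [intervalIntegral.integral_of_le hr.le, ← integral_Ioc_eq_integral_Ioo.symm,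
      ← integral_indicator measurableSet_Ioi, ← integral_indicator measurableSet_Ioo]
    congr 1
    funext y
    by_cases h0 : 0 < y <;> by_cases h1 : y < r <;> simp [g, Set.indicator, h0, h1]
  simp only [finrank_euclideanSpace, Fintype.card_fin]
  rw [e1]
  simp [ballVolume, mul_assoc]

/-- The probability that the displacement has norm at least `t`. -/
def tailReal {d : ℕ} (μ : Measure (Space d)) (t : ℝ) : ℝ :=
  1 - (μ {z | ‖z‖ₑ < ENNReal.ofReal t}).toReal

variable {n : ℕ} {a b : Configuration (n + 1) × Configuration (n + 1) → Space (n + 1) → ℝ≥0∞}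
  {ρ β : Measure (Configuration (n + 1))} {μ : Measure (Space (n + 1))}

lemma tailReal_antitone {d : ℕ} (μ : Measure (Space d)) [IsFiniteMeasure μ] :
    Antitone (tailReal μ) := by
  intro s t hst
  refine sub_le_sub_left (ENNReal.toReal_mono (measure_ne_top _ _) (measure_mono ?_)) _
  exact fun z hz => lt_of_lt_of_le hz (ENNReal.ofReal_le_ofReal hst)

lemma tailReal_le_one {d : ℕ} (μ : Measure (Space d)) (t : ℝ) : tailReal μ t ≤ 1 :=
  sub_le_self _ ENNReal.toReal_nonneg

lemma IsDisplacement.tailReal_nonneg {d : ℕ}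
    {a b : Configuration d × Configuration d → Space d → ℝ≥0∞}
    {ρ β : Measure (Configuration d)} {μ : Measure (Space d)}
    (h : IsDisplacement ρ β a b μ) (t : ℝ) : 0 ≤ tailReal μ t := by
  have := (measure_mono (Set.subset_univ {z | ‖z‖ₑ < ENNReal.ofReal t})).trans
    h.measure_univ_le_one
  have := ENNReal.toReal_mono ENNReal.one_ne_top this
  rw [ENNReal.toReal_one] at this
  exact sub_nonneg.mpr this

lemma IsDisplacement.ofReal_one_sub_tailReal {d : ℕ}
    {a b : Configuration d × Configuration d → Space d → ℝ≥0∞}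
    {ρ β : Measure (Configuration d)} {μ : Measure (Space d)}
    (h : IsDisplacement ρ β a b μ) (t : ℝ) :
    ENNReal.ofReal (1 - tailReal μ t) = μ {z | ‖z‖ₑ < ENNReal.ofReal t} := by
  have := h.finite
  rw [tailReal, sub_sub_cancel, ENNReal.ofReal_toReal (measure_ne_top _ _)]

/-- For a displacement `z` the admissible red positions form a lens, whose volume is an integral of
slices over t > ‖z‖. Exchanging the order of integration leaves the mass of {‖z‖ < t}. -/
lemma IsDisplacement.lintegral_pairs_in_ball (hn : n ≠ 0) (h : IsDisplacement ρ β a b μ) {r : ℝ}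
    (hr : 0 < r) :
    ∫⁻ p, (Metric.ball (0 : Space (n + 1)) r).indicator 1 p.1 *
        (Metric.ball (0 : Space (n + 1)) r).indicator 1 (p.1 + p.2)
          ∂(volume : Measure (Space (n + 1))).prod μ =
      ENNReal.ofReal (ballVolume n * ∫ t in (0 : ℝ)..2 * r,
        √(r ^ 2 - (t / 2) ^ 2) ^ n * (1 - tailReal μ t)) := by
  have := h.finite
  set D := Metric.ball (0 : Space (n + 1)) r with hD
  have hDm : MeasurableSet D := measurableSet_ball
  have hind : Measurable (D.indicator (1 : Space (n + 1) → ℝ≥0∞)) := measurable_one.indicator hDm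
  rw [lintegral_prod_symm (f := fun p => D.indicator 1 p.1 * D.indicator 1 (p.1 + p.2))
    ((hind.comp measurable_fst).mul (hind.comp (measurable_fst.add measurable_snd))).aemeasurable]
  have h1 : ∀ z, ∫⁻ x, D.indicator 1 x * D.indicator 1 (x + z) =
      ∫⁻ t in Set.Ioi 0, sliceVolume n r t * Set.indicator {p : Space (n + 1) × ℝ | ‖p.1‖ < p.2} 1
        (z, t) := by
    intro z
    have h2 := volume_lens hn hr z
    rw [← hD, ← lintegral_indicator_one (hDm.inter (hDm.preimage (measurable_add_const z)))] at h2
    have h3 : ∀ x, (D ∩ (fun x => x + z) ⁻¹' D).indicator (1 : Space (n + 1) → ℝ≥0∞) x =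
        D.indicator 1 x * D.indicator 1 (x + z) := by
      intro x
      by_cases hx : x ∈ D <;> by_cases hxz : x + z ∈ D <;> simp [hx, hxz, Set.indicator]
    simp_rw [h3] at h2
    rw [h2, ← lintegral_indicator measurableSet_Ioi, ← lintegral_indicator measurableSet_Ioi]
    refine lintegral_congr fun t => ?_
    by_cases ht : ‖z‖ < t
    · simp [ht, (norm_nonneg z).trans_lt ht]
    · simp [ht, Set.indicator]
  simp_rw [h1]
  have hS : MeasurableSet {p : Space (n + 1) × ℝ | ‖p.1‖ < p.2} :=
    measurableSet_lt (by fun_prop) (by fun_prop)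
  rw [lintegral_lintegral_swap]
  · rw [← lintegral_sliceVolume hn hr (H := fun t => 1 - tailReal μ t)
      (fun s t hst => sub_le_sub_left (tailReal_antitone μ hst) _)
      (fun t => sub_nonneg.mpr (tailReal_le_one μ t))]
    refine setLIntegral_congr_fun measurableSet_Ioi fun t ht => ?_
    have hSt : MeasurableSet {z : Space (n + 1) | ‖z‖ < t} :=
      measurableSet_lt (by fun_prop) measurable_const
    have hSm : Measurable fun z : Space (n + 1) =>
        {p : Space (n + 1) × ℝ | ‖p.1‖ < p.2}.indicator (1 : Space (n + 1) × ℝ → ℝ≥0∞) (z, t) :=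
      (measurable_one.indicator hS).comp measurable_prodMk_right
    rw [lintegral_const_mul _ hSm, h.ofReal_one_sub_tailReal]
    congr 1
    have h4 : {z : Space (n + 1) | ‖z‖ₑ < ENNReal.ofReal t} = {z | ‖z‖ < t} := by
      ext z
      simp only [Set.mem_ofPred_eq, ← ofReal_norm]
      exact ENNReal.ofReal_lt_ofReal_iff ht
    rw [h4, ← lintegral_indicator_one hSt]
    rfl
  · exact (((measurable_sliceVolume hn r).comp measurable_snd).mul
      (measurable_one.indicator hS)).aemeasurable

lemma IsDisplacement.real_ball_inequality (hn : n ≠ 0) (h : IsDisplacement ρ β a b μ) {r : ℝ}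
    (hr : 0 < r) :
    ballVolume (n + 1) * r ^ (n + 1) + ballVolume n * ∫ t in (0 : ℝ)..2 * r,
        √(r ^ 2 - (t / 2) ^ 2) ^ n * (1 - tailReal μ t) ≤
      2 * √(ballVolume (n + 1) * r ^ (n + 1)) +
        2 * ((n + 1) * ballVolume (n + 1) *
          ∫ y in (0 : ℝ)..r, y ^ n * (1 - tailReal μ (r + y))) := by
  have := h.finite
  have hH : Monotone fun t => 1 - tailReal μ t :=
    fun s t hst => sub_le_sub_left (tailReal_antitone μ hst) _
  have hH0 : ∀ t, 0 ≤ 1 - tailReal μ t := fun t => sub_nonneg.mpr (tailReal_le_one μ t)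
  have hb := h.ball_inequality r.toNNReal
  have hball : Metric.eball (0 : Space (n + 1)) (r.toNNReal : ℝ≥0∞) = Metric.ball 0 r := by
    rw [Metric.eball_coe, Real.coe_toNNReal r hr.le]
  have hlast : ∀ x : Space (n + 1), μ {z | ‖z‖ₑ < (r.toNNReal : ℝ≥0∞) + ‖x‖ₑ} =
      ENNReal.ofReal (1 - tailReal μ (r + ‖x‖)) := by
    intro x
    rw [h.ofReal_one_sub_tailReal, ENNReal.ofReal_add hr.le (norm_nonneg _), ofReal_norm]
    rfl
  simp_rw [hlast, hball] at hb
  have hκ := ballVolume_pos (n + 1)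
  have hc : 0 ≤ ballVolume (n + 1) * r ^ (n + 1) := by positivity
  have hI1 : 0 ≤ ballVolume n * ∫ t in (0 : ℝ)..2 * r,
      √(r ^ 2 - (t / 2) ^ 2) ^ n * (1 - tailReal μ t) :=
    mul_nonneg (ballVolume_pos n).le (intervalIntegral.integral_nonneg (by positivity)
      fun t _ => mul_nonneg (by positivity) (hH0 t))
  have hI2 : 0 ≤ (n + 1) * ballVolume (n + 1) *
      ∫ y in (0 : ℝ)..r, y ^ n * (1 - tailReal μ (r + y)) :=
    mul_nonneg (by positivity) (intervalIntegral.integral_nonneg hr.le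
      fun t ht => mul_nonneg (pow_nonneg ht.1 _) (hH0 _))
  have hsq : ((NNReal.sqrt (ENNReal.ofReal (ballVolume (n + 1) * r ^ (n + 1))).toNNReal : ℝ≥0)
      : ℝ≥0∞) = ENNReal.ofReal (√(ballVolume (n + 1) * r ^ (n + 1))) := by
    rw [Real.sqrt, ENNReal.ofReal_coe_nnreal]
    rfl
  rw [h.lintegral_pairs_in_ball hn hr, lintegral_ball_norm (Nat.succ_ne_zero n) hr hH hH0,
    volume_ball_eq _ hr, hsq] at hb
  have h2 : (2 : ℝ≥0∞) = ENNReal.ofReal 2 := by simp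
  rw [h2, ← ENNReal.ofReal_mul two_pos.le, ← ENNReal.ofReal_mul two_pos.le,
    ← ENNReal.ofReal_add hc hI1, ← ENNReal.ofReal_add (by positivity)
      (mul_nonneg two_pos.le (by push_cast; exact hI2)),
    ENNReal.ofReal_le_ofReal_iff (add_nonneg (by positivity)
      (mul_nonneg two_pos.le (by push_cast; exact hI2)))] at hb
  push_cast at hb
  exact hb

/-- The lens of two coinciding balls is the whole ball. -/
lemma ballVolume_succ_mul (hn : n ≠ 0) {r : ℝ} (hr : 0 < r) :
    ballVolume (n + 1) * r ^ (n + 1) =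
      ballVolume n * ∫ t in (0 : ℝ)..2 * r, √(r ^ 2 - (t / 2) ^ 2) ^ n := by
  have h1 := volume_lens hn hr (0 : Space (n + 1))
  have h2 := lintegral_sliceVolume hn hr (H := fun _ => 1) monotone_const fun _ => zero_le_one
  simp only [add_zero, Set.preimage_id', Set.inter_self, norm_zero] at h1
  simp only [ENNReal.ofReal_one, mul_one] at h2
  rw [h2, volume_ball_eq _ hr] at h1
  refine (ENNReal.ofReal_eq_ofReal_iff (by have := ballVolume_pos (n + 1); positivity) ?_).mp h1
  exact mul_nonneg (ballVolume_pos n).le (intervalIntegral.integral_nonneg (by positivity)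
      fun t _ => by positivity)

/-- The integral inequality for the tail of the distance to the partner. -/
lemma IsDisplacement.tail_inequality (hn : n ≠ 0) (h : IsDisplacement ρ β a b μ) {r : ℝ}
    (hr : 1 ≤ r) :
    2 * ((n + 1) * ballVolume (n + 1)) * (∫ t in (1 : ℝ)..2, (t - 1) ^ n * tailReal μ (r * t)) ≤
      ballVolume n * (∫ t in (0 : ℝ)..2, √(1 - (t / 2) ^ 2) ^ n * tailReal μ (r * t)) +
        2 * √(ballVolume (n + 1)) / r := by
  have := h.finite
  have hr0 : 0 < r := by linarith
  have hF : Antitone (tailReal μ) := tailReal_antitone μ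
  have hmain := h.real_ball_inequality hn hr0
  have i1 : IntervalIntegrable (fun t => √(r ^ 2 - (t / 2) ^ 2) ^ n) volume 0 (2 * r) :=
    Continuous.intervalIntegrable (by fun_prop) _ _
  have i2 : IntervalIntegrable (fun t => √(r ^ 2 - (t / 2) ^ 2) ^ n * tailReal μ t) volume 0
      (2 * r) := (hF.intervalIntegrable).continuousOn_mul (by fun_prop)
  have i3 : IntervalIntegrable (fun y : ℝ => y ^ n) volume 0 r :=
    Continuous.intervalIntegrable (by fun_prop) _ _
  have i4 : IntervalIntegrable (fun y : ℝ => y ^ n * tailReal μ (r + y)) volume 0 r :=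
    Antitone.intervalIntegrable (u := fun y => tailReal μ (r + y))
      (fun s t hst => hF (by linarith)) |>.continuousOn_mul (by fun_prop)
  have e1 : ∫ t in (0 : ℝ)..2 * r, √(r ^ 2 - (t / 2) ^ 2) ^ n * (1 - tailReal μ t) =
      (∫ t in (0 : ℝ)..2 * r, √(r ^ 2 - (t / 2) ^ 2) ^ n) -
        ∫ t in (0 : ℝ)..2 * r, √(r ^ 2 - (t / 2) ^ 2) ^ n * tailReal μ t := by
    rw [← intervalIntegral.integral_sub i1 i2]
    simp only [mul_sub, mul_one]
  have e2 : ∫ y in (0 : ℝ)..r, y ^ n * (1 - tailReal μ (r + y)) =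
      r ^ (n + 1) / (n + 1) - ∫ y in (0 : ℝ)..r, y ^ n * tailReal μ (r + y) := by
    have e0 : ∫ y in (0 : ℝ)..r, y ^ n = r ^ (n + 1) / (n + 1) := by simp [integral_pow]
    rw [← e0, ← intervalIntegral.integral_sub i3 i4]
    simp only [mul_sub, mul_one]
  have e3 : ∫ t in (0 : ℝ)..2 * r, √(r ^ 2 - (t / 2) ^ 2) ^ n * tailReal μ t =
      r ^ (n + 1) * ∫ t in (0 : ℝ)..2, √(1 - (t / 2) ^ 2) ^ n * tailReal μ (r * t) := by
    have := intervalIntegral.smul_integral_comp_mul_left (a := 0) (b := 2)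
      (fun t => √(r ^ 2 - (t / 2) ^ 2) ^ n * tailReal μ t) r
    rw [mul_zero, mul_comm r 2] at this
    rw [← this, smul_eq_mul, show r ^ (n + 1) = r * r ^ n from pow_succ' r n,
      mul_assoc r (r ^ n), ← intervalIntegral.integral_const_mul (r ^ n)]
    congr 1
    refine intervalIntegral.integral_congr fun t _ => ?_
    have hs : r ^ 2 - (r * t / 2) ^ 2 = r ^ 2 * (1 - (t / 2) ^ 2) := by ring
    rw [hs, Real.sqrt_mul (sq_nonneg r), Real.sqrt_sq hr0.le, mul_pow, mul_assoc]
  have e4 : ∫ y in (0 : ℝ)..r, y ^ n * tailReal μ (r + y) =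
      r ^ (n + 1) * ∫ t in (1 : ℝ)..2, (t - 1) ^ n * tailReal μ (r * t) := by
    have := intervalIntegral.smul_integral_comp_mul_sub (a := 1) (b := 2)
      (fun y => y ^ n * tailReal μ (r + y)) r r
    rw [mul_one, sub_self, show r * 2 - r = r by ring] at this
    rw [← this, smul_eq_mul, show r ^ (n + 1) = r * r ^ n from pow_succ' r n,
      mul_assoc r (r ^ n), ← intervalIntegral.integral_const_mul (r ^ n)]
    congr 1
    refine intervalIntegral.integral_congr fun t _ => ?_
    rw [show r * t - r = r * (t - 1) by ring, mul_pow, show r + r * (t - 1) = r * t by ring,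
      mul_assoc]
  -- The fluctuation relative to r^(n+1) is of order r^(-(n+1)/2), which is at most 1 / r because n
  -- ≥ 1 and r ≥ 1. This is where dimension at least two enters the error term.
  have hs : √(ballVolume (n + 1) * r ^ (n + 1)) ≤ √(ballVolume (n + 1)) / r * r ^ (n + 1) := by
    rw [Real.sqrt_mul (ballVolume_pos _).le, pow_succ r n, div_mul_eq_mul_div, mul_div_assoc,
      mul_div_assoc, div_self hr0.ne', mul_one]
    refine mul_le_mul_of_nonneg_left ?_ (Real.sqrt_nonneg _)
    rw [Real.sqrt_le_left (by positivity)]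
    obtain ⟨k, rfl⟩ := Nat.exists_eq_succ_of_ne_zero hn
    have h1 : r ≤ r ^ (k + 1) := le_self_pow₀ hr (by omega)
    calc r ^ (k + 1) * r ≤ r ^ (k + 1) * r ^ (k + 1) := by gcongr
      _ = (r ^ (k + 1)) ^ 2 := by ring
  have hv := ballVolume_succ_mul hn hr0
  -- Both sides now contain the volume of the ball exactly twice, so only tail integrals and the
  -- fluctuation survive.
  rw [e1, e2, mul_sub, ← hv, e3, e4] at hmain
  have hrp : 0 < r ^ (n + 1) := by positivity
  refine le_of_mul_le_mul_left ?_ hrp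
  have hn1 : ((n : ℝ) + 1) ≠ 0 := by positivity
  have e5 : ((n : ℝ) + 1) * ballVolume (n + 1) * (r ^ (n + 1) / (n + 1) -
      r ^ (n + 1) * ∫ t in (1 : ℝ)..2, (t - 1) ^ n * tailReal μ (r * t)) =
      ballVolume (n + 1) * r ^ (n + 1) - ((n : ℝ) + 1) * ballVolume (n + 1) *
      (r ^ (n + 1) * ∫ t in (1 : ℝ)..2, (t - 1) ^ n * tailReal μ (r * t)) := by
    generalize ∫ t in (1 : ℝ)..2, (t - 1) ^ n * tailReal μ (r * t) = J
    field_simp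
  rw [e5] at hmain
  have e6 : r ^ (n + 1) * (2 * √(ballVolume (n + 1)) / r) =
    2 * (√(ballVolume (n + 1)) / r * r ^ (n + 1)) := by ring
  rw [mul_add, e6]
  nlinarith [hmain, hs]

end RealInequality

end StableMatching

/-! ### Existence and uniqueness of the exponent. -/

namespace StableMatching

section Exponent

open Set

variable {K : ℝ → ℝ}

lemma intervalIntegrable_mul_rpow (hK : Continuous K) {s : ℝ} (hs : s < 1) (a b : ℝ) :
    IntervalIntegrable (fun t => K t * t ^ (-s)) volume a b :=
  (intervalIntegral.intervalIntegrable_rpow' (by linarith)).continuousOn_mul hK.continuousOn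

lemma exists_zero_of_strictMonoOn (hK : Continuous K) (h1 : K 1 < 0) (h2 : 0 < K 2) :
    ∃ t₀ ∈ Ioo (1 : ℝ) 2, K t₀ = 0 :=
  intermediate_value_Ioo one_lt_two.le hK.continuousOn ⟨h1, h2⟩

/-- The truncated Mellin transform of `K` has at most one zero in `(-∞, 1)`. -/
lemma exponent_unique (hK : Continuous K) (hmono : StrictMonoOn K (Icc 0 2)) (h1 : K 1 < 0)
    (h2 : 0 < K 2) {s s' : ℝ} (hs : s < 1) (hs' : s' < 1)
    (hz : ∫ t in (0 : ℝ)..2, K t * t ^ (-s) = 0) (hz' : ∫ t in (0 : ℝ)..2, K t * t ^ (-s') = 0) :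
    s = s' := by
  wlog hlt : s < s' generalizing s s'
  · rcases eq_or_lt_of_le (not_lt.mp hlt) with h | h
    · exact h.symm
    · exact (this hs' hs hz' hz h).symm
  exfalso
  obtain ⟨t₀, ⟨ht1, ht2⟩, hKt⟩ := exists_zero_of_strictMonoOn hK h1 h2
  have ht0 : 0 < t₀ := by linarith
  let f : ℝ → ℝ := fun t => t₀ ^ s * (K t * t ^ (-s)) - t₀ ^ s' * (K t * t ^ (-s'))
  have hfi : ∀ a b, IntervalIntegrable f volume a b := fun a b =>
    ((intervalIntegrable_mul_rpow hK hs a b).const_mul _).sub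
      ((intervalIntegrable_mul_rpow hK hs' a b).const_mul _)
  have hf : ∀ t, 0 < t → f t = K t * ((t₀ / t) ^ s - (t₀ / t) ^ s') := by
    intro t ht
    simp only [f]
    rw [Real.div_rpow ht0.le ht.le, Real.div_rpow ht0.le ht.le, Real.rpow_neg ht.le,
      Real.rpow_neg ht.le]
    ring
  have hp1 : 0 < ∫ t in (0 : ℝ)..t₀, f t := by
    refine intervalIntegral.intervalIntegral_pos_of_pos_on (hfi _ _) (fun t ht => ?_) ht0
    rw [hf t ht.1]
    refine mul_pos_of_neg_of_neg ?_ ?_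
    · rw [← hKt]
      exact hmono ⟨ht.1.le, by linarith [ht.2]⟩ ⟨ht0.le, ht2.le⟩ ht.2
    · exact sub_neg.mpr (Real.rpow_lt_rpow_of_exponent_lt ((one_lt_div ht.1).mpr ht.2) hlt)
  have hp2 : 0 < ∫ t in t₀..2, f t := by
    refine intervalIntegral.intervalIntegral_pos_of_pos_on (hfi _ _) (fun t ht => ?_) ht2
    have ht' : 0 < t := ht0.trans ht.1
    rw [hf t ht']
    refine mul_pos ?_ ?_
    · rw [← hKt]
      exact hmono ⟨ht0.le, ht2.le⟩ ⟨ht'.le, ht.2.le⟩ ht.1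
    · exact sub_pos.mpr (Real.rpow_lt_rpow_of_exponent_gt (div_pos ht0 ht')
        ((div_lt_one ht').mpr ht.1) hlt)
  have hsum : ∫ t in (0 : ℝ)..2, f t = 0 := by
    simp only [f]
    rw [intervalIntegral.integral_sub ((intervalIntegrable_mul_rpow hK hs _ _).const_mul _)
      ((intervalIntegrable_mul_rpow hK hs' _ _).const_mul _),
      intervalIntegral.integral_const_mul, intervalIntegral.integral_const_mul, hz, hz']
    simp
  rw [← intervalIntegral.integral_add_adjacent_intervals (hfi 0 t₀) (hfi t₀ 2)] at hsum
  linarith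

lemma continuousOn_exponent (hK : Continuous K) {s₁ : ℝ} (hs₁ : s₁ < 1) :
    ContinuousOn (fun s => ∫ t in (0 : ℝ)..2, K t * t ^ (-s)) (Icc 0 s₁) := by
  intro s hs
  refine intervalIntegral.continuousWithinAt_of_dominated_interval
    (bound := fun t => |K t| * (t ^ (-s₁) + 1)) ?_ ?_ ?_ ?_
  · refine Filter.Eventually.of_forall fun s => ?_
    have : Measurable fun t : ℝ => t ^ (-s) := measurable_id.pow_const _
    exact (hK.measurable.mul this).aestronglyMeasurable
  · filter_upwards [self_mem_nhdsWithin] with s hs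
    refine Filter.Eventually.of_forall fun t ht => ?_
    rw [uIoc_of_le zero_le_two] at ht
    rw [Real.norm_eq_abs, abs_mul, abs_of_nonneg (Real.rpow_nonneg ht.1.le _)]
    refine mul_le_mul_of_nonneg_left ?_ (abs_nonneg _)
    rcases le_total t 1 with h | h
    · have := Real.rpow_le_rpow_of_exponent_ge ht.1 h (neg_le_neg hs.2)
      linarith
    · have := Real.rpow_le_one_of_one_le_of_nonpos h (neg_nonpos.mpr hs.1)
      have := Real.rpow_nonneg ht.1.le (-s₁)
      linarith
  · exact ((intervalIntegral.intervalIntegrable_rpow' (by linarith)).add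
      intervalIntegrable_const).continuousOn_mul (by fun_prop)
  · refine Filter.Eventually.of_forall fun t ht => ?_
    rw [uIoc_of_le zero_le_two] at ht
    have : Continuous fun x : ℝ => t ^ (-x) :=
      Real.continuous_const_rpow ht.1.ne' |>.comp continuous_neg
    exact (continuous_const.mul this).continuousWithinAt

/-- The truncated Mellin transform of `K` has a zero in `(0, 1)`. -/
lemma exponent_exists (hK : Continuous K) (hmono : StrictMonoOn K (Icc 0 2)) (h1 : K 1 < 0)
    (h2 : 0 < K 2) (hpos : 0 < ∫ t in (0 : ℝ)..2, K t) :
    ∃ s : ℝ, 0 < s ∧ s < 1 ∧ ∫ t in (0 : ℝ)..2, K t * t ^ (-s) = 0 := by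
  -- At exponent 1 - δ the interval [0, 1] contributes at most K(1) / δ ≤ -2 K(2) and [1, 2] at most
  -- K(2), so the transform is negative there.
  let δ : ℝ := min (1 / 2) (-K 1 / (2 * K 2))
  have hδ0 : 0 < δ := lt_min (by norm_num) (div_pos (by linarith) (by linarith))
  have hδ1 : δ ≤ 1 / 2 := min_le_left _ _
  have hδ2 : δ * (2 * K 2) ≤ -K 1 := by
    rw [← le_div_iff₀ (by linarith)]
    exact min_le_right _ _
  have hneg : ∫ t in (0 : ℝ)..2, K t * t ^ (-(1 - δ)) < 0 := by
    have hi : ∀ a b, IntervalIntegrable (fun t => K t * t ^ (-(1 - δ))) volume a b :=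
      intervalIntegrable_mul_rpow hK (by linarith)
    have b1 : ∫ t in (0 : ℝ)..1, K t * t ^ (-(1 - δ)) ≤ K 1 / δ := by
      have : ∫ t in (0 : ℝ)..1, K 1 * t ^ (-(1 - δ)) = K 1 / δ := by
        rw [intervalIntegral.integral_const_mul, integral_rpow (Or.inl (by linarith))]
        rw [show -(1 - δ) + 1 = δ by ring, Real.one_rpow, Real.zero_rpow hδ0.ne']
        ring
      rw [← this]
      refine intervalIntegral.integral_mono_on zero_le_one (hi _ _)
        ((intervalIntegral.intervalIntegrable_rpow' (by linarith)).const_mul _) fun t ht => ?_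
      refine mul_le_mul_of_nonneg_right ?_ (Real.rpow_nonneg ht.1 _)
      exact hmono.monotoneOn ⟨ht.1, by linarith [ht.2]⟩ ⟨zero_le_one, one_le_two⟩ ht.2
    have b2 : ∫ t in (1 : ℝ)..2, K t * t ^ (-(1 - δ)) ≤ K 2 := by
      have : ∫ t in (1 : ℝ)..2, K 2 = K 2 := by
        rw [intervalIntegral.integral_const]; norm_num
      refine le_trans ?_ this.le
      refine intervalIntegral.integral_mono_on one_le_two (hi _ _) intervalIntegrable_const
        fun t ht => ?_
      have h3 : K t ≤ K 2 := hmono.monotoneOn ⟨by linarith [ht.1], ht.2⟩ ⟨zero_le_two, le_rfl⟩ ht.2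
      have h4 : t ^ (-(1 - δ)) ≤ 1 := Real.rpow_le_one_of_one_le_of_nonpos ht.1 (by linarith)
      have h5 : 0 ≤ t ^ (-(1 - δ)) := Real.rpow_nonneg (by linarith [ht.1]) _
      nlinarith
    rw [← intervalIntegral.integral_add_adjacent_intervals (hi 0 1) (hi 1 2)]
    have b3 : K 1 / δ ≤ -(2 * K 2) := by
      rw [div_le_iff₀ hδ0]; linarith
    linarith
  have hpos' : 0 < ∫ t in (0 : ℝ)..2, K t * t ^ (-(0 : ℝ)) := by
    simpa using hpos
  obtain ⟨s, hs, hz⟩ := intermediate_value_Ioo' (by linarith : (0 : ℝ) ≤ 1 - δ)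
    (continuousOn_exponent hK (s₁ := 1 - δ) (by linarith)) ⟨hneg, hpos'⟩
  exact ⟨s, hs.1, by linarith [hs.2], hz⟩

end Exponent

/-! ### From the integral inequality to power decay. -/

section Decay

open Set

variable {K F : ℝ → ℝ} {s c : ℝ}

lemma intervalIntegrable_rpow_mul_antitone (hs0 : 0 < s) (hF : Antitone F) (a b : ℝ) :
    IntervalIntegrable (fun u => u ^ (s - 1) * F u) volume a b := by
  have h := intervalIntegral.intervalIntegrable_rpow' (a := a) (b := b) (r := s - 1) (by linarith)
  rw [intervalIntegrable_iff] at h ⊢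
  refine Integrable.mul_bdd (c := max |F (min a b)| |F (max a b)|) h
    hF.measurable.aestronglyMeasurable ?_
  refine (ae_restrict_of_forall_mem measurableSet_uIoc fun t ht => ?_)
  have h1 := hF ht.1.le
  have h2 := hF ht.2
  rw [Real.norm_eq_abs, abs_le']
  constructor
  · exact h1.trans ((le_abs_self _).trans (le_max_left _ _))
  · exact (neg_le_neg h2).trans ((neg_le_abs _).trans (le_max_right _ _))

/-- As s < 1, the integrand is decreasing and hence smallest at the right endpoint. This converts
growth of the primitive back into a pointwise bound on `F`. -/
lemma primitive_sub_ge (hs0 : 0 < s) (hs1 : s < 1) (hF : Antitone F) (hF0 : ∀ t, 0 ≤ F t)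
    {x y : ℝ} (hx : 0 < x) (hxy : x ≤ y) :
    (y - x) * (y ^ (s - 1) * F y) ≤ ∫ u in x..y, u ^ (s - 1) * F u := by
  have : ∫ u in x..y, y ^ (s - 1) * F y = (y - x) * (y ^ (s - 1) * F y) := by
    rw [intervalIntegral.integral_const, smul_eq_mul]
  rw [← this]
  refine intervalIntegral.integral_mono_on hxy intervalIntegrable_const
    (intervalIntegrable_rpow_mul_antitone hs0 hF _ _) fun u hu => ?_
  have hu0 : 0 < u := hx.trans_le hu.1
  exact mul_le_mul (Real.rpow_le_rpow_of_nonpos hu0 hu.2 (by linarith)) (hF hu.2) (hF0 _)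
    (Real.rpow_nonneg hu0.le _)

lemma primitive_nonneg (hF0 : ∀ t, 0 ≤ F t) {x y : ℝ} (hx : 0 ≤ x) (hxy : x ≤ y) :
    0 ≤ ∫ u in x..y, u ^ (s - 1) * F u :=
  intervalIntegral.integral_nonneg hxy fun _ hu =>
    mul_nonneg (Real.rpow_nonneg (hx.trans hu.1) _) (hF0 _)

lemma primitive_le (hs0 : 0 < s) (hF : Antitone F) (hF1 : ∀ t, F t ≤ 1) {x : ℝ} (hx : 0 ≤ x) :
    ∫ u in (0 : ℝ)..x, u ^ (s - 1) * F u ≤ x ^ s / s := by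
  have : ∫ u in (0 : ℝ)..x, u ^ (s - 1) = x ^ s / s := by
    rw [integral_rpow (Or.inl (by linarith)), sub_add_cancel, Real.zero_rpow hs0.ne', sub_zero]
  rw [← this]
  refine intervalIntegral.integral_mono_on hx (intervalIntegrable_rpow_mul_antitone hs0 hF _ _)
    (intervalIntegral.intervalIntegrable_rpow' (by linarith)) fun u hu => ?_
  exact mul_le_of_le_one_right (Real.rpow_nonneg hu.1 _) (hF1 _)

lemma continuous_primitive_rpow_mul (hs0 : 0 < s) (hF : Antitone F) :
    Continuous fun x => ∫ u in (0 : ℝ)..x, u ^ (s - 1) * F u :=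
  intervalIntegral.continuous_primitive (intervalIntegrable_rpow_mul_antitone hs0 hF) 0

/-- The integrated form of the inequality for `F`. -/
lemma integrated_inequality (hK : Continuous K) {M : ℝ} (hM : ∀ t ∈ Icc (0 : ℝ) 2, |K t| ≤ M)
    (hs0 : 0 < s) (hs1 : s < 1) (hF : Antitone F) (hF0 : ∀ t, 0 ≤ F t)
    (hF1 : ∀ t, F t ≤ 1) (hc : 0 ≤ c)
    (hineq : ∀ r, 1 ≤ r → ∫ t in (0 : ℝ)..2, K t * F (r * t) ≤ c / r) {ρ : ℝ} (hρ : 1 ≤ ρ) :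
    ∫ t in (0 : ℝ)..2, K t * t ^ (-s) * ((∫ u in (0 : ℝ)..ρ * t, u ^ (s - 1) * F u) -
      ∫ u in (0 : ℝ)..t, u ^ (s - 1) * F u) ≤ c / (1 - s) := by
  have hρ0 : 0 < ρ := by linarith
  have hM0 : 0 ≤ M := (abs_nonneg _).trans (hM 0 ⟨le_rfl, zero_le_two⟩)
  have hI := intervalIntegrable_rpow_mul_antitone hs0 hF
  -- The hypothesis is weighted by r^(s-1) and integrated over [1, ρ]. The right side stays bounded
  -- because r^(s-2) is integrable at infinity, and on the left Fubini and u = r t produce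
  -- increments of the primitive.
  let f : ℝ → ℝ → ℝ := fun r t => r ^ (s - 1) * (K t * F (r * t))
  have hfm : Measurable (Function.uncurry f) := by
    have h1 : Measurable fun p : ℝ × ℝ => p.1 ^ (s - 1) := measurable_fst.pow_const _
    have h2 : Measurable fun p : ℝ × ℝ => K p.2 := hK.measurable.comp measurable_snd
    have h3 : Measurable fun p : ℝ × ℝ => F (p.1 * p.2) :=
      hF.measurable.comp (measurable_fst.mul measurable_snd)
    exact h1.mul (h2.mul h3)
  have hfint : Integrable (Function.uncurry f)
      ((volume.restrict (uIoc 1 ρ)).prod (volume.restrict (uIoc 0 2))) := by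
    have : IsFiniteMeasure ((volume : Measure ℝ).restrict (uIoc 1 ρ)) := by
      rw [uIoc_of_le hρ]; infer_instance
    have : IsFiniteMeasure ((volume : Measure ℝ).restrict (uIoc 0 2)) := by
      rw [uIoc_of_le zero_le_two]; infer_instance
    refine Integrable.of_bound hfm.aestronglyMeasurable M ?_
    rw [Measure.prod_restrict]
    refine ae_restrict_of_forall_mem (measurableSet_uIoc.prod measurableSet_uIoc) ?_
    rintro ⟨r, t⟩ ⟨hr, ht⟩
    rw [uIoc_of_le hρ] at hr
    rw [uIoc_of_le zero_le_two] at ht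
    simp only [Function.uncurry, f, Real.norm_eq_abs, abs_mul] at hr ht ⊢
    have h1 : |r ^ (s - 1)| ≤ 1 := by
      rw [abs_of_nonneg (Real.rpow_nonneg (by linarith [hr.1]) _)]
      exact Real.rpow_le_one_of_one_le_of_nonpos hr.1.le (by linarith)
    have h2 := hM t ⟨ht.1.le, ht.2⟩
    have h3 : |F (r * t)| ≤ 1 := by rw [abs_of_nonneg (hF0 _)]; exact hF1 _
    calc |r ^ (s - 1)| * (|K t| * |F (r * t)|) ≤ 1 * (M * 1) := by gcongr
      _ = M := by ring
  have hswap := intervalIntegral_intervalIntegral_swap (F := f) (a := 1) (b := ρ) (c := 0) (d := 2)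
    (by rwa [IntegrableOn, Measure.volume_eq_prod, ← Measure.prod_restrict])
  have hleft : ∫ r in (1 : ℝ)..ρ, ∫ t in (0 : ℝ)..2, f r t ≤ c / (1 - s) := by
    have h1 : ∫ r in (1 : ℝ)..ρ, c * r ^ (s - 2) = c / (1 - s) * (1 - ρ ^ (s - 1)) := by
      rw [intervalIntegral.integral_const_mul, integral_rpow (Or.inr ⟨by linarith, by
        rw [uIcc_of_le hρ]; exact fun h => by linarith [h.1]⟩)]
      rw [show s - 2 + 1 = s - 1 by ring, Real.one_rpow]
      have : s - 1 ≠ 0 := by linarith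
      have : 1 - s ≠ 0 := by linarith
      field_simp
      ring
    have h2 : c / (1 - s) * (1 - ρ ^ (s - 1)) ≤ c / (1 - s) :=
      mul_le_of_le_one_right (div_nonneg hc (by linarith))
        (by linarith [Real.rpow_nonneg hρ0.le (s - 1)])
    refine le_trans ?_ (h1.le.trans h2)
    refine intervalIntegral.integral_mono_on hρ ?_ ?_ fun r hr => ?_
    · rw [intervalIntegrable_iff]
      have := hfint.integral_prod_left
      refine this.congr (Filter.Eventually.of_forall fun r => ?_)
      simp only [Function.uncurry]
      rw [intervalIntegral.integral_of_le zero_le_two, uIoc_of_le zero_le_two]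
    · refine (ContinuousOn.intervalIntegrable ?_)
      rw [uIcc_of_le hρ]
      exact continuousOn_const.mul (continuousOn_id.rpow_const fun r hr =>
        Or.inl (by have := hr.1; simp only [id]; linarith))
    · have hr0 : 0 < r := by linarith [hr.1]
      simp only [f]
      rw [intervalIntegral.integral_const_mul]
      have := mul_le_mul_of_nonneg_left (hineq r hr.1) (Real.rpow_nonneg hr0.le (s - 1))
      refine this.trans (le_of_eq ?_)
      have h3 : r ^ (s - 2) = r ^ (s - 1) / r := by
        rw [← Real.rpow_sub_one hr0.ne']
        ring_nf
      rw [h3]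
      ring
  rw [hswap] at hleft
  refine le_trans (le_of_eq ?_) hleft
  refine intervalIntegral.integral_congr_ae (Filter.Eventually.of_forall fun t ht => ?_)
  rw [uIoc_of_le zero_le_two] at ht
  have ht0 : 0 < t := ht.1
  simp only [f]
  rw [intervalIntegral.integral_interval_sub_left (hI _ _) (hI _ _)]
  have h1 := intervalIntegral.smul_integral_comp_mul_right (a := 1) (b := ρ)
    (fun u => u ^ (s - 1) * F u) t
  rw [one_mul, smul_eq_mul] at h1
  rw [← h1]
  have h2 : ∀ r ∈ uIcc 1 ρ, (r * t) ^ (s - 1) * F (r * t) =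
      t ^ (s - 1) * (r ^ (s - 1) * F (r * t)) := by
    intro r hr
    rw [uIcc_of_le hρ] at hr
    rw [Real.mul_rpow (by linarith [hr.1]) ht0.le]
    ring
  rw [intervalIntegral.integral_congr h2, intervalIntegral.integral_const_mul]
  have h3 : t ^ (-s) * (t * t ^ (s - 1)) = 1 := by
    rw [Real.rpow_sub_one ht0.ne', mul_div_cancel₀ _ ht0.ne', ← Real.rpow_add ht0]
    simp
  have h4 : ∀ r, r ^ (s - 1) * (K t * F (r * t)) = K t * (r ^ (s - 1) * F (r * t)) :=
    fun r => by ring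
  simp_rw [h4]
  rw [intervalIntegral.integral_const_mul]
  calc K t * t ^ (-s) * (t * (t ^ (s - 1) * ∫ r in (1 : ℝ)..ρ, r ^ (s - 1) * F (r * t)))
      = (t ^ (-s) * (t * t ^ (s - 1))) * (K t * ∫ r in (1 : ℝ)..ρ, r ^ (s - 1) * F (r * t)) := by
        ring
    _ = _ := by rw [h3, one_mul]

/-- A bounded antitone function satisfying the integral inequality decays like `r ^ (-s)`. -/
theorem exists_decay (hK : Continuous K) (hmono : StrictMonoOn K (Icc 0 2)) (h1 : K 1 < 0)
    (h2 : 0 < K 2) (hs0 : 0 < s) (hs1 : s < 1) (hz : ∫ t in (0 : ℝ)..2, K t * t ^ (-s) = 0)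
    (hc : 0 ≤ c) :
    ∃ C : ℝ, 0 < C ∧ ∀ F : ℝ → ℝ, Antitone F → (∀ t, 0 ≤ F t) → (∀ t, F t ≤ 1) →
      (∀ r, 1 ≤ r → ∫ t in (0 : ℝ)..2, K t * F (r * t) ≤ c / r) →
      ∀ r, 0 < r → F r ≤ C * r ^ (-s) := by
  obtain ⟨t₀, ⟨ht1, ht2⟩, hKt⟩ := exists_zero_of_strictMonoOn hK h1 h2
  obtain ⟨M, hM⟩ := (isCompact_Icc (a := (0 : ℝ)) (b := 2)).exists_bound_of_continuousOn
    hK.continuousOn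
  simp only [Real.norm_eq_abs] at hM
  have hM0 : 0 ≤ M := (abs_nonneg _).trans (hM 0 ⟨le_rfl, zero_le_two⟩)
  have ht0 : 0 < t₀ := by linarith
  -- Any point strictly between t₀ and 2 would do: it must leave an interval on which `K` is bounded
  -- below by a positive constant.
  let t₁ := (t₀ + 2) / 2
  have ht01 : t₀ < t₁ := by simp only [t₁]; linarith
  have ht12 : t₁ < 2 := by simp only [t₁]; linarith
  have ht10 : 0 < t₁ := by linarith
  have hKt1 : 0 < K t₁ := hKt ▸ hmono ⟨ht0.le, ht2.le⟩ ⟨ht10.le, ht12.le⟩ ht01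
  -- The first summand comes from `integrated_inequality`, the second bounds the integral of K(t)
  -- t^(-s) Φ(t), using Φ(t) ≤ t^s / s.
  let C₁ := c / (1 - s) + 2 * (M / s)
  have hC₁ : 0 ≤ C₁ := add_nonneg (div_nonneg hc (by linarith)) (by positivity)
  let γ := (2 - t₁) * (K t₁ * 2 ^ (-s) * ((t₁ - t₀) * t₁ ^ (s - 1)))
  have hγ : 0 < γ := by
    have : 0 < 2 - t₁ := by linarith
    have : 0 < t₁ - t₀ := by linarith
    positivity
  -- The factor 2^s comes from setting r = 2ρ, and the summand 1 covers r ≤ 2, where only F ≤ 1 is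
  -- available. The constant is chosen before `F`, so it does not depend on the processes.
  refine ⟨2 ^ s * (C₁ / γ + 1), by positivity, fun F hF hF0 hF1 hineq r hr => ?_⟩
  have hI := intervalIntegrable_rpow_mul_antitone hs0 hF
  have main : ∀ ρ, 1 ≤ ρ → F (2 * ρ) * ρ ^ s ≤ C₁ / γ := by
    intro ρ hρ
    have hρ0 : 0 < ρ := by linarith
    let Φ : ℝ → ℝ := fun x => ∫ u in (0 : ℝ)..x, u ^ (s - 1) * F u
    have hΦc : Continuous Φ := continuous_primitive_rpow_mul hs0 hF
    have hΦmono : ∀ x y, 0 ≤ x → x ≤ y → Φ x ≤ Φ y := by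
      intro x y hx hxy
      have := primitive_nonneg (s := s) hF0 hx hxy
      rw [← intervalIntegral.integral_interval_sub_left (hI 0 y) (hI 0 x)] at this
      exact sub_nonneg.mp this
    have hint := integrated_inequality hK hM hs0 hs1 hF hF0 hF1 hc hineq hρ
    have i1 := intervalIntegrable_mul_rpow hK hs1 0 2
    have i2 : IntervalIntegrable (fun t => K t * t ^ (-s) * Φ (ρ * t)) volume 0 2 :=
      i1.mul_continuousOn (hΦc.comp (continuous_const_mul ρ)).continuousOn
    have i3 : IntervalIntegrable (fun t => K t * t ^ (-s) * Φ t) volume 0 2 :=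
      i1.mul_continuousOn hΦc.continuousOn
    have i4 : IntervalIntegrable (fun t => K t * t ^ (-s) * Φ (ρ * t₀)) volume 0 2 :=
      i1.mul_const _
    have e1 : ∫ t in (0 : ℝ)..2, K t * t ^ (-s) * (Φ (ρ * t) - Φ t) =
        (∫ t in (0 : ℝ)..2, K t * t ^ (-s) * Φ (ρ * t)) -
          ∫ t in (0 : ℝ)..2, K t * t ^ (-s) * Φ t := by
      rw [← intervalIntegral.integral_sub i2 i3]
      simp only [mul_sub]
    -- Here the exponent equation is used: subtracting a constant from Φ(ρt) does not change the
    -- integral.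
    have e2 : ∫ t in (0 : ℝ)..2, K t * t ^ (-s) * (Φ (ρ * t) - Φ (ρ * t₀)) =
        ∫ t in (0 : ℝ)..2, K t * t ^ (-s) * Φ (ρ * t) := by
      simp only [mul_sub]
      rw [intervalIntegral.integral_sub i2 i4, intervalIntegral.integral_mul_const, hz, zero_mul,
        sub_zero]
    have e3 : ∫ t in (0 : ℝ)..2, K t * t ^ (-s) * Φ t ≤ 2 * (M / s) := by
      have : ∫ t in (0 : ℝ)..2, M / s = 2 * (M / s) := by
        rw [intervalIntegral.integral_const, smul_eq_mul, sub_zero]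
      rw [← this]
      refine intervalIntegral.integral_mono_on_of_le_Ioo zero_le_two i3 intervalIntegrable_const
        fun t ht => ?_
      have hΦ0 : 0 ≤ Φ t := primitive_nonneg hF0 le_rfl ht.1.le
      have hΦ1 : Φ t ≤ t ^ s / s := primitive_le hs0 hF hF1 ht.1.le
      have hK' : K t ≤ M := (le_abs_self _).trans (hM t ⟨ht.1.le, ht.2.le⟩)
      have hts : 0 < t ^ (-s) := Real.rpow_pos_of_pos ht.1 _
      calc K t * t ^ (-s) * Φ t ≤ M * t ^ (-s) * (t ^ s / s) := by gcongr
        _ = M / s * (t ^ (-s) * t ^ s) := by ring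
        _ = M / s := by rw [← Real.rpow_add ht.1]; simp
    have hupper : ∫ t in (0 : ℝ)..2, K t * t ^ (-s) * (Φ (ρ * t) - Φ (ρ * t₀)) ≤ C₁ := by
      rw [e2]
      have : ∫ t in (0 : ℝ)..2, K t * t ^ (-s) * (Φ (ρ * t) - Φ t) ≤ c / (1 - s) := hint
      rw [e1] at this
      simp only [C₁]
      linarith
    have i5 : ∀ a b, IntervalIntegrable
        (fun t => K t * t ^ (-s) * (Φ (ρ * t) - Φ (ρ * t₀))) volume a b := fun a b =>
      (intervalIntegrable_mul_rpow hK hs1 a b).mul_continuousOn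
        ((hΦc.comp (continuous_const_mul ρ)).sub continuous_const).continuousOn
    -- Both `K` and the increment of Φ change sign from negative to positive at t₀, so their product
    -- is nonnegative.
    have p1 : 0 ≤ ∫ t in (0 : ℝ)..t₁, K t * t ^ (-s) * (Φ (ρ * t) - Φ (ρ * t₀)) := by
      refine intervalIntegral.integral_nonneg ht10.le fun t ht => ?_
      have hts : 0 ≤ t ^ (-s) := Real.rpow_nonneg ht.1 _
      rcases le_total t t₀ with h | h
      · have hk : K t ≤ 0 := hKt ▸ hmono.monotoneOn ⟨ht.1, by linarith⟩ ⟨ht0.le, ht2.le⟩ h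
        have hφ := hΦmono (ρ * t) (ρ * t₀) (mul_nonneg hρ0.le ht.1) (by gcongr)
        exact mul_nonneg_of_nonpos_of_nonpos (mul_nonpos_of_nonpos_of_nonneg hk hts)
          (sub_nonpos.mpr hφ)
      · have hk : 0 ≤ K t := hKt ▸ hmono.monotoneOn ⟨ht0.le, ht2.le⟩ ⟨ht.1, by linarith [ht.2]⟩ h
        have hφ := hΦmono (ρ * t₀) (ρ * t) (by positivity) (by gcongr)
        exact mul_nonneg (mul_nonneg hk hts) (sub_nonneg.mpr hφ)
    have hΦdiff : ρ ^ s * ((t₁ - t₀) * t₁ ^ (s - 1)) * F (2 * ρ) ≤ Φ (ρ * t₁) - Φ (ρ * t₀) := by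
      have h3 := primitive_sub_ge hs0 hs1 hF hF0 (x := ρ * t₀) (y := ρ * t₁) (by positivity)
        (by gcongr)
      rw [← intervalIntegral.integral_interval_sub_left (hI 0 _) (hI 0 _)] at h3
      refine le_trans ?_ h3
      have h4 : F (2 * ρ) ≤ F (ρ * t₁) := hF (by nlinarith)
      have h5 : ρ * t₁ - ρ * t₀ = ρ * (t₁ - t₀) := by ring
      have h6 : (ρ * t₁) ^ (s - 1) = ρ ^ s / ρ * t₁ ^ (s - 1) := by
        rw [Real.mul_rpow hρ0.le ht10.le, Real.rpow_sub_one hρ0.ne']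
      have h7 : 0 ≤ t₁ - t₀ := by linarith
      rw [h5, h6]
      calc ρ ^ s * ((t₁ - t₀) * t₁ ^ (s - 1)) * F (2 * ρ)
          ≤ ρ ^ s * ((t₁ - t₀) * t₁ ^ (s - 1)) * F (ρ * t₁) := by gcongr
        _ = ρ * (t₁ - t₀) * (ρ ^ s / ρ * t₁ ^ (s - 1) * F (ρ * t₁)) := by
          field_simp
    have p2 : (2 - t₁) * (K t₁ * 2 ^ (-s) * (Φ (ρ * t₁) - Φ (ρ * t₀))) ≤
        ∫ t in t₁..2, K t * t ^ (-s) * (Φ (ρ * t) - Φ (ρ * t₀)) := by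
      have : ∫ t in t₁..2, K t₁ * 2 ^ (-s) * (Φ (ρ * t₁) - Φ (ρ * t₀)) =
          (2 - t₁) * (K t₁ * 2 ^ (-s) * (Φ (ρ * t₁) - Φ (ρ * t₀))) := by
        rw [intervalIntegral.integral_const, smul_eq_mul]
      rw [← this]
      refine intervalIntegral.integral_mono_on ht12.le intervalIntegrable_const (i5 _ _)
        fun t ht => ?_
      have htp : 0 < t := by linarith [ht.1]
      have h3 : K t₁ ≤ K t := hmono.monotoneOn ⟨ht10.le, ht12.le⟩ ⟨htp.le, ht.2⟩ ht.1
      have h4 : (2 : ℝ) ^ (-s) ≤ t ^ (-s) := Real.rpow_le_rpow_of_nonpos htp ht.2 (by linarith)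
      have h5 : Φ (ρ * t₁) ≤ Φ (ρ * t) := hΦmono _ _ (by positivity) (by gcongr; exact ht.1)
      have h6 : Φ (ρ * t₀) ≤ Φ (ρ * t₁) := hΦmono _ _ (by positivity) (by gcongr)
      have h7 : 0 ≤ Φ (ρ * t₁) - Φ (ρ * t₀) := sub_nonneg.mpr h6
      have h8 : 0 ≤ K t := hKt1.le.trans h3
      gcongr
    have htotal := intervalIntegral.integral_add_adjacent_intervals (i5 0 t₁) (i5 t₁ 2)
    rw [le_div_iff₀ hγ]
    have h2t : 0 ≤ 2 - t₁ := by linarith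
    have hfin : F (2 * ρ) * ρ ^ s * γ ≤
        (2 - t₁) * (K t₁ * 2 ^ (-s) * (Φ (ρ * t₁) - Φ (ρ * t₀))) := by
      calc F (2 * ρ) * ρ ^ s * γ = (2 - t₁) * (K t₁ * 2 ^ (-s) *
            (ρ ^ s * ((t₁ - t₀) * t₁ ^ (s - 1)) * F (2 * ρ))) := by simp only [γ]; ring
        _ ≤ _ := by gcongr
    linarith
  have hrs : r ^ s * r ^ (-s) = 1 := by rw [← Real.rpow_add hr]; simp
  have hrsn : 0 < r ^ (-s) := Real.rpow_pos_of_pos hr _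
  have hq : 0 ≤ C₁ / γ := by positivity
  rcases le_total 2 r with h | h
  · have h3 := main (r / 2) (by linarith)
    rw [show 2 * (r / 2) = r by ring, Real.div_rpow hr.le zero_le_two] at h3
    have h2s : (0 : ℝ) < 2 ^ s := by positivity
    have h4 : F r * r ^ s ≤ 2 ^ s * (C₁ / γ) := by
      have := mul_le_mul_of_nonneg_left h3 h2s.le
      calc F r * r ^ s = 2 ^ s * (F r * (r ^ s / 2 ^ s)) := by field_simp
        _ ≤ _ := this
    calc F r = F r * r ^ s * r ^ (-s) := by rw [mul_assoc, hrs, mul_one]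
      _ ≤ 2 ^ s * (C₁ / γ) * r ^ (-s) := by gcongr
      _ ≤ 2 ^ s * (C₁ / γ + 1) * r ^ (-s) := by gcongr; linarith
  · have h3 : r ^ s ≤ 2 ^ s := Real.rpow_le_rpow hr.le h hs0.le
    calc F r ≤ 1 := hF1 r
      _ = r ^ s * r ^ (-s) := hrs.symm
      _ ≤ 2 ^ s * r ^ (-s) := by gcongr
      _ ≤ 2 ^ s * (C₁ / γ + 1) * r ^ (-s) := by
        gcongr
        exact le_mul_of_one_le_right (by positivity) (by linarith)

end Decay

end StableMatching

/-! ### The concrete kernel and the exponent equation. -/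

namespace StableMatching

section Kernel

/-- The kernel whose truncated Mellin transform vanishes at the exponent. -/
def exponentKernel (n : ℕ) (t : ℝ) : ℝ :=
  2 * ((n + 1) * ballVolume (n + 1)) * max (t - 1) 0 ^ n - ballVolume n * √(1 - (t / 2) ^ 2) ^ n

lemma continuous_exponentKernel (n : ℕ) : Continuous (exponentKernel n) := by
  unfold exponentKernel
  fun_prop

lemma strictMonoOn_exponentKernel {n : ℕ} (hn : n ≠ 0) :
    StrictMonoOn (exponentKernel n) (Set.Icc 0 2) := by
  intro t ht t' ht' hlt
  have h1 : max (t - 1) 0 ^ n ≤ max (t' - 1) 0 ^ n :=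
    pow_le_pow_left₀ (le_max_right _ _) (max_le_max (by linarith) le_rfl) n
  have h2 : √(1 - (t' / 2) ^ 2) ^ n < √(1 - (t / 2) ^ 2) ^ n := by
    refine pow_lt_pow_left₀ (Real.sqrt_lt_sqrt ?_ ?_) (Real.sqrt_nonneg _) hn
    · nlinarith [ht'.1, ht'.2]
    · nlinarith [ht.1, ht'.2]
  have h3 := mul_lt_mul_of_pos_left h2 (ballVolume_pos n)
  have h4 : 0 ≤ 2 * (((n : ℝ) + 1) * ballVolume (n + 1)) := by
    have := ballVolume_pos (n + 1); positivity
  have h5 := mul_le_mul_of_nonneg_left h1 h4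
  simp only [exponentKernel]
  linarith

lemma exponentKernel_one_neg {n : ℕ} (hn : n ≠ 0) : exponentKernel n 1 < 0 := by
  have h : 0 < √(1 - ((1 : ℝ) / 2) ^ 2) := Real.sqrt_pos.mpr (by norm_num)
  have := mul_pos (ballVolume_pos n) (pow_pos h n)
  simp only [exponentKernel, sub_self, max_self, zero_pow hn, mul_zero]
  linarith

lemma exponentKernel_two_pos {n : ℕ} (hn : n ≠ 0) : 0 < exponentKernel n 2 := by
  have h : max ((2 : ℝ) - 1) 0 = 1 := by norm_num
  have h' : √(1 - ((2 : ℝ) / 2) ^ 2) = 0 := by norm_num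
  have := ballVolume_pos (n + 1)
  simp only [exponentKernel, h, h', zero_pow hn, one_pow]
  simp only [mul_one, mul_zero, sub_zero]
  positivity

/-- The positive part in `exponentKernel` merges integrals over [1, 2] and [0, 2] into one. Its
power vanishes on [0, 1] only because n ≠ 0. -/
lemma integral_exponentKernel_mul {n : ℕ} (hn : n ≠ 0) {g : ℝ → ℝ}
    (hg : IntervalIntegrable g volume 0 2) :
    ∫ t in (0 : ℝ)..2, exponentKernel n t * g t =
      2 * ((n + 1) * ballVolume (n + 1)) * (∫ t in (1 : ℝ)..2, (t - 1) ^ n * g t) -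
        ballVolume n * ∫ t in (0 : ℝ)..2, √(1 - (t / 2) ^ 2) ^ n * g t := by
  have i1 : IntervalIntegrable (fun t => max (t - 1) 0 ^ n * g t) volume 0 2 :=
    hg.continuousOn_mul (by fun_prop)
  have i2 : IntervalIntegrable (fun t => √(1 - (t / 2) ^ 2) ^ n * g t) volume 0 2 :=
    hg.continuousOn_mul (by fun_prop)
  have e1 : ∫ t in (0 : ℝ)..2, max (t - 1) 0 ^ n * g t = ∫ t in (1 : ℝ)..2, (t - 1) ^ n * g t := by
    have h01 : (1 : ℝ) ∈ Set.uIcc 0 2 := by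
      rw [Set.uIcc_of_le zero_le_two]; exact ⟨zero_le_one, one_le_two⟩
    rw [← intervalIntegral.integral_add_adjacent_intervals
      (i1.mono_set (Set.uIcc_subset_uIcc_left h01))
      (i1.mono_set (Set.uIcc_subset_uIcc_right h01))]
    have z : ∫ t in (0 : ℝ)..1, max (t - 1) 0 ^ n * g t = 0 := by
      refine intervalIntegral.integral_zero_ae (Filter.Eventually.of_forall fun t ht => ?_)
      rw [Set.uIoc_of_le zero_le_one] at ht
      rw [max_eq_right (by linarith [ht.2]), zero_pow hn, zero_mul]
    rw [z, zero_add]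
    refine intervalIntegral.integral_congr fun t ht => ?_
    rw [Set.uIcc_of_le one_le_two] at ht
    rw [max_eq_left (by linarith [ht.1])]
  rw [← e1, ← intervalIntegral.integral_const_mul, ← intervalIntegral.integral_const_mul,
    ← intervalIntegral.integral_sub (i1.const_mul _) (i2.const_mul _)]
  refine intervalIntegral.integral_congr fun t _ => ?_
  simp only [exponentKernel]
  ring

/-- With κ the volume of the unit ball in dimension n + 1, the integral is 2κ - κ = κ. -/
lemma integral_exponentKernel_pos {n : ℕ} (hn : n ≠ 0) :
    0 < ∫ t in (0 : ℝ)..2, exponentKernel n t := by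
  have h := integral_exponentKernel_mul hn (g := fun _ => 1) intervalIntegrable_const
  simp only [mul_one] at h
  have hv := ballVolume_succ_mul hn one_pos
  simp only [one_pow, mul_one] at hv
  have hp : ∫ t in (1 : ℝ)..2, (t - 1) ^ n = 1 / (n + 1) := by
    rw [intervalIntegral.integral_comp_sub_right (fun t => t ^ n) 1, integral_pow]
    norm_num
  rw [h, hp, ← hv]
  have := ballVolume_pos (n + 1)
  have hn1 : ((n : ℝ) + 1) ≠ 0 := by positivity
  have e : 2 * (((n : ℝ) + 1) * ballVolume (n + 1)) * (1 / (n + 1)) = 2 * ballVolume (n + 1) := by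
    field_simp
  rw [e]
  linarith

lemma exponentEquation_iff {n : ℕ} (hn : n ≠ 0) {s : ℝ} (hs : s < 1) :
    ExponentEquation (n + 1) s ↔ ∫ t in (0 : ℝ)..2, exponentKernel n t * t ^ (-s) = 0 := by
  rw [integral_exponentKernel_mul hn (intervalIntegral.intervalIntegrable_rpow' (by linarith)),
    ExponentEquation, sphereVolume_eq, sphereVolume_eq, sub_eq_zero]
  have hn' : (n : ℝ) ≠ 0 := by exact_mod_cast hn
  have e1 : ((n + 1 : ℕ) : ℝ) - 1 = n := by push_cast; ring
  have e2 : (n : ℝ) * ballVolume n / n = ballVolume n := by field_simp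
  have e3 : ∫ t in (0 : ℝ)..2, (1 - (t / 2) ^ 2) ^ ((n : ℝ) / 2) * t ^ (-s) =
      ∫ t in (0 : ℝ)..2, √(1 - (t / 2) ^ 2) ^ n * t ^ (-s) := by
    refine intervalIntegral.integral_congr fun t ht => ?_
    rw [Set.uIcc_of_le zero_le_two] at ht
    have h0 : 0 ≤ 1 - (t / 2) ^ 2 := by nlinarith [ht.1, ht.2]
    rw [Real.sqrt_eq_rpow, ← Real.rpow_mul_natCast h0, one_div_mul_eq_div]
  simp only [Nat.add_sub_cancel, e1, e2, e3]
  push_cast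
  rfl

end Kernel

/-! ### Points matched far away or not at all. -/

section Tail

variable {d : ℕ} {a b : Configuration d × Configuration d → Space d → ℝ≥0∞}
  {ρ β : Measure (Configuration d)} {μ : Measure (Space d)}

/-- The complement of `a w x < t` includes the unmatched points, which `μ` does not see; they are
reached by subtracting from the intensity of all points, which needs a finite integral of `f`. -/
lemma lintegral_points_compl {Q : Measure (Configuration d × Configuration d)}
    {c : Configuration d × Configuration d → Configuration d} (hc : Measurable c)
    {a : Configuration d × Configuration d → Space d → ℝ≥0∞}
    (ha : Measurable (Function.uncurry a)) {f : Space d → ℝ≥0∞} (hf : Measurable f)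
    (hfi : ∫⁻ x, f x ≠ ∞) {t m : ℝ≥0∞}
    (hall : ∫⁻ w, ∫⁻ x, f x ∂(c w).toMeasure ∂Q = ∫⁻ x, f x) (hm : m ≤ 1)
    (hlt : ∫⁻ w, ∫⁻ x, (if a w x < t then f x else 0) ∂(c w).toMeasure ∂Q = (∫⁻ x, f x) * m) :
    ∫⁻ w, ∫⁻ x, (if a w x < t then 0 else f x) ∂(c w).toMeasure ∂Q =
      (∫⁻ x, f x) * (1 - m) := by
  have hset : MeasurableSet
      {p : (Configuration d × Configuration d) × Space d | a p.1 p.2 < t} :=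
    measurableSet_lt ha measurable_const
  have m1 : Measurable fun p : (Configuration d × Configuration d) × Space d =>
      if a p.1 p.2 < t then f p.2 else 0 :=
    Measurable.ite hset (hf.comp measurable_snd) measurable_const
  have hsplit : ∫⁻ w, ∫⁻ x, f x ∂(c w).toMeasure ∂Q =
      ∫⁻ w, ∫⁻ x, (if a w x < t then f x else 0) ∂(c w).toMeasure ∂Q +
      ∫⁻ w, ∫⁻ x, (if a w x < t then 0 else f x) ∂(c w).toMeasure ∂Q := by
    rw [← lintegral_add_left (measurable_lintegral_points hc
      (g := fun p => if a p.1 p.2 < t then f p.2 else 0) m1)]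
    refine lintegral_congr fun w => ?_
    have m2 : Measurable fun x => if a w x < t then f x else 0 := m1.comp measurable_prodMk_left
    rw [← lintegral_add_left m2]
    refine lintegral_congr fun x => ?_
    split_ifs <;> simp
  rw [hall, hlt] at hsplit
  have hmf : (∫⁻ x, f x) * m ≠ ∞ := ENNReal.mul_ne_top hfi (ne_top_of_le_ne_top ENNReal.one_ne_top hm)
  rw [ENNReal.mul_sub (fun _ _ => hfi), mul_one]
  exact ENNReal.eq_sub_of_add_eq hmf ((add_comm _ _).trans hsplit.symm)

lemma IsDisplacement.lintegral_red_ge (h : IsDisplacement ρ β a b μ) {f : Space d → ℝ≥0∞}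
    (hf : Measurable f) (hfi : ∫⁻ x, f x ≠ ∞) (t : ℝ≥0∞) :
    ∫⁻ w, ∫⁻ x, (if a w x < t then 0 else f x) ∂w.1.toMeasure ∂ρ.prod β =
      (∫⁻ x, f x) * (1 - μ {z | ‖z‖ₑ < t}) := by
  refine lintegral_points_compl measurable_fst h.stationary.measurable_red hf hfi
    (lintegral_fst_points h.red h.blue hf)
    ((measure_mono (Set.subset_univ _)).trans h.measure_univ_le_one) ?_
  rw [h.lintegral_red_lt hf (measurable_const (a := t)), lintegral_mul_const _ hf]

lemma IsDisplacement.lintegral_blue_ge (h : IsDisplacement ρ β a b μ) {f : Space d → ℝ≥0∞}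
    (hf : Measurable f) (hfi : ∫⁻ x, f x ≠ ∞) (t : ℝ≥0∞) :
    ∫⁻ w, ∫⁻ x, (if b w x < t then 0 else f x) ∂w.2.toMeasure ∂ρ.prod β =
      (∫⁻ x, f x) * (1 - μ {z | ‖z‖ₑ < t}) := by
  refine lintegral_points_compl measurable_snd h.stationary.measurable_blue hf hfi
    (lintegral_snd_points h.red h.blue hf)
    ((measure_mono (Set.subset_univ _)).trans h.measure_univ_le_one) ?_
  rw [h.lintegral_blue_lt hf (measurable_const (a := t)), lintegral_mul_const _ hf]

lemma ae_forall_points_lt_top {Q : Measure (Configuration d × Configuration d)}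
    {c : Configuration d × Configuration d → Configuration d} (hc : Measurable c)
    {a : Configuration d × Configuration d → Space d → ℝ≥0∞}
    (ha : Measurable (Function.uncurry a))
    (h0 : ∀ f : Space d → ℝ≥0∞, Measurable f → ∫⁻ x, f x ≠ ∞ →
      ∫⁻ w, ∫⁻ x, (if a w x < ∞ then 0 else f x) ∂(c w).toMeasure ∂Q = 0) :
    ∀ᵐ w ∂Q, ∀ x ∈ (c w).points, a w x < ∞ := by
  have key : ∀ n : ℕ, ∀ᵐ w ∂Q, ∀ x ∈ (c w).points, ‖x‖ < n → a w x < ∞ := by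
    intro n
    let f : Space d → ℝ≥0∞ := (Metric.ball 0 n).indicator 1
    have hf : Measurable f := measurable_one.indicator measurableSet_ball
    have hz := h0 f hf (by
      rw [lintegral_indicator_one measurableSet_ball]; exact measure_ball_lt_top.ne)
    have hset : MeasurableSet
        {p : (Configuration d × Configuration d) × Space d | a p.1 p.2 < ∞} :=
      measurableSet_lt ha measurable_const
    have hm : Measurable fun w => ∫⁻ x, (if a w x < ∞ then 0 else f x) ∂(c w).toMeasure :=
      measurable_lintegral_points hc (g := fun p => if a p.1 p.2 < ∞ then 0 else f p.2)
        (Measurable.ite hset measurable_const (hf.comp measurable_snd))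
    rw [lintegral_eq_zero_iff hm] at hz
    filter_upwards [hz] with w hw x hx hxn
    by_contra hcon
    simp only [Pi.zero_apply, Configuration.lintegral_toMeasure, ENNReal.tsum_eq_zero] at hw
    have := hw ⟨x, hx⟩
    rw [if_neg hcon] at this
    simp [f, hxn] at this
  filter_upwards [ae_all_iff.mpr key] with w hw x hx
  obtain ⟨n, hn⟩ := exists_nat_gt ‖x‖
  exact hw n x hx hn

lemma isBounded_unitCube (d : ℕ) : Bornology.IsBounded (unitCube d) := by
  refine (Metric.isBounded_iff_subset_closedBall 0).mpr ⟨√d, fun x hx => ?_⟩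
  rw [mem_closedBall_zero_iff, EuclideanSpace.norm_eq]
  refine Real.sqrt_le_sqrt ?_
  calc ∑ i, ‖x i‖ ^ 2 ≤ ∑ _i : Fin d, (1 : ℝ) := by
        refine Finset.sum_le_sum fun i _ => ?_
        rw [Real.norm_eq_abs, sq_abs]
        nlinarith [(hx i).1, (hx i).2]
    _ = d := by simp

lemma measurableSet_unitCube (d : ℕ) : MeasurableSet (unitCube d) := by
  have : unitCube d = ⋂ i, ({x : Space d | 0 ≤ x i} ∩ {x | x i < 1}) := by
    ext x; simp [unitCube]
  rw [this]
  refine MeasurableSet.iInter fun i => ?_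
  have : Measurable fun x : Space d => x i := by fun_prop
  exact (measurableSet_le measurable_const this).inter (measurableSet_lt this measurable_const)

end Tail

/-! ### Uniqueness, perfectness and the tail bound. -/

section Main

/-- A power bound on the tail forces the displacement measure to have full mass. -/
lemma IsDisplacement.one_le_measure_univ {d : ℕ}
    {a b : Configuration d × Configuration d → Space d → ℝ≥0∞}
    {ρ β : Measure (Configuration d)} {μ : Measure (Space d)} (h : IsDisplacement ρ β a b μ)
    {C s : ℝ} (hs : 0 < s) (ht : ∀ r, 0 < r → tailReal μ r ≤ C * r ^ (-s)) :
    1 ≤ μ Set.univ := by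
  have := h.finite
  have hle : 1 - (μ Set.univ).toReal ≤ 0 := by
    have hlim : Filter.Tendsto (fun r : ℝ => C * r ^ (-s)) Filter.atTop (nhds (C * 0)) :=
      (tendsto_rpow_neg_atTop hs).const_mul C
    rw [mul_zero] at hlim
    refine ge_of_tendsto hlim ?_
    filter_upwards [Filter.eventually_gt_atTop 0] with r hr
    refine le_trans (sub_le_sub_left (ENNReal.toReal_mono (measure_ne_top _ _)
      (measure_mono (Set.subset_univ {z | ‖z‖ₑ < ENNReal.ofReal r}))) _) (ht r hr)
  rw [← ENNReal.toReal_le_toReal ENNReal.one_ne_top (measure_ne_top _ _), ENNReal.toReal_one]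
  linarith

variable {d : ℕ} {ρ β : Measure (Configuration d)}

/-- Almost surely the stable matching is unique and perfect, provided that the displacements
of stationary stable matchings are almost surely finite. -/
lemma ae_existsUnique_stable (hρ : IsPoissonLaw ρ) (hβ : IsPoissonLaw β)
    {μ : Measure (Space d)} (hμ : IsDisplacement ρ β (fun w => redOpt w.1.points w.2.points)
      (fun w => blueOpt w.1.points w.2.points) μ) (h1 : 1 ≤ μ Set.univ) :
    ∀ᵐ w ∂ρ.prod β,
      IsStablePartialMatching w.1.points w.2.points (distMatching w.1.points w.2.points
        (redOpt w.1.points w.2.points) (blueOpt w.1.points w.2.points)) ∧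
      IsPerfect w.1.points w.2.points (distMatching w.1.points w.2.points
        (redOpt w.1.points w.2.points) (blueOpt w.1.points w.2.points)) ∧
      ∀ m, IsStablePartialMatching w.1.points w.2.points m →
        m = distMatching w.1.points w.2.points
          (redOpt w.1.points w.2.points) (blueOpt w.1.points w.2.points) := by
  obtain ⟨μ', hfin', hprod'⟩ := (isStationarySolution_blueOpt (d := d)).exists_displacement hρ hβ
  have hμ' : IsDisplacement ρ β _ _ μ' :=
    ⟨hfin', hρ, hβ, isStationarySolution_blueOpt, hprod'⟩
  -- The solution best for red is compared with the one best for blue. Every stable matching without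
  -- ties lies between these two.
  have heq := hμ.ae_eq hμ'
    (fun w x hx => (isSolution_opt w.2 w.1).symm.redOpt_le hx)
    (fun w y hy => (isSolution_opt w.2 w.1).symm.le_blueOpt hy)
  have hun : {z : Space d | ‖z‖ₑ < ∞} = Set.univ := by ext z; simp
  have hzero : 1 - μ {z : Space d | ‖z‖ₑ < ∞} = 0 := by rw [hun]; exact tsub_eq_zero_of_le h1
  have hred := ae_forall_points_lt_top (Q := ρ.prod β) measurable_fst
    hμ.stationary.measurable_red fun f hf hfi => by
      rw [hμ.lintegral_red_ge hf hfi, hzero, mul_zero]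
  have hblue := ae_forall_points_lt_top (Q := ρ.prod β) measurable_snd
    hμ.stationary.measurable_blue fun f hf hfi => by
      rw [hμ.lintegral_blue_ge hf hfi, hzero, mul_zero]
  filter_upwards [heq, hred, hblue, ae_noTies hρ hβ, ae_noTies' hρ hβ] with w hw hr hb hUV hVU
  have hsol := isSolution_opt w.1 w.2
  refine ⟨hsol.isStablePartialMatching hUV hVU, ⟨fun x hx => hsol.exists_red hx (hr x hx),
    fun y hy => hsol.exists_blue hy (hb y hy)⟩, fun m hm => ?_⟩
  have hms := hm.isSolution hUV hVU
  -- The distances of `m` are squeezed between the two extremal solutions, which coincide on this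
  -- event.
  have hma : ∀ x ∈ w.1.points, redDist m x = redOpt w.1.points w.2.points x := fun x hx =>
    le_antisymm ((hms.symm.le_blueOpt hx).trans (hw x hx).ge) (hms.redOpt_le hx)
  refine hm.eq_distMatching hUV hma fun y hy => ?_
  rw [hms.2 y hy, hsol.2 y hy]
  exact le_antisymm (acceptDist_anti (fun x hx => (hma x hx).ge) y)
    (acceptDist_anti (fun x hx => (hma x hx).le) y)

/-- The tail of the distance to the partner, bounded by the tail of the displacement. -/
lemma palmProb_le {Ω : Type*} [MeasurableSpace Ω] {P : Measure Ω}
    {R B : Ω → Configuration d} (hR : Measurable R) (hB : Measurable B)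
    (hQ : P.map (fun ω => (R ω, B ω)) = ρ.prod β)
    {a b : Configuration d × Configuration d → Space d → ℝ≥0∞} {μ : Measure (Space d)}
    (hμ : IsDisplacement ρ β a b μ) {M : Ω → Set (Space d × Space d)}
    (hM : ∀ᵐ ω ∂P, ∀ x ∈ (R ω).points, redDist (M ω) x = a (R ω, B ω) x) (r : ℝ) :
    palmProb P R M (Set.Ioi (ENNReal.ofReal r)) ≤
      volume (unitCube d) * ENNReal.ofReal (tailReal μ r) := by
  have := hμ.finite
  have hcube := measurableSet_unitCube d
  let f : Space d → ℝ≥0∞ := (unitCube d).indicator 1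
  have hf : Measurable f := measurable_one.indicator hcube
  have hfi : ∫⁻ x, f x = volume (unitCube d) := lintegral_indicator_one hcube
  have hfin : ∫⁻ x, f x ≠ ∞ := by rw [hfi]; exact (isBounded_unitCube d).measure_lt_top.ne
  have hge := hμ.lintegral_red_ge hf hfin (ENNReal.ofReal r)
  have htail : 1 - μ {z | ‖z‖ₑ < ENNReal.ofReal r} = ENNReal.ofReal (tailReal μ r) := by
    rw [← hμ.ofReal_one_sub_tailReal, ← ENNReal.ofReal_one,
      ← ENNReal.ofReal_sub _ (sub_nonneg.mpr (tailReal_le_one μ r)), sub_sub_cancel]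
  have hset : MeasurableSet
      {p : (Configuration d × Configuration d) × Space d | a p.1 p.2 < ENNReal.ofReal r} :=
    measurableSet_lt hμ.stationary.measurable_red measurable_const
  have hm : Measurable fun w : Configuration d × Configuration d =>
      ∫⁻ x, (if a w x < ENNReal.ofReal r then 0 else f x) ∂w.1.toMeasure :=
    measurable_lintegral_points measurable_fst
      (g := fun p : (Configuration d × Configuration d) × Space d =>
        if a p.1 p.2 < ENNReal.ofReal r then 0 else f p.2)
      (Measurable.ite hset measurable_const (hf.comp measurable_snd))
  rw [← htail, ← hfi, ← hge, ← hQ, lintegral_map hm (hR.prodMk hB)]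
  refine lintegral_mono_ae ?_
  filter_upwards [hM] with ω hω
  have hS : MeasurableSet (unitCube d ∩ {x | ENNReal.ofReal r < a (R ω, B ω) x}) :=
    hcube.inter (measurableSet_lt measurable_const
      (hμ.stationary.measurable_red.comp measurable_prodMk_left))
  have hs : {x ∈ (R ω).points ∩ unitCube d | redDist (M ω) x ∈ Set.Ioi (ENNReal.ofReal r)} =
      (R ω).points ∩ (unitCube d ∩ {x | ENNReal.ofReal r < a (R ω, B ω) x}) := by
    ext x
    constructor
    · rintro ⟨⟨hx, hc⟩, hlt⟩
      exact ⟨hx, hc, lt_of_lt_of_eq hlt (hω x hx)⟩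
    · rintro ⟨hx, hc, hlt⟩
      exact ⟨⟨hx, hc⟩, lt_of_lt_of_eq hlt (hω x hx).symm⟩
  rw [hs]
  change (((R ω).count _ : ℕ∞) : ℝ≥0∞) ≤ _
  rw [← Configuration.toMeasure_apply _ hS, ← lintegral_indicator_one hS]
  -- Only an inequality is claimed: distance greater than `r` is bounded by distance at least `r`.
  refine lintegral_mono fun x => ?_
  by_cases hx : x ∈ unitCube d ∩ {x | ENNReal.ofReal r < a (R ω, B ω) x}
  · rw [Set.indicator_of_mem hx, if_neg (not_lt.mpr hx.2.le)]
    simp [f, hx.1]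
  · rw [Set.indicator_of_notMem hx]
    exact zero_le

end Main

end StableMatching

namespace StableMatching

section Main

/-- The two-color stable matching of independent Poisson laws is almost surely unique and perfect,
and the distance to the partner has a power tail, as soon as the displacement tail
inequality is turned into a decay estimate by `hdecay`. -/
lemma stableMatching_tail {n : ℕ} (hn : n ≠ 0) {s C : ℝ} (hs : 0 < s)
    (hdecay : ∀ F : ℝ → ℝ, Antitone F → (∀ t, 0 ≤ F t) → (∀ t, F t ≤ 1) →
      (∀ r, 1 ≤ r → ∫ t in (0 : ℝ)..2, exponentKernel n t * F (r * t) ≤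
        2 * √(ballVolume (n + 1)) / r) → ∀ r, 0 < r → F r ≤ C * r ^ (-s))
    {Ω : Type*} [MeasurableSpace Ω] {P : Measure Ω} [IsProbabilityMeasure P]
    {R B : Ω → Configuration (n + 1)} (hR : IsPoissonProcess R 1 P)
    (hB : IsPoissonProcess B 1 P) (hRB : IndepFun R B P) :
    (∀ᵐ ω ∂P, ∃ m : Set (Space (n + 1) × Space (n + 1)),
      IsStablePartialMatching (R ω).points (B ω).points m ∧
      IsPerfect (R ω).points (B ω).points m ∧
      ∀ m', IsStablePartialMatching (R ω).points (B ω).points m' → m' = m) ∧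
    ∀ M : Ω → Set (Space (n + 1) × Space (n + 1)),
      (∀ᵐ ω ∂P, IsStablePartialMatching (R ω).points (B ω).points (M ω)) →
      ∀ r : ℝ, 0 < r → palmProb P R M (Set.Ioi (ENNReal.ofReal r)) ≤
        volume (unitCube (n + 1)) * ENNReal.ofReal (C * r ^ (-s)) := by
  have hρ := hR.isPoissonLaw
  have hβ := hB.isPoissonLaw
  have hQ : P.map (fun ω => (R ω, B ω)) = (P.map R).prod (P.map B) :=
    (indepFun_iff_map_prod_eq_prod_map_map hR.measurable.aemeasurable
      hB.measurable.aemeasurable).mp hRB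
  obtain ⟨μ, hfin, hprod⟩ :=
    (isStationarySolution_redOpt (d := n + 1)).exists_displacement hρ hβ
  have hμ : IsDisplacement (P.map R) (P.map B) (fun w => redOpt w.1.points w.2.points)
      (fun w => blueOpt w.1.points w.2.points) μ :=
    ⟨hfin, hρ, hβ, isStationarySolution_redOpt, hprod⟩
  have htail : ∀ r, 0 < r → tailReal μ r ≤ C * r ^ (-s) := by
    refine hdecay _ (tailReal_antitone μ) (fun t => hμ.tailReal_nonneg t)
      (fun t => tailReal_le_one μ t) fun r hr => ?_
    have hi : IntervalIntegrable (fun t => tailReal μ (r * t)) volume 0 2 :=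
      Antitone.intervalIntegrable fun t t' htt =>
        tailReal_antitone μ (mul_le_mul_of_nonneg_left htt (zero_le_one.trans hr))
    rw [integral_exponentKernel_mul hn hi]
    linarith [hμ.tail_inequality hn hr]
  have hae := ae_existsUnique_stable hρ hβ hμ (hμ.one_le_measure_univ hs htail)
  rw [← hQ] at hae
  replace hae := ae_of_ae_map (hR.measurable.prodMk hB.measurable).aemeasurable hae
  refine ⟨?_, fun M hM r hr => ?_⟩
  · filter_upwards [hae] with ω hω
    exact ⟨_, hω⟩
  · refine (palmProb_le hR.measurable hB.measurable hQ hμ ?_ r).trans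
      (mul_le_mul_right (ENNReal.ofReal_le_ofReal (htail r hr)) _)
    -- No measurability of `M` is required, since almost surely it coincides with the matching built
    -- from `redOpt` and `blueOpt`.
    filter_upwards [hae, hM] with ω hω hMω x hx
    rw [hω.2.2 _ hMω]
    exact (isSolution_opt _ _).redDist_distMatching hx

end Main

end StableMatching

end

theorem mainTheorem2 (d : ℕ) (hd : 2 ≤ d) :
    ∃ s : ℝ, (0 < s ∧ s < 1 ∧ StableMatching.ExponentEquation d s) ∧
      (∀ s' : ℝ, 0 < s' → s' < 1 → StableMatching.ExponentEquation d s' → s' = s) ∧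
      ∃ C : ℝ, 0 < C ∧
        ∀ (Ω : Type*) [MeasurableSpace Ω] (P : Measure Ω) [IsProbabilityMeasure P]
          (R B : Ω → StableMatching.Configuration d),
          StableMatching.IsPoissonProcess R 1 P →
          StableMatching.IsPoissonProcess B 1 P →
          IndepFun R B P →
          (∀ᵐ ω ∂P, ∃ m : Set (StableMatching.Space d × StableMatching.Space d),
            StableMatching.IsStablePartialMatching (R ω).points (B ω).points m ∧
            StableMatching.IsPerfect (R ω).points (B ω).points m ∧
            ∀ m', StableMatching.IsStablePartialMatching (R ω).points (B ω).points m' →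
              m' = m) ∧
          ∀ M : Ω → Set (StableMatching.Space d × StableMatching.Space d),
            (∀ᵐ ω ∂P,
              StableMatching.IsStablePartialMatching (R ω).points (B ω).points (M ω)) →
            ∀ r : ℝ, 0 < r →
              StableMatching.palmProb P R M (Set.Ioi (ENNReal.ofReal r)) ≤
                ENNReal.ofReal (C * r ^ (-s)) := by
  obtain ⟨n, rfl⟩ : ∃ n, d = n + 1 := ⟨d - 1, by omega⟩
  have hn : n ≠ 0 := by omega
  have hK := StableMatching.continuous_exponentKernel n
  have hmono := StableMatching.strictMonoOn_exponentKernel hn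
  have h1 := StableMatching.exponentKernel_one_neg hn
  have h2 := StableMatching.exponentKernel_two_pos hn
  obtain ⟨s, hs0, hs1, hz⟩ := StableMatching.exponent_exists hK hmono h1 h2
    (StableMatching.integral_exponentKernel_pos hn)
  refine ⟨s, ⟨hs0, hs1, (StableMatching.exponentEquation_iff hn hs1).mpr hz⟩,
    fun s' _ hs1' hs' => StableMatching.exponent_unique hK hmono h1 h2 hs1' hs1
      ((StableMatching.exponentEquation_iff hn hs1').mp hs') hz, ?_⟩
  obtain ⟨C, hC, hdecay⟩ := StableMatching.exists_decay hK hmono h1 h2 hs0 hs1 hz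
    (c := 2 * √(StableMatching.ballVolume (n + 1))) (by positivity)
  have hfin : volume (StableMatching.unitCube (n + 1)) ≠ ∞ :=
    (StableMatching.isBounded_unitCube _).measure_lt_top.ne
  -- The volume of the cube is absorbed into the constant instead of being evaluated; the added 1
  -- makes positivity immediate.
  refine ⟨C * ((volume (StableMatching.unitCube (n + 1))).toReal + 1), by positivity,
    fun Ω _ P _ R B hR hB hRB => ?_⟩
  obtain ⟨hex, hbound⟩ := StableMatching.stableMatching_tail hn hs0 hdecay hR hB hRB
  refine ⟨hex, fun M hM r hr => (hbound M hM r hr).trans ?_⟩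
  have hpow : 0 ≤ C * r ^ (-s) := by positivity
  conv_lhs => rw [← ENNReal.ofReal_toReal hfin]
  rw [← ENNReal.ofReal_mul ENNReal.toReal_nonneg]
  refine ENNReal.ofReal_le_ofReal ?_
  nlinarith
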